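/- **Setting.** Let $\mathbb B_3=\langle\sigma_1,\sigma_2\mid\sigma_1\sigma_2\sigma_1=\sigma_2\sigma_1\sigma_2\rangle$ and $\Delta=(\sigma_1\sigma_2)^3$, so that $Z(\mathbb B_3)=\langle\Delta\rangle$. Identify $\mathbb B_3/Z(\mathbb B_3)$ with $\mathbf{PSL}(2,\mathbb Z)$ through $\sigma_1\mapsto\pm\begin{pmatrix}1&1\\0&1\end{pmatrix}$, $\sigma_2\mapsto\pm\begin{pmatrix}1&0\\-1&1\end{pmatrix}$. Put $x=\sigma_2^{-1}\sigma_1^{-1}Z(\mathbb B_3)$ and $y=\sigma_1\sigma_2\sigma_1Z(\mathbb B_3)$; then $\mathbf{PSL}(2,\mathbb Z)=\langle x,y\mid x^3=y^2=1\rangle$. A homogeneous space is a set with a transitive action. **Coverings.** A covering of a homogeneous $\mathbf{PSL}(2,\mathbb Z)$-space $\overline\Sigma$ is a homogeneous $\mathbb B_3$-space $\Sigma$ with a surjective $\mathbb B_3$-equivariant map $\pi:\Sigma\to\overline\Sigma$ such that $\pi(s)=\pi(s')$ implies $s=\Delta^m s'$ for some $m\in\mathbb Z$. A $\sigma_i$-cycle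 is a minimal non-empty subset of $\Sigma$ closed under $\sigma_i^{\pm1}$. The covering is with simply intersecting cycles if $|c_1\cap c_2|\le1$ for every $\sigma_1$-cycle $c_1$ and every $\sigma_2$-cycle $c_2$. The vertices of the (pointed) Schreier graph of $\overline\Sigma$ are the points of $\overline\Sigma$, and its arrows are $v\to xv$ and $v\to yv$. Write $V_x=\{v\in\overline\Sigma: xv=v\}$ and $V_{xy}=\{v\in\overline\Sigma: xyv=v\}$. **Immunity.** A quarantine is a non-empty $Q\subseteq\Sigma$ such that, for every $s\in\Sigma$, if two of $s,\ \sigma_2s,\ \sigma_1\sigma_2s$ lie in $Q$ then so does the third. A plague is a non-empty $P\subseteq\Sigma$ such that $\Sigma$ is the only quarantine containing $P$. For finite $\Sigma$, $imm(\Sigma)$ is the least size of a plague divided by $|\Sigma|$. **Weight.** For $i,j\ge1$ define $\omega'_{ij}=\omega'_{ji}$ by $$\omega'_{11}=1,\qquad \omega'_{2j}=\tfrac13\ (j\ge1),\qquad \omega'_{13}=\tfrac{11}{24},\qquad \omega'_{1j}=\tfrac12\ (j\ge4),\qquad \omega'_{3j}=\tfrac7{24}\ (j\ge3),\qquad \omega'_{ij}=\tfrac14\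 (i,j\ge4).$$ If $s\in\Sigma$ lies on a $\sigma_1$-cycle of length $i$ and on a $\sigma_2$-cycle of length $j$, then $\omega(s)=\omega'_{ij}+\varepsilon(s)$, where $\varepsilon(s)=0$ except in the following three cases. The exceptional spaces are understood up to isomorphism of $\mathbb B_3$-spaces. They are given on points $v_p[k]$, $k\in\mathbb Z/N$, and $v\xrightarrow{\,c\,}w$ means $v[k]\mapsto w[k+c]$. * $\varepsilon=\frac1{30}$ on the fiber $v_1[*]$ of $\Sigma^{5;3,2}_{4A}$. Here $N=5$. The element $\sigma_2^{-1}\sigma_1^{-1}$ acts by $v_1\xrightarrow{3}v_1$, $v_2\xrightarrow{-1}v_3\xrightarrow{0}v_4\xrightarrow{0}v_2$, and $\sigma_1\sigma_2\sigma_1$ acts by $v_1\xrightarrow{1}v_2\xrightarrow{0}v_1$, $v_3\xrightarrow{2}v_4\xrightarrow{-1}v_3$. * $\varepsilon=\frac1{12}$ on the fiber $v_3[*]$ of $\Sigma^{4;2,2}_{6A}$. Here $N=4$. The element $\sigma_2^{-1}\sigma_1^{-1}$ acts by $v_1\xrightarrow{-1}v_2\xrightarrow{0}v_3\xrightarrow{0}v_1$,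 $v_4\xrightarrow{-1}v_5\xrightarrow{0}v_6\xrightarrow{0}v_4$, and $\sigma_1\sigma_2\sigma_1$ acts by $v_1\xrightarrow{2}v_2\xrightarrow{-1}v_1$, $v_3\xrightarrow{0}v_4\xrightarrow{1}v_3$, $v_5\xrightarrow{2}v_6\xrightarrow{-1}v_5$. * $\varepsilon=\frac1{24}$ everywhere on the trivial covering of $\Sigma_{12C}$. Here $N=1$. The element $\sigma_2^{-1}\sigma_1^{-1}$ acts as $(v_1\,v_2\,v_3)(v_4\,v_5\,v_6)(v_7\,v_8\,v_9)(v_{10}\,v_{11}\,v_{12})$, and $\sigma_1\sigma_2\sigma_1$ acts as $(v_1\,v_4)(v_2\,v_7)(v_3\,v_{10})(v_5\,v_{12})(v_6\,v_8)(v_9\,v_{11})$. For finite $\Sigma$, $\omega(\Sigma)=\frac1{|\Sigma|}\sum_{s\in\Sigma}\omega(s)$. **Theorem 3.13.** Let $\Sigma$ be a covering with simply intersecting cycles of a finite homogeneous $\mathbf{PSL}(2,\mathbb Z)$-space $\overline\Sigma$ such that $V_x\neq\emptyset$ and $V_{xy}=\emptyset$. Then $\Sigma$ is finite and $imm(\Sigma)\le\omega(\Sigma)$.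 -/

import Mathlib

/-- The braid group on three strands, with the two Artin generators indexed by `Fin 2`
and the single relation `σ₁ σ₂ σ₁ = σ₂ σ₁ σ₂`. -/
abbrev BraidThree : Type :=
  PresentedGroup
    ({FreeGroup.of 0 * FreeGroup.of 1 * FreeGroup.of 0 *
      (FreeGroup.of 1 * FreeGroup.of 0 * FreeGroup.of 1)⁻¹} : Set (FreeGroup (Fin 2)))

namespace BraidThree

/-- The Artin generator `σ₁`. -/
def s1 : BraidThree := PresentedGroup.of 0

/-- The Artin generator `σ₂`. -/
def s2 : BraidThree := PresentedGroup.of 1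

/-- `Δ = (σ₁ σ₂)³`, the generator of the centre. -/
def delta : BraidThree := (s1 * s2) ^ 3

/-- The lift `σ₂⁻¹ σ₁⁻¹` of the generator `x` of the modular group. -/
def liftX : BraidThree := s2⁻¹ * s1⁻¹

/-- The lift `σ₁ σ₂ σ₁` of the generator `y` of the modular group. -/
def liftY : BraidThree := s1 * s2 * s1

end BraidThree

/-- The modular group `PSL(2, ℤ)`. -/
abbrev Modular : Type := Matrix.ProjectiveSpecialLinearGroup (Fin 2) ℤ

namespace Modular

/-- The matrix `(1 1; 0 1)`. -/
def matU : Matrix.SpecialLinearGroup (Fin 2) ℤ :=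
  ⟨!![1, 1; 0, 1], by simp [Matrix.det_fin_two]⟩

/-- The matrix `(1 0; -1 1)`. -/
def matL : Matrix.SpecialLinearGroup (Fin 2) ℤ :=
  ⟨!![1, 0; -1, 1], by simp [Matrix.det_fin_two]⟩

theorem matU_matL_matU : matU * matL * matU = matL * matU * matL := by
  decide

/-- The class of `(1 1; 0 1)`. -/
def u : Modular := QuotientGroup.mk matU

/-- The class of `(1 0; -1 1)`. -/
def l : Modular := QuotientGroup.mk matL

theorem u_l_u : u * l * u = l * u * l :=
  congrArg (QuotientGroup.mk : Matrix.SpecialLinearGroup (Fin 2) ℤ → Modular) matU_matL_matU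

/-- The canonical surjection `𝔹₃ → PSL(2, ℤ)`, `σ₁ ↦ ±(1 1; 0 1)`, `σ₂ ↦ ±(1 0; -1 1)`.
Its kernel is the centre `⟨Δ⟩`, so that it identifies `𝔹₃ / Z(𝔹₃)` with `PSL(2, ℤ)`. -/
def ofBraid : BraidThree →* Modular :=
  PresentedGroup.toGroup (f := ![u, l]) (by
    intro r hr
    rw [Set.mem_singleton_iff] at hr
    subst hr
    simp only [map_mul, map_inv, FreeGroup.lift_apply_of, Matrix.cons_val_zero,
      Matrix.cons_val_one]
    rw [u_l_u, mul_inv_cancel])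

/-- The generator `x = σ₂⁻¹ σ₁⁻¹ Z(𝔹₃)` of the modular group, of order three. -/
def x : Modular := ofBraid BraidThree.liftX

/-- The generator `y = σ₁ σ₂ σ₁ Z(𝔹₃)` of the modular group, of order two. -/
def y : Modular := ofBraid BraidThree.liftY

end Modular

section SchreierGraph

/-- The `x`-fixed vertices of the Schreier graph of a `PSL(2, ℤ)`-space `T` with respect to the
generators `x` and `y`; the vertices of that graph are the points of `T`. -/
def verticesX (T : Type*) [MulAction Modular T] : Set T :=
  {v | Modular.x • v = v}

/-- The `xy`-fixed vertices of the Schreier graph of a `PSL(2, ℤ)`-space. -/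
def verticesXY (T : Type*) [MulAction Modular T] : Set T :=
  {v | (Modular.x * Modular.y) • v = v}

end SchreierGraph

section Coverings

/-- `π : S → T` is a covering of the `PSL(2, ℤ)`-space `T` by the `𝔹₃`-space `S`: a surjective
`𝔹₃`-equivariant map, any two points with the same image being related by a power of `Δ`. -/
structure IsCovering {S T : Type*} [MulAction BraidThree S] [MulAction Modular T]
    (π : S → T) : Prop where
  surjective : Function.Surjective π
  equivariant : ∀ (g : BraidThree) (s : S), π (g • s) = Modular.ofBraid g • π s
  fiber : ∀ s s' : S, π s = π s' → ∃ m : ℤ, s = BraidThree.delta ^ m • s'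

/-- A `g`-cycle: a minimal non-empty subset closed under the action of `g` and `g⁻¹`. -/
def IsCycle {G S : Type*} [Group G] [MulAction G S] (g : G) (c : Set S) : Prop :=
  Minimal (fun d : Set S => d.Nonempty ∧ ∀ v ∈ d, g • v ∈ d ∧ g⁻¹ • v ∈ d) c

/-- Any `σ₁`-cycle and any `σ₂`-cycle have at most one common point. -/
def SimplyIntersectingCycles (S : Type*) [MulAction BraidThree S] : Prop :=
  ∀ c₁ c₂ : Set S, IsCycle BraidThree.s1 c₁ → IsCycle BraidThree.s2 c₂ → (c₁ ∩ c₂).encard ≤ 1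

/-- The `g`-cycle through `v`. -/
def cycleOf {G S : Type*} [Group G] [MulAction G S] (g : G) (v : S) : Set S :=
  MulAction.orbit (Subgroup.zpowers g) v

theorem zpow_smul_mem_of_closed {G S : Type*} [Group G] [MulAction G S] {g : G} {d : Set S}
    (hd : ∀ v ∈ d, g • v ∈ d ∧ g⁻¹ • v ∈ d) (n : ℤ) {v : S} (hv : v ∈ d) : g ^ n • v ∈ d := by
  induction n with
  | zero => simpa using hv
  | succ n ih =>
    rw [add_comm, zpow_add, zpow_one, mul_smul]
    exact (hd _ ih).1
  | pred n ih =>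
    rw [sub_eq_add_neg, add_comm, zpow_add, zpow_neg_one, mul_smul]
    exact (hd _ ih).2

/-- The `g`-cycles are exactly the sets `cycleOf g v`. -/
theorem isCycle_iff {G S : Type*} [Group G] [MulAction G S] (g : G) (c : Set S) :
    IsCycle g c ↔ ∃ v, c = cycleOf g v := by
  have mem_iff : ∀ v w : S, w ∈ cycleOf g v ↔ ∃ n : ℤ, g ^ n • v = w := by
    intro v w
    constructor
    · rintro ⟨⟨h, n, rfl⟩, rfl⟩
      exact ⟨n, rfl⟩
    · rintro ⟨n, rfl⟩
      exact ⟨⟨g ^ n, n, rfl⟩, rfl⟩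
  have closed : ∀ v : S, ∀ w ∈ cycleOf g v, g • w ∈ cycleOf g v ∧ g⁻¹ • w ∈ cycleOf g v := by
    intro v w hw
    obtain ⟨n, rfl⟩ := (mem_iff v w).1 hw
    refine ⟨(mem_iff _ _).2 ⟨1 + n, ?_⟩, (mem_iff _ _).2 ⟨-1 + n, ?_⟩⟩
    · rw [zpow_add, zpow_one, mul_smul]
    · rw [zpow_add, zpow_neg_one, mul_smul]
  constructor
  · rintro ⟨⟨⟨v, hv⟩, hc⟩, hmin⟩
    have hsub : cycleOf g v ⊆ c := by
      intro w hw
      obtain ⟨n, rfl⟩ := (mem_iff v w).1 hw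
      exact zpow_smul_mem_of_closed hc n hv
    exact ⟨v, Set.Subset.antisymm
      (hmin ⟨⟨v, (mem_iff v v).2 ⟨0, by simp⟩⟩, closed v⟩ hsub) hsub⟩
  · rintro ⟨v, rfl⟩
    refine ⟨⟨⟨v, (mem_iff v v).2 ⟨0, by simp⟩⟩, closed v⟩, ?_⟩
    rintro d ⟨⟨w, hw⟩, hd⟩ hsub z hz
    obtain ⟨n, rfl⟩ := (mem_iff v w).1 (hsub hw)
    obtain ⟨m, rfl⟩ := (mem_iff v z).1 hz
    have h := zpow_smul_mem_of_closed hd (m - n) hw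
    rwa [← mul_smul, ← zpow_add, sub_add_cancel] at h

end Coverings

section Immunity

/-- A quarantine: a non-empty set which, as soon as it contains two of the three points
`v, σ₂ v, σ₁ σ₂ v`, contains the third one too. -/
def IsQuarantine {S : Type*} [MulAction BraidThree S] (Q : Set S) : Prop :=
  Q.Nonempty ∧ ∀ v : S,
    (v ∈ Q → BraidThree.s2 • v ∈ Q → (BraidThree.s1 * BraidThree.s2) • v ∈ Q) ∧
    (v ∈ Q → (BraidThree.s1 * BraidThree.s2) • v ∈ Q → BraidThree.s2 • v ∈ Q) ∧
    (BraidThree.s2 • v ∈ Q → (BraidThree.s1 * BraidThree.s2) • v ∈ Q → v ∈ Q)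

/-- A plague: a non-empty set such that the only quarantine containing it is the whole space. -/
def IsPlague {S : Type*} [MulAction BraidThree S] (P : Set S) : Prop :=
  P.Nonempty ∧ ∀ Q : Set S, IsQuarantine Q → P ⊆ Q → Q = Set.univ

/-- The immunity of a finite non-empty `𝔹₃`-space: the least size of a plague divided by the
size of the space. -/
noncomputable def immunity (S : Type*) [MulAction BraidThree S] : ℚ :=
  (sInf {n : ℕ | ∃ P : Set S, IsPlague P ∧ P.ncard = n} : ℕ) / (Nat.card S : ℚ)

end Immunity

section Weight

/-- The symmetric matrix `ω'`, of which only the entries with `i, j ≥ 1` matter. -/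
def weightMatrix : ℕ → ℕ → ℚ
  | 1, 1 => 1
  | 2, _ => 1 / 3
  | _, 2 => 1 / 3
  | 1, 3 => 11 / 24
  | 3, 1 => 11 / 24
  | 1, _ => 1 / 2
  | _, 1 => 1 / 2
  | 3, _ => 7 / 24
  | _, 3 => 7 / 24
  | _, _ => 1 / 4

/-- A labelled Schreier graph with vertices `v₀, …, v_{n-1}` and fibre size `N`: the `x`-arrow at
`v` points to `x v` and has label `xLabel v`, and similarly for the `y`-arrows. -/
structure LabelledGraph (n N : ℕ) where
  x : Fin n → Fin n
  xLabel : Fin n → ZMod N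
  y : Fin n → Fin n
  yLabel : Fin n → ZMod N

/-- `e` identifies the `𝔹₃`-space `S` with the covering given by the labelled graph `G`. A point
`(v, k)` stands for the point `v[k]` of the fibre over `v`; an arrow `v → w` with label `l`
sends `v[k]` to `w[k + l]`. -/
def LabelledGraph.IsGraphOf {n N : ℕ} (G : LabelledGraph n N) {S : Type*}
    [MulAction BraidThree S] (e : S ≃ Fin n × ZMod N) : Prop :=
  ∀ s : S,
    e (BraidThree.liftX • s) = (G.x (e s).1, (e s).2 + G.xLabel (e s).1) ∧
    e (BraidThree.liftY • s) = (G.y (e s).1, (e s).2 + G.yLabel (e s).1)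

/-- The covering `Σ_{4A}^{5;3,2}`: four vertices, `xy`-cycles of lengths `3, 1`, fibre size `5`,
labels `a = 3` (at the `x`-loop) and `b = 2`. -/
def graph4A : LabelledGraph 4 5 where
  x := ![0, 2, 3, 1]
  xLabel := ![3, -1, 0, 0]
  y := ![1, 0, 3, 2]
  yLabel := ![1, 0, 2, 1 - 2]

/-- The covering `Σ_{6A}^{4;2,2}`: two triangles joined by one `y`-edge, `xy`-cycles of lengths
`4, 1, 1`, fibre size `4`, labels `a = 2` and `b = 2` (at the `y`-edges inside the triangles). -/
def graph6A : LabelledGraph 6 4 where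
  x := ![1, 2, 0, 4, 5, 3]
  xLabel := ![-1, 0, 0, -1, 0, 0]
  y := ![1, 0, 3, 2, 5, 4]
  yLabel := ![2, 1 - 2, 0, 1, 2, 1 - 2]

/-- The trivial covering of `Σ_{12C}`: the regular action of the alternating group on four
letters, with `xy`-cycles of lengths `3, 3, 3, 3`. -/
def graph12C : LabelledGraph 12 1 where
  x := ![1, 2, 0, 4, 5, 3, 7, 8, 6, 10, 11, 9]
  xLabel := fun _ => 0
  y := ![3, 6, 9, 0, 11, 7, 1, 5, 10, 2, 8, 4]
  yLabel := fun _ => 0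

open Classical in
/-- The weight of a point: the entry of `ω'` at the lengths of its `σ₁`- and `σ₂`-cycles, raised
in three exceptional cases (up to isomorphism of `𝔹₃`-spaces). -/
noncomputable def pointWeight {S : Type*} [MulAction BraidThree S] (v : S) : ℚ :=
  weightMatrix (cycleOf BraidThree.s1 v).ncard (cycleOf BraidThree.s2 v).ncard +
    if ∃ e : S ≃ Fin 4 × ZMod 5, graph4A.IsGraphOf e ∧ (e v).1 = 0 then 1 / 30
    else if ∃ e : S ≃ Fin 6 × ZMod 4, graph6A.IsGraphOf e ∧ (e v).1 = 2 then 1 / 12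
    else if ∃ e : S ≃ Fin 12 × ZMod 1, graph12C.IsGraphOf e then 1 / 24
    else 0

/-- The weight of a finite `𝔹₃`-space: the average of the weights of its points. -/
noncomputable def weight (S : Type*) [MulAction BraidThree S] : ℚ :=
  (∑ᶠ v : S, pointWeight v) / (Nat.card S : ℚ)

end Weight

/-!
Write `z = σ₁σ₂` and `y = σ₁σ₂σ₁`, so that `z³ = y² = Δ`, and let `ζ`, `η` be the permutations of
the base space induced by them. The points of the base are then the vertices of a cubic graph of
triangles (orbits of `ζ`) and leaves (fixed points of `ζ`), joined by the edges `t - η t`, and a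
quarantine is a set closed under the rule "two of `y q`, `z q`, `z² q` imply the third". Over a leaf
`z` is a power of `Δ`; hence the fibre size `N` is finite and prime to three, and the covering is
finite.

The plague is built by making the fibres of more and more vertices full. If the entry vertex of a
triangle and its neighbour are full, membership over the second vertex is tied to membership over
the third one and over their neighbours. So a triangle entered once costs at most `N` points, a
triangle entered twice costs none, and an `η`-fixed vertex or a leaf makes it cheaper still. As each
vertex has weight at least `N / 4`, the potential "four times the cost, minus four times the weight,
minus `N` for each boundary edge" never increases (`Reach.exists_larger`). It starts at `2 N` for a
single leaf and has to reach zero (`Reach.cost_univ`). Since the graph is finite, growing must run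
into one of the events that lower the potential by `N` or `2 N` (`Sparse.exists_gain`); the only one
of them that saves no points is a bigon with trivial holonomy, and there the `σ₁`- and `σ₂`-cycles
have length two, which raises the weight instead.

This argument leaves some small spaces. The one of ten vertices made of a leaf, its triangle and a
bigon is treated in `Bigon.exists_cost`, again by a dichotomy between holonomy and weight. The other
ones have four or seven vertices, and there the simply intersecting cycles matter: the face of the
leaf is traced by `σ₁` and by `σ₂` in the same number of steps, with the same holonomy, so this
holonomy is trivial. That excludes the spaces of four vertices
(`SimplyIntersecting.not_two_semi`) and determines the labels of the spaces of seven vertices, for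
which explicit plagues suffice (`Seven.exists_cost_bigon`, `Seven.exists_cost_twisted`). The
exceptional increments of the weight are nonnegative and are not needed.
-/

/-! ### Coverings as permutations with `z³ = y²`, and quarantines -/

/-- The permutations by which `𝔹₃` acts on a covering `S` of a `PSL(2, ℤ)`-space `T`, written in the
generators `z = σ₁σ₂` and `y = σ₁σ₂σ₁` with the relation `z³ = y²`; the common value is the central
element `Δ`. The permutations `ζ` and `η` of `T` are induced by `z` and `y`. Thus `ζ` is the action
of `x⁻¹`, the orbits of `ζ` are triangles and single points (leaves), and `ne_rotate` excludes
`xy`-fixed points. -/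
structure ModularCover (S T : Type*) where
  z : Equiv.Perm S
  y : Equiv.Perm S
  ζ : Equiv.Perm T
  η : Equiv.Perm T
  proj : S → T
  proj_surj : Function.Surjective proj
  proj_z : ∀ s, proj (z s) = ζ (proj s)
  proj_y : ∀ s, proj (y s) = η (proj s)
  z_cube : z ^ 3 = y ^ 2
  exists_zpow : ∀ s s', proj s = proj s' → ∃ m : ℤ, s = ((y ^ 2) ^ m) s'
  ζ_cube : ∀ t, ζ (ζ (ζ t)) = t
  η_sq : ∀ t, η (η t) = t
  ne_rotate : ∀ t, η t ≠ ζ t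
  eq_univ : ∀ K : Set T, K.Nonempty → (∀ t ∈ K, ζ t ∈ K) → (∀ t ∈ K, η t ∈ K) → K = Set.univ

namespace ModularCover

variable {S T : Type*} (C : ModularCover S T)

/-- The central permutation `Δ = y² = z³`. -/
def Δ : Equiv.Perm S := C.y ^ 2

/-- The size of the fibres, see `card_fiber`. -/
noncomputable def fiberSize : ℕ := orderOf C.Δ

/-- The action of `σ₁ = z⁻¹ y`. -/
def σ₁ : Equiv.Perm S := C.z⁻¹ * C.y

/-- The action of `σ₂ = y z⁻¹`. -/
def σ₂ : Equiv.Perm S := C.y * C.z⁻¹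

theorem y_y (s : S) : C.y (C.y s) = C.Δ s := rfl

theorem z_z_z (s : S) : C.z (C.z (C.z s)) = C.Δ s := by
  have := congrArg (fun g : Equiv.Perm S => g s) C.z_cube
  simpa [pow_succ, Δ] using this

theorem Δ_comm_y : Commute C.Δ C.y := (Commute.refl C.y).pow_left 2

theorem Δ_comm_z : Commute C.Δ C.z := by
  have : C.Δ = C.z ^ 3 := C.z_cube.symm
  rw [this]
  exact (Commute.refl C.z).pow_left 3

theorem zpow_y (m : ℤ) (s : S) : (C.Δ ^ m) (C.y s) = C.y ((C.Δ ^ m) s) :=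
  congrArg (fun g : Equiv.Perm S => g s) (C.Δ_comm_y.zpow_left m).eq

theorem zpow_z (m : ℤ) (s : S) : (C.Δ ^ m) (C.z s) = C.z ((C.Δ ^ m) s) :=
  congrArg (fun g : Equiv.Perm S => g s) (C.Δ_comm_z.zpow_left m).eq

theorem Δ_z (s : S) : C.Δ (C.z s) = C.z (C.Δ s) := by simpa using C.zpow_z 1 s

theorem proj_Δ (s : S) : C.proj (C.Δ s) = C.proj s := by
  rw [← C.y_y, C.proj_y, C.proj_y, C.η_sq]

theorem proj_zpow (m : ℤ) (s : S) : C.proj ((C.Δ ^ m) s) = C.proj s := by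
  induction m with
  | zero => simp
  | succ n ih => rw [add_comm, zpow_add, Equiv.Perm.mul_apply, zpow_one, C.proj_Δ, ih]
  | pred n ih =>
    rw [← ih, sub_eq_neg_add, zpow_add, Equiv.Perm.mul_apply, zpow_neg_one]
    conv_rhs => rw [← C.Δ.apply_symm_apply ((C.Δ ^ (-(n : ℤ))) s), C.proj_Δ]
    rfl

theorem proj_symm_z (s : S) : C.proj (C.z.symm s) = C.ζ (C.ζ (C.proj s)) := by
  conv_rhs => rw [← C.z.apply_symm_apply s, C.proj_z, C.ζ_cube]

theorem proj_symm_y (s : S) : C.proj (C.y.symm s) = C.η (C.proj s) := by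
  conv_rhs => rw [← C.y.apply_symm_apply s, C.proj_y, C.η_sq]

theorem Δ_comm_σ₁ : Commute C.Δ C.σ₁ := C.Δ_comm_z.inv_right.mul_right C.Δ_comm_y

theorem zpow_σ₁_pow (m : ℤ) (n : ℕ) (s : S) :
    (C.Δ ^ m) ((C.σ₁ ^ n) s) = (C.σ₁ ^ n) ((C.Δ ^ m) s) :=
  congrArg (fun g : Equiv.Perm S => g s) ((C.Δ_comm_σ₁.zpow_left m).pow_right n).eq

theorem proj_σ₁ (s : S) : C.proj (C.σ₁ s) = C.ζ (C.ζ (C.η (C.proj s))) := by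
  change C.proj (C.z.symm (C.y s)) = _
  rw [C.proj_symm_z, C.proj_y]

theorem η_inj {t u : T} : C.η t = C.η u ↔ t = u := C.η.injective.eq_iff

theorem η_eq_iff {t u : T} : C.η t = u ↔ t = C.η u := by
  constructor
  · rintro rfl; rw [C.η_sq]
  · rintro rfl; rw [C.η_sq]

/-- `Δ` acts freely modulo its order: a power fixing one point fixes all of them, because it is
central and the action on `T` is transitive. -/
theorem zpow_apply_eq_self_iff (m : ℤ) (s : S) :
    (C.Δ ^ m) s = s ↔ (C.fiberSize : ℤ) ∣ m := by
  constructor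
  · intro h
    rw [fiberSize, orderOf_dvd_iff_zpow_eq_one]
    have key : {t | ∀ s, C.proj s = t → (C.Δ ^ m) s = s} = Set.univ := by
      apply C.eq_univ
      · refine ⟨C.proj s, fun s' hs' => ?_⟩
        obtain ⟨k, rfl⟩ := C.exists_zpow _ _ hs'
        change (C.Δ ^ m) ((C.Δ ^ k) s) = (C.Δ ^ k) s
        rw [← Equiv.Perm.mul_apply, ← zpow_add, add_comm, zpow_add, Equiv.Perm.mul_apply, h]
      · intro t ht s' hs'
        have := ht (C.z.symm s') (by rw [C.proj_symm_z, hs', C.ζ_cube])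
        rw [← C.z.apply_symm_apply s', C.zpow_z, this]
      · intro t ht s' hs'
        have := ht (C.y.symm s') (by rw [C.proj_symm_y, hs', C.η_sq])
        rw [← C.y.apply_symm_apply s', C.zpow_y, this]
    ext s'
    have : C.proj s' ∈ {t | ∀ s, C.proj s = t → (C.Δ ^ m) s = s} := by rw [key]; trivial
    exact this s' rfl
  · intro h
    rw [fiberSize, orderOf_dvd_iff_zpow_eq_one] at h
    rw [h]; rfl

theorem exists_zpow' {s s' : S} (h : C.proj s = C.proj s') : ∃ m : ℤ, s = (C.Δ ^ m) s' :=
  C.exists_zpow s s' h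

theorem zpow_zpow (m n : ℤ) (s : S) : (C.Δ ^ m) ((C.Δ ^ n) s) = (C.Δ ^ (m + n)) s := by
  rw [← Equiv.Perm.mul_apply, ← zpow_add]

theorem zpow_eq_zpow_iff (m n : ℤ) (s : S) :
    (C.Δ ^ m) s = (C.Δ ^ n) s ↔ (C.fiberSize : ℤ) ∣ m - n := by
  rw [← C.zpow_apply_eq_self_iff (m - n) ((C.Δ ^ n) s), C.zpow_zpow, sub_add_cancel]

section Finite

variable [Fintype S]

theorem fiberSize_pos : 0 < C.fiberSize := orderOf_pos _

variable [DecidableEq T]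

/-- The points over `t`. -/
def fiber (t : T) : Finset S := Finset.univ.filter fun s => C.proj s = t

theorem mem_fiber {t : T} {s : S} : s ∈ C.fiber t ↔ C.proj s = t := by simp [fiber]

theorem card_fiber (t : T) : (C.fiber t).card = C.fiberSize := by
  classical
  obtain ⟨s, rfl⟩ := C.proj_surj t
  have hN := C.fiberSize_pos
  have : C.fiber (C.proj s) =
      (Finset.range C.fiberSize).image (fun i : ℕ => (C.Δ ^ (i : ℤ)) s) := by
    ext s'
    rw [mem_fiber, Finset.mem_image]
    constructor
    · intro h
      obtain ⟨m, rfl⟩ := C.exists_zpow' h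
      refine ⟨(m % C.fiberSize).toNat, ?_, ?_⟩
      · rw [Finset.mem_range]
        have := Int.emod_lt_of_pos m (show (0 : ℤ) < C.fiberSize by exact_mod_cast hN)
        have := Int.emod_nonneg m (show (C.fiberSize : ℤ) ≠ 0 by omega)
        omega
      · rw [C.zpow_eq_zpow_iff, Int.toNat_of_nonneg
          (Int.emod_nonneg m (show (C.fiberSize : ℤ) ≠ 0 by omega))]
        exact ⟨-(m / C.fiberSize), by have := Int.mul_ediv_add_emod m C.fiberSize; linarith⟩
    · rintro ⟨i, -, rfl⟩
      exact C.proj_zpow _ _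
  rw [this, Finset.card_image_of_injOn, Finset.card_range]
  intro i hi j hj hij
  simp only [Finset.coe_range, Set.mem_Iio] at hi hj
  have := (C.zpow_eq_zpow_iff _ _ _).1 hij
  have h0 := Int.eq_zero_of_abs_lt_dvd this (by rw [abs_lt]; constructor <;> omega)
  omega

end Finite

/-- The quarantine rule in terms of `z` and `y`: the points `σ₁σ₂s`, `σ₂s`, `s` with `s = z q` are
`z² q`, `y q`, `z q`. -/
def Closed (Q : Set S) : Prop :=
  ∀ q, (C.y q ∈ Q → C.z q ∈ Q → C.z (C.z q) ∈ Q) ∧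
    (C.y q ∈ Q → C.z (C.z q) ∈ Q → C.z q ∈ Q) ∧
    (C.z q ∈ Q → C.z (C.z q) ∈ Q → C.y q ∈ Q)

/-- All points over `t` belong to `Q`. -/
def Full (Q : Set S) (t : T) : Prop := ∀ s, C.proj s = t → s ∈ Q

variable {C} {Q : Set S} {a b u : T}

theorem Closed.iff_of_y (hQ : C.Closed Q) {q : S} (h : C.y q ∈ Q) :
    C.z q ∈ Q ↔ C.z (C.z q) ∈ Q := ⟨(hQ q).1 h, (hQ q).2.1 h⟩

theorem Closed.iff_of_z (hQ : C.Closed Q) {q : S} (h : C.z q ∈ Q) :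
    C.y q ∈ Q ↔ C.z (C.z q) ∈ Q := ⟨fun h' => (hQ q).1 h' h, (hQ q).2.2 h⟩

theorem Closed.iff_of_z_z (hQ : C.Closed Q) {q : S} (h : C.z (C.z q) ∈ Q) :
    C.y q ∈ Q ↔ C.z q ∈ Q := ⟨fun h' => (hQ q).2.1 h' h, fun h' => (hQ q).2.2 h' h⟩

/-- Two full vertices of a triangle make the `η`-neighbour of the third one full. -/
theorem Closed.full_η (hQ : C.Closed Q) {t : T} (h1 : C.Full Q (C.ζ t))
    (h2 : C.Full Q (C.ζ (C.ζ t))) : C.Full Q (C.η t) := by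
  intro s hs
  have hp : C.proj (C.y.symm s) = t := by rw [C.proj_symm_y, hs, C.η_sq]
  have := (hQ (C.y.symm s)).2.2 (h1 _ (by rw [C.proj_z, hp]))
    (h2 _ (by rw [C.proj_z, C.proj_z, hp]))
  simpa using this

/-- If `t` and the `η`-neighbour of `ζ² t` are full then so is `ζ t`. -/
theorem Closed.full_ζ (hQ : C.Closed Q) {t : T} (h : C.Full Q t)
    (h' : C.Full Q (C.η (C.ζ (C.ζ t)))) : C.Full Q (C.ζ t) := by
  intro s hs
  have hp : C.proj (C.z.symm (C.z.symm s)) = C.ζ (C.ζ t) := by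
    rw [C.proj_symm_z, C.proj_symm_z, hs, C.ζ_cube]
  have := (hQ (C.z.symm (C.z.symm s))).1 (h' _ (by rw [C.proj_y, hp]))
    (h _ (by rw [C.proj_z, hp, C.ζ_cube]))
  simpa using this

/-- If `t` and its `η`-neighbour are full then `ζ t` and `ζ² t` are full together. -/
theorem Closed.link_z (hQ : C.Closed Q) {t : T} (h' : C.Full Q (C.η t)) {q : S}
    (hq : C.proj q = C.ζ t) : q ∈ Q ↔ C.z q ∈ Q := by
  have hp : C.proj (C.z.symm q) = t := by rw [C.proj_symm_z, hq, C.ζ_cube]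
  have := hQ.iff_of_y (q := C.z.symm q) (h' _ (by rw [C.proj_y, hp]))
  simpa using this

/-- If `t` and its `η`-neighbour are full then `q` and `y q` are linked for `q` over `ζ t`. -/
theorem Closed.link_y (hQ : C.Closed Q) {t : T} (h : C.Full Q t) (h' : C.Full Q (C.η t)) {q : S}
    (hq : C.proj q = C.ζ t) : q ∈ Q ↔ C.y q ∈ Q := by
  rw [hQ.link_z h' hq]
  exact (hQ.iff_of_z_z (h _ (by rw [C.proj_z, C.proj_z, hq, C.ζ_cube]))).symm

/-- If `t` and its `η`-neighbour are full then `y q` and `Δ q` are linked for `q` over `ζ² t`. -/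
theorem Closed.link_Δ (hQ : C.Closed Q) {t : T} (h : C.Full Q t) (h' : C.Full Q (C.η t)) {q : S}
    (hq : C.proj q = C.ζ (C.ζ t)) : C.y q ∈ Q ↔ C.Δ q ∈ Q := by
  rw [hQ.iff_of_z (h _ (by rw [C.proj_z, hq, C.ζ_cube])), ← C.z_z_z]
  exact hQ.link_z h' (by rw [C.proj_z, C.proj_z, hq, C.ζ_cube])

theorem Full.of_link [Finite S] {t : T} (hlink : ∀ q, C.proj q = t → (q ∈ Q → C.Δ q ∈ Q)) {s : S}
    (hs : C.proj s = t) (hsQ : s ∈ Q) : C.Full Q t := by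
  have hpow : ∀ n : ℕ, (C.Δ ^ n) s ∈ Q := by
    intro n
    induction n with
    | zero => simpa
    | succ n ih =>
      rw [pow_succ', Equiv.Perm.mul_apply]
      refine hlink _ ?_ ih
      rw [← zpow_natCast, C.proj_zpow, hs]
  intro s' hs'
  obtain ⟨m, rfl⟩ := C.exists_zpow' (hs'.trans hs.symm)
  obtain ⟨n, hn⟩ := (isOfFinOrder_of_finite C.Δ).mem_powers_iff_mem_zpowers.2 ⟨m, rfl⟩
  simp only at hn
  rw [← hn]
  exact hpow n

/-- If membership is invariant under a non-trivial power of `Δ` over `t`, half of the points over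
`t` make `t` full: one representative for each orbit. -/
theorem exists_half [Fintype S] (t : T) (h : ℤ) (hne : ¬ (C.fiberSize : ℤ) ∣ h) :
    ∃ P : Finset S, 2 * P.card ≤ C.fiberSize ∧ ∀ Q : Set S,
      (∀ q, C.proj q = t → (q ∈ Q ↔ (C.Δ ^ h) q ∈ Q)) → (P : Set S) ⊆ Q → C.Full Q t := by
  classical
  obtain ⟨s, rfl⟩ := C.proj_surj t
  have hN := C.fiberSize_pos
  set N := C.fiberSize with hNdef
  set g := Int.gcd h N with hg
  have hgN : g ∣ N := by
    have := Int.gcd_dvd_right h (N : ℤ)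
    exact_mod_cast this
  have hg0 : 0 < g := Nat.pos_of_dvd_of_pos hgN hN
  have hgne : g ≠ N := by
    intro hEq
    apply hne
    have := Int.gcd_dvd_left h (N : ℤ)
    rw [← hg, hEq] at this
    exact this
  refine ⟨(Finset.range g).image (fun i : ℕ => (C.Δ ^ (i : ℤ)) s), ?_, ?_⟩
  · have h1 : ((Finset.range g).image (fun i : ℕ => (C.Δ ^ (i : ℤ)) s)).card ≤ g := by
      simpa using Finset.card_image_le (s := Finset.range g) (f := fun i : ℕ => (C.Δ ^ (i : ℤ)) s)
    obtain ⟨k, hk⟩ := hgN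
    have : 2 ≤ k := by
      rcases k with _ | _ | k
      · simp at hk; omega
      · simp at hk; omega
      · omega
    nlinarith
  · intro Q hlink hP s' hs'
    obtain ⟨m, rfl⟩ := C.exists_zpow' hs'
    have hshift : ∀ (k m : ℤ), (C.Δ ^ m) s ∈ Q ↔ (C.Δ ^ (h * k + m)) s ∈ Q := by
      intro k
      induction k with
      | zero => simp
      | succ n ih =>
        intro m
        rw [ih, hlink _ (C.proj_zpow _ _), C.zpow_zpow]
        ring_nf
      | pred n ih =>
        intro m
        rw [ih, hlink ((C.Δ ^ (h * (-(n : ℤ) - 1) + m)) s) (C.proj_zpow _ _), C.zpow_zpow]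
        ring_nf
    have hr : (C.Δ ^ (m % (g : ℤ))) s ∈ Q := by
      apply hP
      rw [Finset.mem_coe, Finset.mem_image]
      have h1 := Int.emod_nonneg m (show (g : ℤ) ≠ 0 by omega)
      have h2 := Int.emod_lt_of_pos m (show (0 : ℤ) < g by omega)
      refine ⟨(m % (g : ℤ)).toNat, ?_, ?_⟩
      · rw [Finset.mem_range]; omega
      · rw [Int.toNat_of_nonneg h1]
    have hbez := Int.gcd_eq_gcd_ab h (N : ℤ)
    rw [hshift (Int.gcdA h N * (m / g))] at hr
    have : (C.Δ ^ m) s = (C.Δ ^ (h * (Int.gcdA h N * (m / g)) + m % (g : ℤ))) s := by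
      rw [C.zpow_eq_zpow_iff]
      refine ⟨Int.gcdB h N * (m / g), ?_⟩
      have := Int.mul_ediv_add_emod m g
      rw [← hg] at hbez
      linear_combination (-1 : ℤ) * this + (m / g) * hbez
    rw [this]
    exact hr

/-- Around a bigon of two triangles `a`, `b` next to `K`, membership is invariant under `σ₁²`. -/
theorem Closed.link_bigon (hQ : C.Closed Q) (ha0 : C.Full Q a)
    (ha0' : C.Full Q (C.η a)) (hb0 : C.Full Q b) (hb0' : C.Full Q (C.η b))
    (h1 : C.η (C.ζ a) = C.ζ (C.ζ b)) (h2 : C.η (C.ζ (C.ζ a)) = C.ζ b) {q : S}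
    (hq : C.proj q = C.ζ a) : q ∈ Q ↔ C.σ₁ (C.σ₁ q) ∈ Q := by
  have hr : C.proj (C.y q) = C.ζ (C.ζ b) := by rw [C.proj_y, hq, h1]
  have hu : C.proj (C.z.symm (C.y q)) = C.ζ b := by rw [C.proj_symm_z, hr, C.ζ_cube]
  have hv : C.proj (C.y (C.z.symm (C.y q))) = C.ζ (C.ζ a) := by rw [C.proj_y, hu, ← h2, C.η_sq]
  have hw : C.proj (C.z.symm (C.y (C.z.symm (C.y q)))) = C.ζ a := by
    rw [C.proj_symm_z, hv, C.ζ_cube]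
  have e1 := hQ.link_y ha0 ha0' hq
  have e2 := hQ.link_z hb0' hu
  have e3 := hQ.link_y hb0 hb0' hu
  have e4 := hQ.link_z ha0' hw
  rw [C.z.apply_symm_apply] at e2 e4
  rw [e1, ← e2, e3, ← e4]
  rfl

/-- A power of `σ₁` that returns to the fibre acts on it by a fixed power of `Δ`. -/
theorem exists_holonomy {t : T} (n : ℕ) (hn : ∀ q, C.proj q = t → C.proj ((C.σ₁ ^ n) q) = t) :
    ∃ h : ℤ, ∀ q, C.proj q = t → (C.σ₁ ^ n) q = (C.Δ ^ h) q := by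
  obtain ⟨s, hs⟩ := C.proj_surj t
  obtain ⟨h, hh⟩ := C.exists_zpow' ((hn s hs).trans hs.symm)
  refine ⟨h, fun q hq => ?_⟩
  obtain ⟨k, rfl⟩ := C.exists_zpow' (hq.trans hs.symm)
  rw [← C.zpow_σ₁_pow, hh, C.zpow_zpow, C.zpow_zpow, add_comm]

theorem exists_half_of_holonomy [Fintype S] {t : T} (n : ℕ)
    (hn : ∀ q, C.proj q = t → C.proj ((C.σ₁ ^ n) q) = t)
    (hne : ¬ ∀ q, C.proj q = t → (C.σ₁ ^ n) q = q) :
    ∃ P : Finset S, 2 * P.card ≤ C.fiberSize ∧ ∀ Q : Set S,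
      (∀ q, C.proj q = t → (q ∈ Q ↔ (C.σ₁ ^ n) q ∈ Q)) → (P : Set S) ⊆ Q → C.Full Q t := by
  obtain ⟨h, hh⟩ := exists_holonomy n hn
  have hdvd : ¬ (C.fiberSize : ℤ) ∣ h := by
    intro hd
    exact hne fun q hq => by rw [hh q hq, C.zpow_apply_eq_self_iff]; exact hd
  obtain ⟨P, hP, hPQ⟩ := exists_half t h hdvd
  exact ⟨P, hP, fun Q hl => hPQ Q fun q hq => by rw [hl q hq, hh q hq]⟩

/-- The number of points that make a leaf next to a half-known triangle full. -/
def leafCost (N : ℕ) : ℕ := if N = 2 then 1 else 2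

/-- If two of `p`, `z p`, `z² p` over a leaf determine the third one then two points make it full,
and even one if `N = 2`, as then `z² p = p`. -/
theorem exists_leafCost [Fintype S] (hu : C.ζ u = u) :
    ∃ P : Finset S, P.card ≤ leafCost C.fiberSize ∧ ∀ Q : Set S,
      (∀ p, C.proj p = u → p ∈ Q → (C.z p ∈ Q ↔ C.z (C.z p) ∈ Q)) → (P : Set S) ⊆ Q → C.Full Q u := by
  classical
  obtain ⟨s, hs⟩ := C.proj_surj u
  have key : ∀ Q : Set S, (∀ p, C.proj p = u → p ∈ Q → (C.z p ∈ Q ↔ C.z (C.z p) ∈ Q)) →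
      s ∈ Q → C.z s ∈ Q → C.Full Q u := by
    intro Q hrule h0 h1
    have hstep : ∀ q, C.proj q = u → (q ∈ Q ∧ C.z q ∈ Q) → (C.z q ∈ Q ∧ C.z (C.z q) ∈ Q) :=
      fun q hq hqQ => ⟨hqQ.2, (hrule q hq hqQ.1).1 hqQ.2⟩
    have hz : ∀ q, C.proj q = u → C.proj (C.z q) = u := fun q hq => by rw [C.proj_z, hq, hu]
    have hfull : C.Full {q | q ∈ Q ∧ C.z q ∈ Q} u := by
      refine Full.of_link (fun q hq hqQ => ?_) hs ⟨h0, h1⟩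
      rw [← C.z_z_z]
      exact hstep _ (hz _ (hz _ hq)) (hstep _ (hz _ hq) (hstep _ hq hqQ))
    exact fun q hq => (hfull q hq).1
  by_cases hN : C.fiberSize = 2
  · refine ⟨{s}, by simp [leafCost, hN], fun Q hrule hP => ?_⟩
    have h0 : s ∈ Q := hP (by simp)
    refine key Q hrule h0 ((hrule s hs h0).2 ?_)
    have hz2 : C.z (C.z s) = s := by
      obtain ⟨m, hm⟩ := C.exists_zpow' (s := C.z s) (s' := s) (by rw [C.proj_z, hs, hu])
      rw [hm, ← C.zpow_z, hm, C.zpow_zpow, C.zpow_apply_eq_self_iff, hN]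
      exact ⟨m, by push_cast; ring⟩
    rwa [hz2]
  · refine ⟨{s, C.z s}, ?_, fun Q hrule hP => key Q hrule (hP (by simp)) (hP (by simp))⟩
    simpa [leafCost, hN] using Finset.card_le_two (a := s) (b := C.z s)

end ModularCover

/-! ### The cost of adding a triangle -/

namespace ModularCover

variable {S T : Type*} (C : ModularCover S T)

section Spread

/-- Sets of vertices that are unions of `ζ`-orbits. -/
def Inv (K : Finset T) : Prop := ∀ t ∈ K, C.ζ t ∈ K

variable {C} {K : Finset T} {a b u : T} {Q : Set S}

theorem Inv.mem_of_ζ (h : C.Inv K) {t : T} (ht : C.ζ t ∈ K) : t ∈ K := by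
  have := h _ (h _ ht)
  rwa [C.ζ_cube] at this

theorem Inv.full_base (h : C.Inv K) (hQ : C.Closed Q) (hK : ∀ t ∈ K, C.Full Q t)
    (ha : C.η a ∈ K) : C.Full Q a := by
  have := hQ.full_η (hK _ (h _ ha)) (hK _ (h _ (h _ ha)))
  rwa [C.η_sq] at this

variable (C) [DecidableEq T]

/-- `c` points suffice to make all vertices of `K` full. -/
def Cost (K : Finset T) (c : ℕ) : Prop :=
  ∃ P : Finset S, P.card ≤ c ∧ ∀ Q, C.Closed Q → (P : Set S) ⊆ Q → ∀ t ∈ K, C.Full Q t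

/-- Once the vertices of `K` are full, `c` further points suffice for those of `A`. -/
def Extends (K A : Finset T) (c : ℕ) : Prop :=
  ∃ P : Finset S, P.card ≤ c ∧ ∀ Q, C.Closed Q → (∀ t ∈ K, C.Full Q t) → (P : Set S) ⊆ Q →
    ∀ t ∈ A, C.Full Q t

/-- The `ζ`-orbit of `t`. -/
def orb (t : T) : Finset T := {t, C.ζ t, C.ζ (C.ζ t)}

variable {C}

theorem mem_orb {t : T} : t ∈ C.orb a ↔ t = a ∨ t = C.ζ a ∨ t = C.ζ (C.ζ a) := by
  simp [orb]

theorem Cost.union {A : Finset T} {c c' : ℕ} (h : C.Cost K c) (h' : C.Extends K A c') :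
    C.Cost (K ∪ A) (c + c') := by
  classical
  obtain ⟨P, hP, hPQ⟩ := h
  obtain ⟨P', hP', hPQ'⟩ := h'
  refine ⟨P ∪ P', (Finset.card_union_le _ _).trans (by omega), fun Q hQ hsub t ht => ?_⟩
  rw [Finset.coe_union, Set.union_subset_iff] at hsub
  have hK := hPQ Q hQ hsub.1
  rcases Finset.mem_union.1 ht with h | h
  · exact hK t h
  · exact hPQ' Q hQ hK hsub.2 t h

theorem inv_orb : C.Inv (C.orb a) := by
  intro t ht
  rw [mem_orb] at ht ⊢
  rcases ht with rfl | rfl | rfl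
  · simp
  · simp
  · simp [C.ζ_cube]

theorem Inv.union {A : Finset T} (h : C.Inv K) (h' : C.Inv A) : C.Inv (K ∪ A) := by
  intro t ht
  rw [Finset.mem_union] at ht ⊢
  exact ht.imp (h t) (h' t)

theorem Closed.full_orb (hQ : C.Closed Q) (h0 : C.Full Q a) (h0' : C.Full Q (C.η a))
    (h1 : C.Full Q (C.ζ a)) : ∀ t ∈ C.orb a, C.Full Q t := by
  intro t ht
  rw [mem_orb] at ht
  rcases ht with rfl | rfl | rfl
  · exact h0
  · exact h1
  · intro s hs
    have hp : C.proj (C.z.symm s) = C.ζ a := by rw [C.proj_symm_z, hs, C.ζ_cube]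
    have := (hQ.link_z h0' hp).1 (h1 _ hp)
    simpa using this

theorem extends_leaf (h : C.Inv K) (ha : C.η a ∈ K) (hleaf : C.ζ a = a) :
    C.Extends K (C.orb a) 0 := by
  refine ⟨∅, le_rfl, fun Q hQ hK _ t ht => ?_⟩
  have : t = a := by simpa [mem_orb, hleaf] using ht
  rw [this]
  exact h.full_base hQ hK ha

theorem extends_two (h : C.Inv K) (ha : C.η a ∈ K)
    (h' : C.η (C.ζ a) ∈ K ∨ C.η (C.ζ (C.ζ a)) ∈ K) : C.Extends K (C.orb a) 0 := by
  refine ⟨∅, le_rfl, fun Q hQ hK _ => ?_⟩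
  have h0 := h.full_base hQ hK ha
  refine hQ.full_orb h0 (hK _ ha) ?_
  rcases h' with h' | h'
  · exact h.full_base hQ hK h'
  · exact hQ.full_ζ h0 (hK _ h')

section Finite

variable [Fintype S]

theorem extends_one (h : C.Inv K) (ha : C.η a ∈ K) : C.Extends K (C.orb a) C.fiberSize :=
  ⟨C.fiber (C.ζ a), (C.card_fiber _).le, fun _ hQ hK hP =>
    hQ.full_orb (h.full_base hQ hK ha) (hK _ ha)
      fun _ hs => hP (Finset.mem_coe.2 (C.mem_fiber.2 hs))⟩

/-- A `y`-edge from a triangle to itself costs a single point: over its foot membership is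
invariant under `y`, hence under `Δ = y²`. -/
theorem extends_semi (h : C.Inv K) (ha : C.η a ∈ K)
    (h' : C.η (C.ζ a) = C.ζ a ∨ C.η (C.ζ (C.ζ a)) = C.ζ (C.ζ a)) : C.Extends K (C.orb a) 1 := by
  classical
  obtain ⟨s, hs⟩ := C.proj_surj (C.ζ a)
  refine ⟨{s}, by simp, fun Q hQ hK hP => ?_⟩
  have h0 := h.full_base hQ hK ha
  have h0' := hK _ ha
  have hsQ : s ∈ Q := hP (by simp)
  refine hQ.full_orb h0 h0' (Full.of_link (fun q hq hqQ => ?_) hs hsQ)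
  rcases h' with h' | h'
  · have h1 := (hQ.link_y h0 h0' hq).1 hqQ
    rw [hQ.link_y h0 h0' (by rw [C.proj_y, hq, h'])] at h1
    exact h1
  · have h1 := (hQ.link_z h0' hq).1 hqQ
    have hr : C.proj (C.z q) = C.ζ (C.ζ a) := by rw [C.proj_z, hq]
    -- Over `ζ² a`, `p = y (y⁻¹ p)` is linked to `Δ (y⁻¹ p) = y p`.
    have key : ∀ p, C.proj p = C.ζ (C.ζ a) → p ∈ Q → C.y p ∈ Q := by
      intro p hp hpQ
      have hp' : C.proj (C.y.symm p) = C.ζ (C.ζ a) := by rw [C.proj_symm_y, hp, h']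
      have := hQ.link_Δ h0 h0' hp'
      rw [← C.y_y, C.y.apply_symm_apply] at this
      exact this.1 hpQ
    have h2 := key _ (by rw [C.proj_y, hr, h']) (key _ hr h1)
    rw [C.y_y, C.Δ_z] at h2
    exact (hQ.link_z h0' (by rw [C.proj_Δ, hq])).2 h2

theorem extends_triangle_leaf (h : C.Inv K) (ha : C.η a ∈ K)
    (h' : C.ζ (C.η (C.ζ a)) = C.η (C.ζ a) ∨
      C.ζ (C.η (C.ζ (C.ζ a))) = C.η (C.ζ (C.ζ a))) :
    C.Extends K (C.orb a) (leafCost C.fiberSize) := by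
  rcases h' with h' | h'
  · obtain ⟨P, hP, hPQ⟩ := exists_leafCost h'
    refine ⟨P, hP, fun Q hQ hK hsub => ?_⟩
    have h0 := h.full_base hQ hK ha
    have h0' := hK _ ha
    have hfull := hPQ Q (fun p hp hpQ => ?_) hsub
    · refine hQ.full_orb h0 h0' fun q hq => (hQ.link_y h0 h0' hq).2 (hfull _ ?_)
      rw [C.proj_y, hq]
    · -- The triple at `r = z⁻¹ p` is `y r, p, z p`, and `y r` is linked to `y² r = z³ r`.
      have hr : C.proj (C.z.symm p) = C.η (C.ζ a) := by rw [C.proj_symm_z, hp, h', h']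
      have h1 := hQ.link_y h0 h0' (q := C.y (C.z.symm p)) (by rw [C.proj_y, hr, C.η_sq])
      rw [C.y_y, ← C.z_z_z, C.z.apply_symm_apply] at h1
      have h2 := hQ.iff_of_z (q := C.z.symm p) (by rwa [C.z.apply_symm_apply])
      rw [C.z.apply_symm_apply] at h2
      rw [← h2, h1]
  · obtain ⟨P, hP, hPQ⟩ := exists_leafCost h'
    refine ⟨P, hP, fun Q hQ hK hsub => ?_⟩
    have h0 := h.full_base hQ hK ha
    have h0' := hK _ ha
    have hfull := hPQ Q (fun p hp hpQ => ?_) hsub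
    · refine hQ.full_orb h0 h0' fun q hq => (hQ.link_z h0' hq).2 ?_
      have hr : C.proj (C.Δ.symm (C.z q)) = C.ζ (C.ζ a) := by
        rw [← C.proj_Δ, C.Δ.apply_symm_apply, C.proj_z, hq]
      have := (hQ.link_Δ h0 h0' hr).1 (hfull _ (by rw [C.proj_y, hr]))
      rwa [C.Δ.apply_symm_apply] at this
    · have hr : C.proj (C.y.symm p) = C.ζ (C.ζ a) := by rw [C.proj_symm_y, hp, C.η_sq]
      have h1 := hQ.link_Δ h0 h0' hr
      rw [← C.y_y, C.y.apply_symm_apply] at h1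
      exact hQ.iff_of_y (h1.1 hpQ)

theorem extends_twisted (h : C.Inv K) (ha : C.η a ∈ K) (hb : C.η b ∈ K)
    (hab : C.η (C.ζ a) = C.ζ b) : C.Extends K (C.orb a ∪ C.orb b) 1 := by
  classical
  obtain ⟨s, hs⟩ := C.proj_surj (C.ζ a)
  refine ⟨{s}, by simp, fun Q hQ hK hP t ht => ?_⟩
  have ha0 := h.full_base hQ hK ha
  have hb0 := h.full_base hQ hK hb
  have hlink : ∀ q, C.proj q = C.ζ a → (q ∈ Q ↔ C.y q ∈ Q) :=
    fun q hq => hQ.link_y ha0 (hK _ ha) hq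
  have hfull : C.Full Q (C.ζ a) := by
    refine Full.of_link (fun q hq hqQ => ?_) hs (hP (by simp))
    exact (hQ.link_y hb0 (hK _ hb) (by rw [C.proj_y, hq, hab])).1 ((hlink q hq).1 hqQ)
  rcases Finset.mem_union.1 ht with ht | ht
  · exact hQ.full_orb ha0 (hK _ ha) hfull t ht
  · refine hQ.full_orb hb0 (hK _ hb) (fun q hq => ?_) t ht
    refine (hQ.link_y hb0 (hK _ hb) hq).2 (hfull _ ?_)
    rw [C.proj_y, hq, ← hab, C.η_sq]

theorem extends_bigon (h : C.Inv K) (ha : C.η a ∈ K) (hb : C.η b ∈ K)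
    (h1 : C.η (C.ζ a) = C.ζ (C.ζ b)) (h2 : C.η (C.ζ (C.ζ a)) = C.ζ b)
    (hne : ¬ ∀ q, C.proj q = C.ζ a → C.σ₁ (C.σ₁ q) = q) :
    ∃ c, 2 * c ≤ C.fiberSize ∧ C.Extends K (C.orb a ∪ C.orb b) c := by
  have hproj : ∀ q, C.proj q = C.ζ a → C.proj ((C.σ₁ ^ 2) q) = C.ζ a := by
    intro q hq
    rw [pow_two, Equiv.Perm.mul_apply, proj_σ₁, proj_σ₁, hq, h1, C.ζ_cube, ← h2, C.η_sq, C.ζ_cube]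
  obtain ⟨P, hP, hPQ⟩ := exists_half_of_holonomy 2 hproj hne
  refine ⟨P.card, hP, P, le_rfl, fun Q hQ hK hsub t ht => ?_⟩
  have ha0 := h.full_base hQ hK ha
  have hb0 := h.full_base hQ hK hb
  have hfull := hPQ Q (fun q hq => hQ.link_bigon ha0 (hK _ ha) hb0 (hK _ hb) h1 h2 hq) hsub
  have horb := hQ.full_orb ha0 (hK _ ha) hfull
  rcases Finset.mem_union.1 ht with ht | ht
  · exact horb t ht
  · refine hQ.full_orb hb0 (hK _ hb) (fun q hq => ?_) t ht
    refine (hQ.link_y hb0 (hK _ hb) hq).2 (horb (C.ζ (C.ζ a)) (by simp [mem_orb]) _ ?_)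
    rw [C.proj_y, hq, ← h2, C.η_sq]

end Finite

end Spread

end ModularCover

/-! ### The potential of a set of vertices -/

namespace ModularCover

section Potential

variable {S T : Type*} {C : ModularCover S T} {a : T}

theorem ζ_ζ_ne (ha : C.ζ a ≠ a) : C.ζ (C.ζ a) ≠ a := by
  intro h
  apply ha
  have := C.ζ_cube a
  rwa [h] at this

theorem ζ_ne_ζ_ζ (ha : C.ζ a ≠ a) : C.ζ a ≠ C.ζ (C.ζ a) :=
  fun h => ha (C.ζ.injective h).symm

theorem η_ne_ζ_ζ (t : T) : C.η t ≠ C.ζ (C.ζ t) := by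
  intro h
  apply C.ne_rotate (C.η t)
  rw [C.η_sq, h, C.ζ_cube]

variable (C) [DecidableEq T]

/-- The number of `η`-edges leaving `K`. -/
def bd (K : Finset T) : ℕ := (K.filter fun t => C.η t ∉ K).card

/-- The budget of `K` with respect to vertex weights `w`, to be compared with four times the number
of points needed for `K`: besides its weight, `K` gets credit for the edges leading to new
triangles. -/
noncomputable def val (w : T → ℚ) (K : Finset T) : ℚ := ∑ t ∈ K, w t + C.fiberSize * C.bd K

/-- The vertices of `K` can be made full within the budget, up to an excess `d`. -/
def Reach (w : T → ℚ) (K : Finset T) (d : ℚ) : Prop :=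
  ∃ c : ℕ, C.Cost K c ∧ 4 * (c : ℚ) ≤ C.val w K + d

/-- Outside `K` there is no leaf next to `K`, and no triangle with two edges to `K`. -/
def Sparse (K : Finset T) : Prop :=
  ∀ t, t ∉ K → C.η t ∈ K → C.ζ t ≠ t ∧ C.η (C.ζ t) ∉ K ∧ C.η (C.ζ (C.ζ t)) ∉ K

variable {C} {K : Finset T} {w : T → ℚ}

theorem sum_orb {M : Type*} [AddCommMonoid M] (ha : C.ζ a ≠ a) (f : T → M) :
    ∑ t ∈ C.orb a, f t = f a + f (C.ζ a) + f (C.ζ (C.ζ a)) := by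
  rw [orb, Finset.sum_insert, Finset.sum_insert, Finset.sum_singleton, add_assoc]
  · simpa using ζ_ne_ζ_ζ ha
  · simp only [Finset.mem_insert, Finset.mem_singleton, not_or]
    exact ⟨ha.symm, (ζ_ζ_ne ha).symm⟩

theorem η_mem_orb_iff {t : T} (ht : t ∈ C.orb a) : C.η t ∈ C.orb a ↔ C.η t = t := by
  constructor
  · intro h
    have h1 := C.ne_rotate t
    have h2 := C.η_ne_ζ_ζ t
    rw [mem_orb] at ht h
    rcases ht with rfl | rfl | rfl
    · tauto
    · rw [C.ζ_cube] at h2; tauto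
    · rw [C.ζ_cube] at h1 h2; tauto
  · intro h
    rwa [h]

theorem Inv.disjoint_orb (h : C.Inv K) (ha : a ∉ K) : Disjoint K (C.orb a) := by
  rw [Finset.disjoint_right]
  intro t ht htK
  rw [mem_orb] at ht
  rcases ht with rfl | rfl | rfl
  · exact ha htK
  · exact ha (h.mem_of_ζ htK)
  · exact ha (h.mem_of_ζ (h.mem_of_ζ htK))

theorem bd_union {A : Finset T} (hd : Disjoint K A) :
    (C.bd (K ∪ A) : ℚ) = C.bd K + C.bd A - 2 * (A.filter fun t => C.η t ∈ K).card := by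
  have part : ∀ {K A : Finset T}, Disjoint K A →
      (K.filter fun t => C.η t ∉ K ∪ A).card + (K.filter fun t => C.η t ∈ A).card = C.bd K := by
    intro K A hd
    rw [bd, ← Finset.card_union_of_disjoint]
    · congr 1
      ext t
      simp only [Finset.mem_union, Finset.mem_filter, not_or]
      have hx : C.η t ∈ A → C.η t ∉ K := fun h => Finset.disjoint_right.1 hd h
      tauto
    · rw [Finset.disjoint_left]
      intro t ht ht'
      simp only [Finset.mem_union, Finset.mem_filter, not_or] at ht ht'
      exact ht.2.2 ht'.2
  have hswap : (K.filter fun t => C.η t ∈ A).card = (A.filter fun t => C.η t ∈ K).card := by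
    refine Finset.card_bij (fun t _ => C.η t) ?_ ?_ ?_
    · intro t ht
      simp only [Finset.mem_filter, C.η_sq] at ht ⊢
      exact ⟨ht.2, ht.1⟩
    · intro t _ u _ h
      exact C.η.injective h
    · intro t ht
      simp only [Finset.mem_filter] at ht
      exact ⟨C.η t, by simp [C.η_sq, ht.1, ht.2], C.η_sq t⟩
  have h1 := part hd
  have h2 := part hd.symm
  have h3 : C.bd (K ∪ A) = (K.filter fun t => C.η t ∉ K ∪ A).card +
      (A.filter fun t => C.η t ∉ A ∪ K).card := by
    rw [bd, Finset.filter_union, Finset.card_union_of_disjoint, Finset.union_comm A K]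
    exact Finset.disjoint_filter_filter hd
  have h1' : ((K.filter fun t => C.η t ∉ K ∪ A).card : ℚ) +
      (K.filter fun t => C.η t ∈ A).card = C.bd K := by exact_mod_cast h1
  have h2' : ((A.filter fun t => C.η t ∉ A ∪ K).card : ℚ) +
      (A.filter fun t => C.η t ∈ K).card = C.bd A := by exact_mod_cast h2
  rw [h3, ← h1', ← h2', hswap]
  push_cast
  ring

theorem bd_union_leaf (h : C.Inv K) (ha : a ∉ K) (hl : C.ζ a = a) (hη : C.η a ∈ K) :
    (C.bd (K ∪ C.orb a) : ℚ) = C.bd K - 1 := by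
  have horb : C.orb a = {a} := by simp [orb, hl]
  have hne : C.η a ≠ a := by have := C.ne_rotate a; rwa [hl] at this
  rw [bd_union (h.disjoint_orb ha), horb]
  have h1 : C.bd {a} = 1 := by simp [bd, Finset.filter_singleton, hne]
  have h2 : (({a} : Finset T).filter fun t => C.η t ∈ K).card = 1 := by
    simp [Finset.filter_singleton, hη]
  rw [h1, h2]
  norm_num
  ring

/-- The contribution of a triangle to the number of boundary edges: each edge to `K` removes two
boundary edges, each edge from the triangle to itself removes one. -/
theorem bd_union_orb (h : C.Inv K) (ha : a ∉ K) (ht : C.ζ a ≠ a) :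
    (C.bd (K ∪ C.orb a) : ℚ) = C.bd K + (3 - ((if C.η a = a then 1 else 0) +
      (if C.η (C.ζ a) = C.ζ a then 1 else 0) +
      (if C.η (C.ζ (C.ζ a)) = C.ζ (C.ζ a) then 1 else 0)) -
      2 * ((if C.η a ∈ K then 1 else 0) + (if C.η (C.ζ a) ∈ K then 1 else 0) +
        (if C.η (C.ζ (C.ζ a)) ∈ K then 1 else 0))) := by
  rw [bd_union (h.disjoint_orb ha)]
  have h1 : (C.bd (C.orb a) : ℚ) = 3 - ((if C.η a = a then 1 else 0) +
      (if C.η (C.ζ a) = C.ζ a then 1 else 0) +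
      (if C.η (C.ζ (C.ζ a)) = C.ζ (C.ζ a) then 1 else 0)) := by
    have : (C.bd (C.orb a) : ℚ) = ∑ t ∈ C.orb a, (1 - if C.η t = t then 1 else 0 : ℚ) := by
      rw [bd, Finset.card_filter]
      push_cast
      refine Finset.sum_congr rfl fun t ht => ?_
      have hiff := η_mem_orb_iff ht
      by_cases h : C.η t = t <;> simp [hiff, h, ht]
    rw [this, sum_orb ht]
    ring
  have h2 : (((C.orb a).filter fun t => C.η t ∈ K).card : ℚ) = (if C.η a ∈ K then 1 else 0) +
      (if C.η (C.ζ a) ∈ K then 1 else 0) + (if C.η (C.ζ (C.ζ a)) ∈ K then 1 else 0) := by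
    rw [Finset.card_filter]
    push_cast
    rw [sum_orb ht]
  rw [h1, h2]
  ring

theorem val_union_orb (h : C.Inv K) (ha : a ∉ K) (ht : C.ζ a ≠ a) :
    C.val w (K ∪ C.orb a) = C.val w K + (w a + w (C.ζ a) + w (C.ζ (C.ζ a))) +
      C.fiberSize * (3 - ((if C.η a = a then 1 else 0) +
      (if C.η (C.ζ a) = C.ζ a then 1 else 0) +
      (if C.η (C.ζ (C.ζ a)) = C.ζ (C.ζ a) then 1 else 0)) -
      2 * ((if C.η a ∈ K then 1 else 0) + (if C.η (C.ζ a) ∈ K then 1 else 0) +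
        (if C.η (C.ζ (C.ζ a)) ∈ K then 1 else 0))) := by
  rw [val, val, Finset.sum_union (h.disjoint_orb ha), sum_orb ht, bd_union_orb h ha ht]
  ring

theorem Reach.mono {d d' : ℚ} (h : C.Reach w K d) (hd : d ≤ d') : C.Reach w K d' := by
  obtain ⟨c, hc, hcd⟩ := h
  exact ⟨c, hc, by linarith⟩

theorem Reach.extend {A : Finset T} {d d' : ℚ} {c : ℕ} (h : C.Reach w K d)
    (hA : C.Extends K A c) (hd : C.val w K + d + 4 * (c : ℚ) ≤ C.val w (K ∪ A) + d') :
    C.Reach w (K ∪ A) d' := by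
  obtain ⟨c₀, hc, hcd⟩ := h
  exact ⟨c₀ + c, hc.union hA, by push_cast; linarith⟩

theorem exists_of_bd_pos (h : 1 ≤ C.bd K) : ∃ a, a ∉ K ∧ C.η a ∈ K := by
  obtain ⟨t, ht⟩ := Finset.card_pos.1 h
  rw [Finset.mem_filter] at ht
  exact ⟨C.η t, ht.2, by rw [C.η_sq]; exact ht.1⟩

theorem eq_univ_of_bd [Fintype T] (h : C.Inv K) (hne : K.Nonempty) (h0 : C.bd K = 0) :
    K = Finset.univ := by
  have := C.eq_univ (K : Set T) (by exact_mod_cast hne) (fun t ht => h t ht) (fun t ht => by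
    by_contra hcon
    have : t ∈ K.filter fun t => C.η t ∉ K := Finset.mem_filter.2 ⟨ht, hcon⟩
    rw [Finset.card_eq_zero.1 h0] at this
    simp at this)
  exact_mod_cast this

section Finite

variable [Fintype S]

/-- Any set of vertices with a boundary edge can be enlarged within the budget. -/
theorem Reach.exists_larger (hw : ∀ t, (C.fiberSize : ℚ) ≤ w t) (hN : 2 ≤ C.fiberSize)
    (h : C.Inv K) (hbd : 1 ≤ C.bd K) {d : ℚ} (hr : C.Reach w K d) :
    ∃ K', K ⊂ K' ∧ C.Inv K' ∧ C.Reach w K' d := by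
  obtain ⟨a, ha, haK⟩ := exists_of_bd_pos hbd
  have hNQ : (2 : ℚ) ≤ C.fiberSize := by exact_mod_cast hN
  refine ⟨K ∪ C.orb a, ?_, h.union inv_orb, ?_⟩
  · refine Finset.ssubset_iff_subset_ne.2 ⟨Finset.subset_union_left, fun he => ha ?_⟩
    rw [he]
    simp [mem_orb]
  by_cases hl : C.ζ a = a
  · refine hr.extend (extends_leaf h haK hl) ?_
    have horb : C.orb a = {a} := by simp [orb, hl]
    rw [val, val, bd_union_leaf h ha hl haK, Finset.sum_union (h.disjoint_orb ha), horb,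
      Finset.sum_singleton]
    have := hw a
    push_cast
    linarith
  have hne : C.η a ≠ a := fun he => ha (by rwa [he] at haK)
  have w0 := hw a
  have w1 := hw (C.ζ a)
  have w2 := hw (C.ζ (C.ζ a))
  by_cases h2 : C.η (C.ζ a) ∈ K ∨ C.η (C.ζ (C.ζ a)) ∈ K
  · refine hr.extend (extends_two h haK h2) ?_
    rw [val_union_orb h ha hl]
    simp only [hne, haK, if_true, if_false]
    have e1 : C.η (C.ζ a) ∈ K → C.η (C.ζ a) ≠ C.ζ a :=
      fun hK he => ha (h.mem_of_ζ (by rwa [he] at hK))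
    have e2 : C.η (C.ζ (C.ζ a)) ∈ K → C.η (C.ζ (C.ζ a)) ≠ C.ζ (C.ζ a) :=
      fun hK he => ha (h.mem_of_ζ (h.mem_of_ζ (by rwa [he] at hK)))
    split_ifs <;> first | (push_cast; linarith) | tauto
  · rw [not_or] at h2
    by_cases h3 : C.η (C.ζ a) = C.ζ a ∨ C.η (C.ζ (C.ζ a)) = C.ζ (C.ζ a)
    · refine hr.extend (extends_semi h haK h3) ?_
      rw [val_union_orb h ha hl]
      simp only [hne, haK, if_true, if_false, h2]
      split_ifs <;> (push_cast; linarith)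
    · rw [not_or] at h3
      refine hr.extend (extends_one h haK) ?_
      rw [val_union_orb h ha hl]
      simp only [hne, haK, if_true, if_false, h2, h3]
      linarith

theorem Reach.cost_univ [Fintype T] (hw : ∀ t, (C.fiberSize : ℚ) ≤ w t) (hN : 2 ≤ C.fiberSize)
    (h : C.Inv K) (hne : K.Nonempty) (hr : C.Reach w K 0) :
    ∃ c : ℕ, C.Cost Finset.univ c ∧ 4 * (c : ℚ) ≤ ∑ t, w t := by
  induction hn : Kᶜ.card using Nat.strong_induction_on generalizing K with
  | _ n ih =>
    rcases Nat.eq_zero_or_pos (C.bd K) with h0 | hpos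
    · have := eq_univ_of_bd h hne h0
      subst this
      obtain ⟨c, hc, hcd⟩ := hr
      refine ⟨c, hc, ?_⟩
      rw [val, h0] at hcd
      simpa using hcd
    · obtain ⟨K', hK', hinv, hr'⟩ := hr.exists_larger hw hN h hpos
      refine ih _ ?_ hinv (hne.mono hK'.1) hr' rfl
      rw [← hn]
      exact Finset.card_lt_card (Finset.compl_ssubset_compl.2 hK')

end Finite

end Potential

end ModularCover

/-! ### Double edges and bigons -/

namespace ModularCover

section Gain

variable {S T : Type*} {C : ModularCover S T} {K : Finset T} {a b : T} {w : T → ℚ} {d : ℚ}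

theorem η_ne_of_mem (ha : a ∉ K) (haK : C.η a ∈ K) : C.η a ≠ a :=
  fun he => ha (by rwa [he] at haK)

theorem Inv.ζ_notMem (h : C.Inv K) (ha : a ∉ K) : C.ζ a ∉ K := fun hc => ha (h.mem_of_ζ hc)

theorem odd_of_semi {t : T} (ht : C.η t = t) : Odd C.fiberSize := by
  obtain ⟨s, hs⟩ := C.proj_surj t
  obtain ⟨k, hk⟩ := C.exists_zpow' (s := C.y s) (s' := s) (by rw [C.proj_y, hs, ht])
  have h2 : (C.Δ ^ (1 : ℤ)) s = (C.Δ ^ (k + k)) s := by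
    rw [zpow_one, ← C.y_y, hk, ← C.zpow_y, hk, C.zpow_zpow]
  rw [C.zpow_eq_zpow_iff] at h2
  have hodd : Odd ((C.fiberSize : ℤ)) := by
    obtain ⟨m, hm⟩ := h2
    rcases Int.even_or_odd (C.fiberSize : ℤ) with ⟨e, he⟩ | ho
    · rw [he] at hm; exfalso; have : 2 * (e * m + k) = 1 := by linarith
      omega
    · exact ho
  exact_mod_cast hodd

theorem five_le_of_semi {t : T} (hN : 2 ≤ C.fiberSize) (hN3 : ¬ 3 ∣ C.fiberSize)
    (ht : C.η t = t) : 5 ≤ C.fiberSize := by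
  obtain ⟨k, hk⟩ := odd_of_semi ht
  omega

/-- The four vertices around a bigon with trivial holonomy lie on cycles of length two. -/
theorem bigon_weights (hw2 : ∀ t, (∀ q, C.proj q = t → C.σ₁ (C.σ₁ q) = q) →
      4 / 3 * (C.fiberSize : ℚ) ≤ w t ∧ 4 / 3 * (C.fiberSize : ℚ) ≤ w (C.η t))
    (h1 : C.η (C.ζ a) = C.ζ (C.ζ b)) (h2 : C.η (C.ζ (C.ζ a)) = C.ζ b)
    (hhol : ∀ q, C.proj q = C.ζ a → C.σ₁ (C.σ₁ q) = q) :
    4 / 3 * (C.fiberSize : ℚ) ≤ w (C.ζ a) ∧ 4 / 3 * (C.fiberSize : ℚ) ≤ w (C.ζ (C.ζ a)) ∧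
    4 / 3 * (C.fiberSize : ℚ) ≤ w (C.ζ b) ∧ 4 / 3 * (C.fiberSize : ℚ) ≤ w (C.ζ (C.ζ b)) := by
  have ha := hw2 _ hhol
  have hb := hw2 (C.ζ b) (fun q hq => by
    have hp : C.proj (C.σ₁ q) = C.ζ a := by
      rw [C.proj_σ₁, hq, ← h2, C.η_sq, C.ζ_cube]
    exact C.σ₁.injective (hhol _ hp))
  rw [h1] at ha
  rw [← h2, C.η_sq, h2] at hb
  exact ⟨ha.1, hb.2, hb.1, ha.2⟩

variable [DecidableEq T]

theorem exists_two_of_not_sparse (h : ¬ C.Sparse K) :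
    ∃ t, t ∉ K ∧ C.η t ∈ K ∧ (C.ζ t = t ∨ (C.ζ t ≠ t ∧ C.η (C.ζ t) ∈ K)) ∨
      t ∉ K ∧ C.η t ∈ K ∧ C.ζ t ≠ t ∧ C.η (C.ζ (C.ζ t)) ∈ K := by
  unfold Sparse at h
  push Not at h
  obtain ⟨t, h1, h2, h3⟩ := h
  refine ⟨t, ?_⟩
  by_cases h4 : C.ζ t = t
  · tauto
  · by_cases h5 : C.η (C.ζ t) ∈ K
    · tauto
    · exact Or.inr ⟨h1, h2, h4, by_contra fun h6 => h6 (h3 h4 h5)⟩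

/-- A violation of sparseness is a leaf next to `K`, or a triangle with two edges to `K`, rotated
such that these start at `t` and `ζ t`. -/
theorem Inv.exists_of_not_sparse (hK : C.Inv K) (h : ¬ C.Sparse K) :
    ∃ t, t ∉ K ∧ C.η t ∈ K ∧ (C.ζ t = t ∨ (C.ζ t ≠ t ∧ C.η (C.ζ t) ∈ K)) := by
  obtain ⟨t, h | ⟨h1, h2, h3, h4⟩⟩ := exists_two_of_not_sparse h
  · exact ⟨t, h⟩
  · refine ⟨C.ζ (C.ζ t), fun h => h1 (hK.mem_of_ζ (hK.mem_of_ζ h)), h4, Or.inr ⟨?_, ?_⟩⟩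
    · rw [C.ζ_cube]
      exact (ζ_ζ_ne h3).symm
    · rwa [C.ζ_cube]

theorem η_eq_of_mem_orb (haK : C.η a ∈ K)
    (hb : C.η b ∈ C.orb a) (hbK : b ∉ K) : C.η b = C.ζ a ∨ C.η b = C.ζ (C.ζ a) := by
  rcases mem_orb.1 hb with h | h
  · rw [C.η_eq_iff] at h
    exact absurd (h ▸ haK) hbK
  · exact h

/-- Two triangles outside `K`, joined by a double edge, each of them having its third edge to
`K`. -/
structure DoubleEdge (C : ModularCover S T) (K : Finset T) (a b : T) : Prop where
  a_notMem : a ∉ K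
  b_notMem : b ∉ K
  b_notMem_orb : b ∉ C.orb a
  ηa_mem : C.η a ∈ K
  ηb_mem : C.η b ∈ K
  ζa_ne : C.ζ a ≠ a
  ζb_ne : C.ζ b ≠ b
  η_ζ_cases : C.η (C.ζ a) = C.ζ b ∨ C.η (C.ζ a) = C.ζ (C.ζ b)
  η_ζ_ζ_cases : C.η (C.ζ (C.ζ a)) = C.ζ b ∨ C.η (C.ζ (C.ζ a)) = C.ζ (C.ζ b)

/-- A double edge that bounds a bigon, with trivial holonomy: the `σ₁`-cycles over the bigon have
length two. -/
structure Bigon (C : ModularCover S T) (K : Finset T) (a b : T) : Prop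
    extends DoubleEdge C K a b where
  η_ζ : C.η (C.ζ a) = C.ζ (C.ζ b)
  η_ζ_ζ : C.η (C.ζ (C.ζ a)) = C.ζ b
  holonomy : ∀ q, C.proj q = C.ζ a → C.σ₁ (C.σ₁ q) = q

/-- Adding two triangles joined by a double edge removes two boundary edges. -/
theorem DoubleEdge.bd (hg : C.DoubleEdge K a b) (h : C.Inv K) :
    (C.bd (K ∪ C.orb a ∪ C.orb b) : ℚ) = C.bd K - 2 := by
  obtain ⟨ha, hb, hab, haK, hbK, hta, htb, h1, h2⟩ := hg
  have hKa := h.union (inv_orb (a := a) (C := C))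
  have hb' : b ∉ K ∪ C.orb a := by rw [Finset.mem_union]; tauto
  rw [bd_union_orb hKa hb' htb, bd_union_orb h ha hta]
  have hζb := hKa.ζ_notMem hb'
  have hζζb := hKa.ζ_notMem hζb
  have m1 : C.ζ a ∈ K ∪ C.orb a := by simp [mem_orb]
  have m2 : C.ζ (C.ζ a) ∈ K ∪ C.orb a := by simp [mem_orb]
  have hd : C.ζ a ≠ C.ζ (C.ζ a) := ζ_ne_ζ_ζ hta
  have hbmem : C.η (C.ζ b) ∈ K ∪ C.orb a ∧ C.η (C.ζ (C.ζ b)) ∈ K ∪ C.orb a := by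
    rcases h1 with h1 | h1 <;> rcases h2 with h2 | h2
    · exact absurd (C.η_inj.1 (h1.trans h2.symm)) hd
    · rw [← h2, ← h1, C.η_sq, C.η_sq]; exact ⟨m1, m2⟩
    · rw [← h1, ← h2, C.η_sq, C.η_sq]; exact ⟨m2, m1⟩
    · exact absurd (C.η_inj.1 (h1.trans h2.symm)) hd
  have hamem : C.η (C.ζ a) ∉ K ∪ C.orb a ∧ C.η (C.ζ (C.ζ a)) ∉ K ∪ C.orb a := by
    constructor
    · rcases h1 with h1 | h1 <;> rw [h1] <;> assumption
    · rcases h2 with h2 | h2 <;> rw [h2] <;> assumption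
  have n1 : C.η (C.ζ a) ≠ C.ζ a := fun he => hamem.1 (by rw [he]; exact m1)
  have n2 : C.η (C.ζ (C.ζ a)) ≠ C.ζ (C.ζ a) := fun he => hamem.2 (by rw [he]; exact m2)
  have n3 : C.η (C.ζ b) ≠ C.ζ b := fun he => hζb (by rw [← he]; exact hbmem.1)
  have n4 : C.η (C.ζ (C.ζ b)) ≠ C.ζ (C.ζ b) := fun he => hζζb (by rw [← he]; exact hbmem.2)
  have n5 : C.η b ∈ K ∪ C.orb a := Finset.mem_union_left _ hbK
  have k1 : C.η (C.ζ a) ∉ K := fun hc => hamem.1 (Finset.mem_union_left _ hc)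
  have k2 : C.η (C.ζ (C.ζ a)) ∉ K := fun hc => hamem.2 (Finset.mem_union_left _ hc)
  simp only [haK, n1, n2, n3, n4, n5, k1, k2, hbmem, η_ne_of_mem ha haK, η_ne_of_mem hb hbK,
    if_true, if_false]
  ring

theorem DoubleEdge.val (hg : C.DoubleEdge K a b) (h : C.Inv K) :
    C.val w (K ∪ C.orb a ∪ C.orb b) = C.val w K +
    (w a + w (C.ζ a) + w (C.ζ (C.ζ a))) + (w b + w (C.ζ b) + w (C.ζ (C.ζ b))) -
    2 * C.fiberSize := by
  have hbd := hg.bd h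
  obtain ⟨ha, hb, hab, haK, hbK, hta, htb, h1, h2⟩ := hg
  have hKa := h.union (inv_orb (a := a) (C := C))
  have hb' : b ∉ K ∪ C.orb a := by rw [Finset.mem_union]; tauto
  rw [ModularCover.val, hbd, ModularCover.val,
    Finset.sum_union (hKa.disjoint_orb hb'), Finset.sum_union (h.disjoint_orb ha), sum_orb hta,
    sum_orb htb]
  ring

theorem Sparse.union {A : Finset T} (hs : C.Sparse K) (hA : C.Inv (K ∪ A))
    (h : ∀ t, t ∉ K ∪ A → C.η t ∈ A → False) : C.Sparse (K ∪ A) := by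
  intro t ht hηt
  have key : ∀ t, t ∉ K ∪ A → C.η t ∈ K ∪ A → C.η t ∈ K := fun t ht hη =>
    (Finset.mem_union.1 hη).resolve_right (h t ht)
  obtain ⟨e1, e2, e3⟩ := hs t (fun hc => ht (Finset.mem_union_left _ hc)) (key t ht hηt)
  exact ⟨e1, fun hc => e2 (key _ (hA.ζ_notMem ht) hc),
    fun hc => e3 (key _ (hA.ζ_notMem (hA.ζ_notMem ht)) hc)⟩

variable [Fintype S]

/-- A set that can be reached with an excess lowered by twice the fibre size. -/
def BigGain (C : ModularCover S T) (w : T → ℚ) (d : ℚ) : Prop :=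
  ∃ K, C.Inv K ∧ K.Nonempty ∧ C.Reach w K (d - 2 * C.fiberSize)

theorem bigGain_or_bigon_of_double (hw : ∀ t, (C.fiberSize : ℚ) ≤ w t) (hN : 2 ≤ C.fiberSize)
    (h : C.Inv K) (hr : C.Reach w K d) (hg : C.DoubleEdge K a b) :
    C.BigGain w d ∨ C.Bigon K a b := by
  have hNQ : (2 : ℚ) ≤ C.fiberSize := by exact_mod_cast hN
  have hval := hg.val (w := w) h
  obtain ⟨ha, hb, hab, haK, hbK, hta, htb, h1, h2⟩ := id hg
  have hinv : C.Inv (K ∪ (C.orb a ∪ C.orb b)) := h.union (inv_orb.union inv_orb)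
  have hne : (K ∪ (C.orb a ∪ C.orb b)).Nonempty := ⟨a, by simp [mem_orb]⟩
  have key : ∀ c : ℕ, 2 * c ≤ C.fiberSize → C.Extends K (C.orb a ∪ C.orb b) c →
      C.BigGain w d := by
    intro c hc hE
    refine ⟨_, hinv, hne, hr.extend hE ?_⟩
    have hcQ : 2 * (c : ℚ) ≤ C.fiberSize := by exact_mod_cast hc
    rw [← Finset.union_assoc, hval]
    linarith [hw a, hw (C.ζ a), hw (C.ζ (C.ζ a)), hw b, hw (C.ζ b), hw (C.ζ (C.ζ b))]
  rcases h1 with e1 | e1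
  · exact Or.inl (key 1 hN (extends_twisted h haK hbK e1))
  · have e2 : C.η (C.ζ (C.ζ a)) = C.ζ b := by
      rcases h2 with h2 | h2
      · exact h2
      · exact absurd (C.η_inj.1 (e1.trans h2.symm)) (ζ_ne_ζ_ζ hta)
    by_cases hhol : ∀ q, C.proj q = C.ζ a → C.σ₁ (C.σ₁ q) = q
    · exact Or.inr ⟨hg, e1, e2, hhol⟩
    · obtain ⟨c, hc, hE⟩ := extends_bigon h haK hbK e1 e2 hhol
      exact Or.inl (key c hc hE)

theorem Bigon.gain (hg : C.Bigon K a b) (hw : ∀ t, (C.fiberSize : ℚ) ≤ w t)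
    (hw2 : ∀ t, (∀ q, C.proj q = t → C.σ₁ (C.σ₁ q) = q) →
      4 / 3 * (C.fiberSize : ℚ) ≤ w t ∧ 4 / 3 * (C.fiberSize : ℚ) ≤ w (C.η t))
    (h : C.Inv K) (hs : C.Sparse K) (hr : C.Reach w K d) :
    ∃ K', C.Inv K' ∧ C.Sparse K' ∧ C.bd K ≤ C.bd K' + 2 ∧ K'.Nonempty ∧
      C.Reach w K' (d - C.fiberSize) := by
  have hbd := hg.bd h
  have hval := hg.val (w := w) h
  obtain ⟨⟨ha, hb, hab, haK, hbK, hta, htb, -, -⟩, h1, h2, hhol⟩ := hg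
  have hKa := h.union (inv_orb (a := a) (C := C))
  have hKab := hKa.union (inv_orb (a := b) (C := C))
  have hbig := bigon_weights hw2 h1 h2 hhol
  refine ⟨K ∪ C.orb a ∪ C.orb b, hKab, ?_, ?_, ⟨a, by simp [mem_orb]⟩, ?_⟩
  · rw [Finset.union_assoc] at hKab ⊢
    refine hs.union hKab fun t ht hη => ?_
    have hm : t = C.η a ∨ t = C.η (C.ζ a) ∨ t = C.η (C.ζ (C.ζ a)) ∨
        t = C.η b ∨ t = C.η (C.ζ b) ∨ t = C.η (C.ζ (C.ζ b)) := by
      rw [Finset.mem_union, mem_orb, mem_orb] at hη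
      simp only [C.η_eq_iff] at hη
      tauto
    have h1' : C.η (C.ζ (C.ζ b)) = C.ζ a := by rw [← h1, C.η_sq]
    have h2' : C.η (C.ζ b) = C.ζ (C.ζ a) := by rw [← h2, C.η_sq]
    rw [h1, h2, h1', h2'] at hm
    simp only [Finset.mem_union, mem_orb, not_or] at ht
    rcases hm with rfl | rfl | rfl | rfl | rfl | rfl <;> tauto
  · have : (C.bd K : ℚ) ≤ ((C.bd (K ∪ C.orb a ∪ C.orb b) + 2 : ℕ) : ℚ) := by
      push_cast; linarith
    exact_mod_cast this
  · have hra : C.Reach w (K ∪ C.orb a)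
        (C.val w K + d + 4 * (C.fiberSize : ℚ) - C.val w (K ∪ C.orb a)) :=
      hr.extend (extends_one h haK) (by linarith)
    refine hra.extend (extends_two hKa (Finset.mem_union_left _ hbK) (Or.inl ?_)) ?_
    · rw [← h2, C.η_sq]; simp [mem_orb]
    · rw [hval]
      push_cast
      linarith [hw a, hw b]

end Gain

end ModularCover

/-! ### Growing a sparse set until something is gained -/

namespace ModularCover

section ExistsGain

variable {S T : Type*} {C : ModularCover S T} [DecidableEq T] {K : Finset T} {a : T}
  {w : T → ℚ} {d : ℚ}

/-- A triangle with at least two edges to `K` costs nothing; it gains `2 N`, or `N` if its third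
edge leads back to it, unless all three of its edges lead to `K`. -/
theorem Reach.extend_two (hr : C.Reach w K d) (hw : ∀ t, (C.fiberSize : ℚ) ≤ w t) (h : C.Inv K)
    (ha : a ∉ K) (hta : C.ζ a ≠ a) (haK : C.η a ∈ K) (haK1 : C.η (C.ζ a) ∈ K)
    (haK2 : C.η (C.ζ (C.ζ a)) ∉ K) :
    (C.η (C.ζ (C.ζ a)) ≠ C.ζ (C.ζ a) → C.Reach w (K ∪ C.orb a) (d - 2 * C.fiberSize)) ∧
    C.Reach w (K ∪ C.orb a) (d - C.fiberSize) := by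
  have n0 := η_ne_of_mem ha haK
  have n1 := η_ne_of_mem (h.ζ_notMem ha) haK1
  constructor
  · intro hne
    refine hr.extend (extends_two h haK (Or.inl haK1)) ?_
    rw [val_union_orb h ha hta]
    simp only [n0, n1, hne, haK, haK1, haK2, if_true, if_false]
    push_cast
    linarith [hw a, hw (C.ζ a), hw (C.ζ (C.ζ a))]
  · refine hr.extend (extends_two h haK (Or.inl haK1)) ?_
    rw [val_union_orb h ha hta]
    simp only [n0, n1, haK, haK1, haK2, if_true, if_false]
    have hN : (0 : ℚ) ≤ C.fiberSize := by positivity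
    split_ifs <;> (push_cast; linarith [hw a, hw (C.ζ a), hw (C.ζ (C.ζ a))])

/-- A triangle `p` with three edges to `K ∪ orb a` forms a double edge with `a`, as at most one of
its edges leads to `K`. -/
theorem Sparse.exists_doubleEdge (hs : C.Sparse K) (h : C.Inv K) (ha : a ∉ K) (haK : C.η a ∈ K)
    {p : T} (hp : p ∉ K ∪ C.orb a) (htp : C.ζ p ≠ p) (h0 : C.η p ∈ K ∪ C.orb a)
    (h1 : C.η (C.ζ p) ∈ K ∪ C.orb a) (h2 : C.η (C.ζ (C.ζ p)) ∈ K ∪ C.orb a) :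
    ∃ b ∈ C.orb p, C.DoubleEdge K a b := by
  have hKa := h.union (inv_orb (a := a) (C := C))
  -- Rotate the triangle such that its edge to `K` starts at `b`.
  have core : ∀ b, b ∉ K ∪ C.orb a → C.ζ b ≠ b → C.η b ∈ K → C.η (C.ζ b) ∈ K ∪ C.orb a →
      C.η (C.ζ (C.ζ b)) ∈ K ∪ C.orb a → C.DoubleEdge K a b := by
    intro b hb htb hbK h1 h2
    have hbK' : b ∉ K := fun hc => hb (Finset.mem_union_left _ hc)
    have hζ := h.ζ_notMem hbK'
    have e1 := η_eq_of_mem_orb haK ((Finset.mem_union.1 h1).resolve_left (hs b hbK' hbK).2.1) hζ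
    have e2 := η_eq_of_mem_orb haK ((Finset.mem_union.1 h2).resolve_left (hs b hbK' hbK).2.2)
      (h.ζ_notMem hζ)
    have hdist : C.η (C.ζ b) ≠ C.η (C.ζ (C.ζ b)) := fun he => ζ_ne_ζ_ζ htb (C.η_inj.1 he)
    refine ⟨ha, hbK', fun hc => hb (Finset.mem_union_right _ hc), haK, hbK, (hs a ha haK).1, htb,
      ?_, ?_⟩
    · rw [C.η_eq_iff, C.η_eq_iff, eq_comm, eq_comm (a := C.ζ a)]
      rcases e1 with e1 | e1
      · exact Or.inl e1
      · rcases e2 with e2 | e2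
        · exact Or.inr e2
        · exact absurd (e1.trans e2.symm) hdist
    · rw [C.η_eq_iff, C.η_eq_iff, eq_comm, eq_comm (a := C.ζ (C.ζ a))]
      rcases e1 with e1 | e1
      · rcases e2 with e2 | e2
        · exact absurd (e1.trans e2.symm) hdist
        · exact Or.inr e2
      · exact Or.inl e1
  have hp1 := hKa.ζ_notMem hp
  have hp2 := hKa.ζ_notMem hp1
  by_cases k0 : C.η p ∈ K
  · exact ⟨p, by simp [mem_orb], core p hp htp k0 h1 h2⟩
  by_cases k1 : C.η (C.ζ p) ∈ K
  · exact ⟨C.ζ p, by simp [mem_orb], core _ hp1 (ζ_ne_ζ_ζ htp).symm k1 h2 (by rwa [C.ζ_cube])⟩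
  by_cases k2 : C.η (C.ζ (C.ζ p)) ∈ K
  · exact ⟨C.ζ (C.ζ p), by simp [mem_orb], core _ hp2 (by rw [C.ζ_cube]; exact (ζ_ζ_ne htp).symm) k2
      (by rwa [C.ζ_cube]) (by rwa [C.ζ_cube])⟩
  -- Three edges cannot lead to the two free vertices of `a`.
  exfalso
  have nK : ∀ {t}, t ∉ K ∪ C.orb a → t ∉ K := fun ht hc => ht (Finset.mem_union_left _ hc)
  have e0 := η_eq_of_mem_orb haK ((Finset.mem_union.1 h0).resolve_left k0) (nK hp)
  have e1 := η_eq_of_mem_orb haK ((Finset.mem_union.1 h1).resolve_left k1) (nK hp1)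
  have e2 := η_eq_of_mem_orb haK ((Finset.mem_union.1 h2).resolve_left k2) (nK hp2)
  have d01 : C.η p ≠ C.η (C.ζ p) := fun he => htp (C.η_inj.1 he).symm
  have d02 : C.η p ≠ C.η (C.ζ (C.ζ p)) := fun he => ζ_ζ_ne htp (C.η_inj.1 he).symm
  have d12 : C.η (C.ζ p) ≠ C.η (C.ζ (C.ζ p)) := fun he => ζ_ne_ζ_ζ htp (C.η_inj.1 he)
  rcases e0 with e0 | e0 <;> rcases e1 with e1 | e1 <;> rcases e2 with e2 | e2 <;>
    simp_all

/-- A gain of at least `N` that leaves a sparse set with almost as many boundary edges. -/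
def SmallGain (C : ModularCover S T) (w : T → ℚ) (d : ℚ) (n : ℕ) : Prop :=
  ∃ K, C.Inv K ∧ C.Sparse K ∧ n ≤ C.bd K + 1 ∧ K.Nonempty ∧ C.Reach w K (d - C.fiberSize)

/-- In the situation of a `y`-edge from the triangle of `p` to itself, whose other two edges lead to
`K ∪ orb a`, the enlarged set is sparse or allows for a further gain. -/
theorem gain_of_semi (hw : ∀ t, (C.fiberSize : ℚ) ≤ w t) (h : C.Inv K) (hs : C.Sparse K)
    (ha : a ∉ K) (haK : C.η a ∈ K) (hl1 : C.ζ (C.η (C.ζ a)) ≠ C.η (C.ζ a))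
    (hl2 : C.ζ (C.η (C.ζ (C.ζ a))) ≠ C.η (C.ζ (C.ζ a))) {p : T} (hp : p ∉ K ∪ C.orb a)
    (h0 : C.η p ∈ K ∪ C.orb a) (h1 : C.η (C.ζ p) ∈ K ∪ C.orb a)
    (h2 : C.η (C.ζ (C.ζ p)) = C.ζ (C.ζ p))
    (hr : C.Reach w (K ∪ C.orb a ∪ C.orb p) (d - C.fiberSize)) :
    C.BigGain w d ∨ C.Sparse (K ∪ C.orb a ∪ C.orb p) := by
  have hKa := h.union (inv_orb (a := a) (C := C))
  have hKap := hKa.union (inv_orb (a := p) (C := C))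
  by_cases hs2 : C.Sparse (K ∪ C.orb a ∪ C.orb p)
  · exact Or.inr hs2
  left
  obtain ⟨t, ht, hηt, hcase⟩ := hKap.exists_of_not_sparse hs2
  have nKa : ∀ {t}, t ∉ K ∪ C.orb a ∪ C.orb p → t ∉ K ∪ C.orb a :=
    fun ht hc => ht (Finset.mem_union_left _ hc)
  have nK : ∀ {t}, t ∉ K ∪ C.orb a ∪ C.orb p → t ∉ K :=
    fun ht hc => nKa ht (Finset.mem_union_left _ hc)
  -- The triangle of `p` has no free vertex.
  have hKa' : ∀ t, t ∉ K ∪ C.orb a ∪ C.orb p → C.η t ∈ K ∪ C.orb a ∪ C.orb p →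
      C.η t ∈ K ∪ C.orb a := by
    intro t ht hη
    refine (Finset.mem_union.1 hη).resolve_right fun hc => ?_
    rw [mem_orb, C.η_eq_iff, C.η_eq_iff, C.η_eq_iff, h2] at hc
    rcases hc with rfl | rfl | rfl
    · exact nKa ht h0
    · exact nKa ht h1
    · exact ht (Finset.mem_union_right _ (by simp [mem_orb]))
  have hcases : ∀ t, t ∉ K ∪ C.orb a ∪ C.orb p → C.η t ∈ K ∪ C.orb a ∪ C.orb p →
      C.η t ∈ K ∨ C.η t = C.ζ a ∨ C.η t = C.ζ (C.ζ a) := by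
    intro t ht hη
    rcases Finset.mem_union.1 (hKa' t ht hη) with hc | hc
    · exact Or.inl hc
    · exact Or.inr (η_eq_of_mem_orb haK hc (nK ht))
  rcases hcase with hl | ⟨htt, hη1⟩
  · exfalso
    rcases hcases t ht hηt with hc | hc | hc
    · exact (hs t (nK ht) hc).1 hl
    · rw [C.η_eq_iff] at hc; subst hc; exact hl1 hl
    · rw [C.η_eq_iff] at hc; subst hc; exact hl2 hl
  · have ht1 := hKap.ζ_notMem ht
    have ht2 := hKap.ζ_notMem ht1
    by_cases hη2 : C.η (C.ζ (C.ζ t)) ∈ K ∪ C.orb a ∪ C.orb p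
    · -- At most one edge of `t` leads to `K`, the others take both free vertices of `a`; but one of
      -- these belongs to an edge to `p`.
      exfalso
      obtain ⟨b, hbt, hb⟩ := hs.exists_doubleEdge h ha haK (nKa ht) htt (hKa' _ ht hηt)
        (hKa' _ ht1 hη1) (hKa' _ ht2 hη2)
      obtain ⟨b', hb'⟩ : ∃ x, x ∈ C.orb p ∧ x ∉ K ∪ C.orb a ∧
          (C.η x = C.ζ a ∨ C.η x = C.ζ (C.ζ a)) := by
        have hpK : p ∉ K := fun hc => hp (Finset.mem_union_left _ hc)
        by_cases k0 : C.η p ∈ K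
        · exact ⟨C.ζ p, by simp [mem_orb], hKa.ζ_notMem hp, η_eq_of_mem_orb haK
            ((Finset.mem_union.1 h1).resolve_left (hs p hpK k0).2.1) (h.ζ_notMem hpK)⟩
        · exact ⟨p, by simp [mem_orb], hp, η_eq_of_mem_orb haK
            ((Finset.mem_union.1 h0).resolve_left k0) hpK⟩
      have hb1 := inv_orb _ hbt
      have hb2 := inv_orb _ hb1
      have hb't : b' ∈ C.orb t := by
        obtain ⟨-, -, hb''⟩ := hb'
        rw [C.η_eq_iff, C.η_eq_iff] at hb''
        rcases hb'' with rfl | rfl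
        · rcases hb.η_ζ_cases with he | he <;> rw [he] <;> assumption
        · rcases hb.η_ζ_ζ_cases with he | he <;> rw [he] <;> assumption
      exact Finset.disjoint_left.1 (hKap.disjoint_orb ht) (Finset.mem_union_right _ hb'.1) hb't
    · obtain ⟨hg, hg'⟩ := hr.extend_two hw hKap ht htt hηt hη1 hη2
      refine ⟨_, hKap.union inv_orb, ⟨t, by simp [mem_orb]⟩, hg'.mono (by linarith)⟩

/-- The possibilities for a triangle with a single edge to a sparse set `K`. -/
theorem Sparse.gain_triangle [Fintype S] (hs : C.Sparse K) (hw : ∀ t, (C.fiberSize : ℚ) ≤ w t)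
    (hN : 2 ≤ C.fiberSize) (hN3 : ¬ 3 ∣ C.fiberSize) (h : C.Inv K) (ha : a ∉ K) (haK : C.η a ∈ K)
    (hr : C.Reach w K d) :
    C.BigGain w d ∨
    (C.η (C.ζ a) = C.ζ a ∧ C.η (C.ζ (C.ζ a)) = C.ζ (C.ζ a) ∧
      C.SmallGain w d (C.bd K)) ∨
    (C.ζ (C.η (C.ζ a)) ≠ C.η (C.ζ a) ∧ C.ζ (C.η (C.ζ (C.ζ a))) ≠ C.η (C.ζ (C.ζ a)) ∧
      C.bd (K ∪ C.orb a) = C.bd K + 1 ∧ C.Reach w (K ∪ C.orb a) d) := by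
  obtain ⟨hta, k1, k2⟩ := hs a ha haK
  have hKa := h.union (inv_orb (a := a) (C := C))
  have hne : (K ∪ C.orb a).Nonempty := ⟨a, by simp [mem_orb]⟩
  have n0 := η_ne_of_mem ha haK
  have hNQ : (2 : ℚ) ≤ C.fiberSize := by exact_mod_cast hN
  have w0 := hw a
  have w1 := hw (C.ζ a)
  have w2 := hw (C.ζ (C.ζ a))
  have hval := val_union_orb (w := w) h ha hta
  have hbda := bd_union_orb h ha hta
  simp only [n0, haK, k1, k2, if_true, if_false] at hval hbda
  by_cases hsemi : C.η (C.ζ a) = C.ζ a ∨ C.η (C.ζ (C.ζ a)) = C.ζ (C.ζ a)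
  · have hN5 : (5 : ℚ) ≤ C.fiberSize := by
      rcases hsemi with he | he <;> exact_mod_cast five_le_of_semi hN hN3 he
    by_cases hboth : C.η (C.ζ a) = C.ζ a ∧ C.η (C.ζ (C.ζ a)) = C.ζ (C.ζ a)
    · right; left
      simp only [hboth, if_true] at hval hbda
      refine ⟨hboth.1, hboth.2, _, hKa, hs.union hKa fun t ht hη => ?_, ?_, hne,
        hr.extend (extends_semi h haK hsemi) ?_⟩
      · rw [mem_orb, C.η_eq_iff, C.η_eq_iff, C.η_eq_iff, hboth.1, hboth.2] at hη
        rw [Finset.mem_union, mem_orb] at ht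
        rcases hη with rfl | rfl | rfl <;> tauto
      · have : (C.bd K : ℚ) ≤ ((C.bd (K ∪ C.orb a) + 1 : ℕ) : ℚ) := by push_cast; linarith
        exact_mod_cast this
      · push_cast; linarith
    · left
      refine ⟨_, hKa, hne, hr.extend (extends_semi h haK hsemi) ?_⟩
      rw [hval]
      split_ifs <;> first | (push_cast; linarith) | tauto
  rw [not_or] at hsemi
  simp only [hsemi, if_false] at hval hbda
  by_cases hleaf : C.ζ (C.η (C.ζ a)) = C.η (C.ζ a) ∨
      C.ζ (C.η (C.ζ (C.ζ a))) = C.η (C.ζ (C.ζ a))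
  · left
    refine ⟨_, hKa, hne, hr.extend (extends_triangle_leaf h haK hleaf) ?_⟩
    rw [hval]
    by_cases hN2 : C.fiberSize = 2
    · rw [leafCost, if_pos hN2]
      rw [hN2] at w0 w1 w2 ⊢
      push_cast at w0 w1 w2 ⊢
      linarith
    · have hN4 : (4 : ℚ) ≤ C.fiberSize := by
        have : 4 ≤ C.fiberSize := by omega
        exact_mod_cast this
      simp only [leafCost, hN2, if_false]
      push_cast; linarith
  rw [not_or] at hleaf
  refine Or.inr (Or.inr ⟨hleaf.1, hleaf.2, ?_, hr.extend (extends_one h haK) (by linarith)⟩)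
  have : (C.bd (K ∪ C.orb a) : ℚ) = ((C.bd K + 1 : ℕ) : ℚ) := by push_cast; linarith
  exact_mod_cast this

/-- The possibilities for a second triangle, with two edges to `K ∪ orb a`, if the triangle of `a`
is neither next to itself nor to a leaf. -/
theorem Sparse.gain_second [Fintype S] (hs : C.Sparse K) (hw : ∀ t, (C.fiberSize : ℚ) ≤ w t)
    (hN : 2 ≤ C.fiberSize) (h : C.Inv K) (ha : a ∉ K) (haK : C.η a ∈ K)
    (hl1 : C.ζ (C.η (C.ζ a)) ≠ C.η (C.ζ a))
    (hl2 : C.ζ (C.η (C.ζ (C.ζ a))) ≠ C.η (C.ζ (C.ζ a))) (hr : C.Reach w K d)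
    (hra : C.Reach w (K ∪ C.orb a) d) (hsa : ¬ C.Sparse (K ∪ C.orb a)) :
    C.BigGain w d ∨ (∃ b, C.Bigon K a b) ∨
    ∃ p, p ∉ K ∪ C.orb a ∧ C.ζ p ≠ p ∧ C.η p ∈ K ∪ C.orb a ∧ C.η (C.ζ p) ∈ K ∪ C.orb a ∧
      C.η (C.ζ (C.ζ p)) = C.ζ (C.ζ p) ∧
      C.Reach w (K ∪ C.orb a ∪ C.orb p) (d - C.fiberSize) := by
  have hKa := h.union (inv_orb (a := a) (C := C))
  obtain ⟨p, hp, hηp, hcase⟩ := hKa.exists_of_not_sparse hsa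
  have hpK : p ∉ K := fun hc => hp (Finset.mem_union_left _ hc)
  rcases hcase with hl | ⟨htp, hηp1⟩
  · exfalso
    rcases Finset.mem_union.1 hηp with hc | hc
    · exact (hs p hpK hc).1 hl
    · rcases η_eq_of_mem_orb haK hc hpK with hc | hc <;> rw [C.η_eq_iff] at hc <;> subst hc
      · exact hl1 hl
      · exact hl2 hl
  by_cases hηp2 : C.η (C.ζ (C.ζ p)) ∈ K ∪ C.orb a
  · obtain ⟨b, -, hb⟩ := hs.exists_doubleEdge h ha haK hp htp hηp hηp1 hηp2
    rcases bigGain_or_bigon_of_double hw hN h hr hb with hc | hc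
    · exact Or.inl hc
    · exact Or.inr (Or.inl ⟨b, hc⟩)
  · obtain ⟨g1, g2⟩ := hra.extend_two hw hKa hp htp hηp hηp1 hηp2
    by_cases he : C.η (C.ζ (C.ζ p)) = C.ζ (C.ζ p)
    · exact Or.inr (Or.inr ⟨p, hp, htp, hηp, hηp1, he, g2⟩)
    · exact Or.inl ⟨_, hKa.union inv_orb, ⟨p, by simp [mem_orb]⟩, g1 he⟩

/-- Growing a sparse set triangle by triangle finally gains something: otherwise the triangles
would form an infinite tree. -/
theorem Sparse.exists_gain [Fintype S] [Fintype T] (hw : ∀ t, (C.fiberSize : ℚ) ≤ w t)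
    (hw2 : ∀ t, (∀ q, C.proj q = t → C.σ₁ (C.σ₁ q) = q) →
      4 / 3 * (C.fiberSize : ℚ) ≤ w t ∧ 4 / 3 * (C.fiberSize : ℚ) ≤ w (C.η t))
    (hN : 2 ≤ C.fiberSize) (hN3 : ¬ 3 ∣ C.fiberSize) (h : C.Inv K) (hs : C.Sparse K)
    (hbd : 1 ≤ C.bd K) (hr : C.Reach w K d) :
    C.BigGain w d ∨ C.SmallGain w d (C.bd K) ∨ ∃ a b, C.Bigon K a b := by
  induction hn : Kᶜ.card using Nat.strong_induction_on generalizing K with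
  | _ n ih =>
  obtain ⟨a, ha, haK⟩ := exists_of_bd_pos hbd
  have hKa := h.union (inv_orb (a := a) (C := C))
  rcases hs.gain_triangle hw hN hN3 h ha haK hr with hc | ⟨-, -, hc⟩ | ⟨hl1, hl2, hbd1, hra⟩
  · exact Or.inl hc
  · exact Or.inr (Or.inl hc)
  by_cases hsa : C.Sparse (K ∪ C.orb a)
  · have hlt : (K ∪ C.orb a)ᶜ.card < n := by
      rw [← hn]
      refine Finset.card_lt_card (Finset.compl_ssubset_compl.2 ?_)
      refine Finset.ssubset_iff_subset_ne.2 ⟨Finset.subset_union_left, fun he => ha ?_⟩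
      rw [he]
      simp [mem_orb]
    rcases ih _ hlt hKa hsa (by omega) hra rfl with hc | hc | ⟨a', b', hc⟩
    · exact Or.inl hc
    · obtain ⟨K', e1, e2, e3, e4⟩ := hc
      exact Or.inr (Or.inl ⟨K', e1, e2, by omega, e4⟩)
    · obtain ⟨K', e1, e2, e3, e4⟩ := hc.gain hw hw2 hKa hsa hra
      exact Or.inr (Or.inl ⟨K', e1, e2, by omega, e4⟩)
  rcases hs.gain_second hw hN h ha haK hl1 hl2 hr hra hsa with
    hc | ⟨b, hc⟩ | ⟨p, hp, htp, hηp, hηp1, he, g2⟩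
  · exact Or.inl hc
  · exact Or.inr (Or.inr ⟨a, b, hc⟩)
  · rcases gain_of_semi hw h hs ha haK hl1 hl2 hp hηp hηp1 he g2 with hc | hc
    · exact Or.inl hc
    · refine Or.inr (Or.inl ⟨_, hKa.union inv_orb, hc, ?_, ⟨p, by simp [mem_orb]⟩, g2⟩)
      have hbdp := bd_union_orb hKa hp htp
      simp only [η_ne_of_mem hp hηp, η_ne_of_mem (hKa.ζ_notMem hp) hηp1, he, hηp, hηp1,
        hKa.ζ_notMem (hKa.ζ_notMem hp), if_true, if_false, hbd1] at hbdp
      have : (C.bd K : ℚ) ≤ ((C.bd (K ∪ C.orb a ∪ C.orb p) + 1 : ℕ) : ℚ) := by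
        push_cast at hbdp ⊢; linarith
      exact_mod_cast this

end ExistsGain

end ModularCover

/-! ### The bound up to spaces of seven vertices -/

namespace ModularCover

section Ten

variable {S T : Type*} {C : ModularCover S T} [DecidableEq T] {K : Finset T} {v a b : T}
  {w : T → ℚ} {d : ℚ}

theorem Bigon.symm (hg : C.Bigon K a b) : C.Bigon K b a := by
  obtain ⟨⟨ha, hb, hab, haK, hbK, hta, htb, -, -⟩, h1, h2, hhol⟩ := hg
  have e1 : C.η (C.ζ b) = C.ζ (C.ζ a) := by rw [← h2, C.η_sq]
  have e2 : C.η (C.ζ (C.ζ b)) = C.ζ a := by rw [← h1, C.η_sq]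
  refine ⟨⟨hb, ha, fun hc => hab ?_, hbK, haK, htb, hta, Or.inr e1, Or.inl e2⟩, e1, e2,
    fun q hq => ?_⟩
  · rw [mem_orb] at hc ⊢
    rcases hc with hc | hc | hc
    · exact Or.inl hc.symm
    · right; right; rw [hc, C.ζ_cube]
    · right; left; rw [hc, C.ζ_cube]
  · have hp : C.proj (C.σ₁ q) = C.ζ a := by rw [C.proj_σ₁, hq, e1, C.ζ_cube]
    exact C.σ₁.injective (hhol _ hp)

theorem orb_leaf (hv : C.ζ v = v) : C.orb v = {v} := by simp [orb, hv]

theorem bd_leaf (hv : C.ζ v = v) : C.bd (C.orb v) = 1 := by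
  have hne : C.η v ≠ v := by have := C.ne_rotate v; rwa [hv] at this
  simp [orb_leaf hv, bd, Finset.filter_singleton, hne]

theorem η_leaf_notMem (hv : C.ζ v = v) : C.η v ∉ C.orb v := by
  have hne : C.η v ≠ v := by have := C.ne_rotate v; rwa [hv] at this
  simpa [orb_leaf hv] using hne

variable [Fintype S]

/-- The space of ten vertices made of a leaf, its triangle `ζⁱ η v`, and two triangles `a`, `b` that
bound a bigon. If `v` and `ζ a` are full then membership over `ζ η v` is invariant under the
holonomy `σ₁³` of the face formed by the three triangles: either it is non-trivial and saves points,
or the face increases the weight. -/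
theorem Bigon.exists_cost [Fintype T] (hv : C.ζ v = v) (hd : C.ζ (C.η v) ≠ C.η v)
    (hg : C.Bigon (C.orb v ∪ C.orb (C.η v)) a b) (hda : C.η (C.ζ (C.η v)) = a)
    (hdb : C.η (C.ζ (C.ζ (C.η v))) = b)
    (hw : ∀ t, (C.fiberSize : ℚ) ≤ w t)
    (hw2 : ∀ t, (∀ q, C.proj q = t → C.σ₁ (C.σ₁ q) = q) →
      4 / 3 * (C.fiberSize : ℚ) ≤ w t ∧ 4 / 3 * (C.fiberSize : ℚ) ≤ w (C.η t))
    (hw3 : ∀ t, (∀ q, C.proj q = t → (C.σ₁ ^ 3) q = q) →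
      7 / 6 * (C.fiberSize : ℚ) ≤ w t ∧ 7 / 6 * (C.fiberSize : ℚ) ≤ w (C.η t)) :
    ∃ c : ℕ, C.Cost Finset.univ c ∧ 4 * (c : ℚ) ≤ ∑ t, w t := by
  classical
  have hinv : C.Inv (C.orb v ∪ C.orb (C.η v)) := inv_orb.union inv_orb
  have hbdK := bd_union_orb inv_orb (η_leaf_notMem hv) hd
  have hηa : C.η a = C.ζ (C.η v) := by rw [← hda, C.η_sq]
  have hηb : C.η b = C.ζ (C.ζ (C.η v)) := by rw [← hdb, C.η_sq]
  have hanot := hg.a_notMem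
  have hbnot := hg.b_notMem
  have huniv : C.orb v ∪ C.orb (C.η v) ∪ C.orb a ∪ C.orb b = Finset.univ := by
    refine eq_univ_of_bd ((hinv.union inv_orb).union inv_orb) ⟨v, by simp [mem_orb]⟩ ?_
    have hbd2 := hg.bd hinv
    have m1 : C.ζ (C.η v) ∈ C.orb v ∪ C.orb (C.η v) := by simp [mem_orb]
    have m2 : C.ζ (C.ζ (C.η v)) ∈ C.orb v ∪ C.orb (C.η v) := by simp [mem_orb]
    have n0 : C.η (C.η v) ≠ C.η v := by
      rw [C.η_sq]; intro he; exact η_leaf_notMem hv (by rw [← he]; simp [mem_orb])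
    have n1 : a ≠ C.ζ (C.η v) := fun he => hanot (he ▸ m1)
    have n2 : b ≠ C.ζ (C.ζ (C.η v)) := fun he => hbnot (he ▸ m2)
    have k0 : C.η (C.η v) ∈ C.orb v := by rw [C.η_sq]; simp [mem_orb]
    have k1 : a ∉ C.orb v := fun hc => hanot (Finset.mem_union_left _ hc)
    have k2 : b ∉ C.orb v := fun hc => hbnot (Finset.mem_union_left _ hc)
    rw [hda, hdb, bd_leaf hv] at hbdK
    simp only [n0, n1, n2, k0, k1, k2, if_true, if_false] at hbdK
    have : (C.bd (C.orb v ∪ C.orb (C.η v) ∪ C.orb a ∪ C.orb b) : ℚ) = 0 := by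
      rw [hbd2, hbdK]; norm_num
    exact_mod_cast this
  have hsum : ∑ t, w t = w v + (w (C.η v) + w (C.ζ (C.η v)) + w (C.ζ (C.ζ (C.η v)))) +
      (w a + w (C.ζ a) + w (C.ζ (C.ζ a))) + (w b + w (C.ζ b) + w (C.ζ (C.ζ b))) := by
    have hb' : b ∉ C.orb v ∪ C.orb (C.η v) ∪ C.orb a := by
      rw [Finset.mem_union]; exact not_or.2 ⟨hbnot, hg.b_notMem_orb⟩
    rw [← huniv, Finset.sum_union ((hinv.union inv_orb).disjoint_orb hb'),
      Finset.sum_union (hinv.disjoint_orb hanot),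
      Finset.sum_union (inv_orb.disjoint_orb (η_leaf_notMem hv)), sum_orb hg.ζb_ne,
      sum_orb hg.ζa_ne, sum_orb hd, orb_leaf hv, Finset.sum_singleton]
  -- Three full vertices suffice.
  have hd0 : ∀ {Q}, C.Closed Q → C.Full Q v → C.Full Q (C.η v) := fun hQ h0 =>
    hQ.full_η (by rwa [hv]) (by rwa [hv, hv])
  have hu : ∀ {Q}, C.Closed Q → C.Full Q v → ∀ u, C.proj u = b → (u ∈ Q ↔ C.y u ∈ Q) := by
    intro Q hQ h0 u hu
    have := hQ.link_Δ (hd0 hQ h0) (by rwa [C.η_sq]) (q := C.y.symm u)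
      (by rw [C.proj_symm_y, hu, hηb])
    rwa [← C.y_y, C.y.apply_symm_apply] at this
  have hall : ∀ Q, C.Closed Q → C.Full Q v → C.Full Q (C.ζ a) → C.Full Q (C.ζ (C.η v)) →
      ∀ t ∈ (Finset.univ : Finset T), C.Full Q t := by
    intro Q hQ h0 h1 h2 t _
    have f0 := hd0 hQ h0
    have f0' : C.Full Q (C.η (C.η v)) := by rwa [C.η_sq]
    have fd := hQ.full_orb f0 f0' h2
    have fa : C.Full Q a := by
      intro q hq
      have hp : C.proj (C.y.symm q) = C.ζ (C.η v) := by rw [C.proj_symm_y, hq, hηa]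
      have := (hQ.link_y f0 f0' hp).1 (h2 _ hp)
      simpa using this
    have fa' := hQ.full_orb fa (by rwa [hηa]) h1
    have fd2 : C.Full Q (C.ζ (C.ζ (C.η v))) := fd _ (by simp [mem_orb])
    have fb : C.Full Q b := fun u hu' => (hu hQ h0 u hu').2 (fd2 _ (by rw [C.proj_y, hu', hηb]))
    have fb' := hQ.full_orb fb (by rwa [hηb]) (fun q hq => (hQ.link_y fb (by rwa [hηb]) hq).2
      (fa' (C.ζ (C.ζ a)) (by simp [mem_orb]) _ (by rw [C.proj_y, hq, ← hg.η_ζ_ζ, C.η_sq])))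
    have ht : t ∈ C.orb v ∪ C.orb (C.η v) ∪ C.orb a ∪ C.orb b := by rw [huniv]; simp
    simp only [Finset.mem_union] at ht
    rcases ht with ((ht | ht) | ht) | ht
    · rw [orb_leaf hv, Finset.mem_singleton] at ht
      rwa [ht]
    · exact fd t ht
    · exact fa' t ht
    · exact fb' t ht
  have hproj : ∀ q, C.proj q = C.ζ (C.η v) → C.proj ((C.σ₁ ^ 3) q) = C.ζ (C.η v) := by
    intro q hq
    change C.proj (C.σ₁ (C.σ₁ (C.σ₁ q))) = _
    rw [C.proj_σ₁, C.proj_σ₁, C.proj_σ₁, hq, hda, hg.η_ζ_ζ, C.ζ_cube, hηb, C.ζ_cube]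
  have hcost : ∀ P : Finset S, (∀ Q : Set S,
      (∀ q, C.proj q = C.ζ (C.η v) → (q ∈ Q ↔ (C.σ₁ ^ 3) q ∈ Q)) → (P : Set S) ⊆ Q →
        C.Full Q (C.ζ (C.η v))) → C.Cost Finset.univ (2 * C.fiberSize + P.card) := by
    intro P hP
    refine ⟨C.fiber v ∪ C.fiber (C.ζ a) ∪ P, ?_, fun Q hQ hsub => ?_⟩
    · refine (Finset.card_union_le _ _).trans (Nat.add_le_add_right ?_ _)
      refine (Finset.card_union_le _ _).trans ?_
      rw [C.card_fiber, C.card_fiber]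
      omega
    · rw [Finset.coe_union, Finset.coe_union, Set.union_subset_iff, Set.union_subset_iff] at hsub
      obtain ⟨⟨hs1, hs2⟩, hs3⟩ := hsub
      have h0 : C.Full Q v := fun s hs => hs1 (Finset.mem_coe.2 (C.mem_fiber.2 hs))
      have h1 : C.Full Q (C.ζ a) := fun s hs => hs2 (Finset.mem_coe.2 (C.mem_fiber.2 hs))
      refine hall Q hQ h0 h1 (hP Q (fun q hq => ?_) hs3)
      have f0 := hd0 hQ h0
      have f0' : C.Full Q (C.η (C.η v)) := by rwa [C.η_sq]
      -- The path of `q` around the face.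
      have p1 : C.proj (C.y q) = a := by rw [C.proj_y, hq, hda]
      have p2 : C.proj (C.z.symm (C.y q)) = C.ζ (C.ζ a) := by rw [C.proj_symm_z, p1]
      have p3 : C.proj (C.σ₁ (C.σ₁ q)) = b := by
        rw [C.proj_σ₁, C.proj_σ₁, hq, hda, hg.η_ζ_ζ, C.ζ_cube]
      have e1 := hQ.link_y f0 f0' hq
      have e2 := hQ.iff_of_z_z (q := C.z.symm (C.y q))
        (h1 _ (by rw [C.proj_z, C.proj_z, p2, C.ζ_cube]))
      have e3 := hQ.iff_of_y (q := C.z.symm (C.σ₁ (C.σ₁ q)))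
        (h1 _ (by rw [C.proj_y, C.proj_symm_z, p3, ← hg.η_ζ, C.η_sq]))
      have e4 := hu hQ h0 _ p3
      have e5 := hQ.link_z f0' (hproj q hq)
      have r1 : C.z (C.σ₁ (C.σ₁ q)) = C.y (C.z.symm (C.y q)) := C.z.apply_symm_apply _
      have r2 : C.z ((C.σ₁ ^ 3) q) = C.y (C.σ₁ (C.σ₁ q)) := C.z.apply_symm_apply _
      rw [C.z.apply_symm_apply] at e2 e3
      rw [r1] at e3
      rw [r2] at e5
      rw [e1, ← e2, ← e3, e4, ← e5]
  by_cases hhol : ∀ q, C.proj q = C.ζ (C.η v) → (C.σ₁ ^ 3) q = q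
  · refine ⟨_, hcost (C.fiber (C.ζ (C.η v))) fun Q _ hsub s hs =>
      hsub (Finset.mem_coe.2 (C.mem_fiber.2 hs)), ?_⟩
    obtain ⟨b1, b2, b3, b4⟩ := bigon_weights hw2 hg.η_ζ hg.η_ζ_ζ hg.holonomy
    have c1 := hw3 _ hhol
    have c2 := hw3 b (fun q hq => by
      have hp : C.proj (C.σ₁ q) = C.ζ (C.η v) := by rw [C.proj_σ₁, hq, hηb, C.ζ_cube]
      exact C.σ₁.injective (hhol _ hp))
    rw [hda] at c1
    rw [hηb] at c2
    rw [C.card_fiber, hsum]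
    push_cast
    linarith [hw v, hw (C.η v), c1.1, c1.2, c2.1, c2.2]
  · obtain ⟨P, hP, hPQ⟩ := exists_half_of_holonomy 3 hproj hhol
    refine ⟨_, hcost P hPQ, ?_⟩
    have hPQ' : 2 * (P.card : ℚ) ≤ C.fiberSize := by exact_mod_cast hP
    rw [hsum]
    push_cast
    linarith [hw v, hw (C.η v), hw (C.ζ (C.η v)), hw (C.ζ (C.ζ (C.η v))), hw a, hw (C.ζ a),
      hw (C.ζ (C.ζ a)), hw b, hw (C.ζ b), hw (C.ζ (C.ζ b))]

/-- A space with a leaf `v` next to a triangle without two `η`-fixed vertices satisfies the bound,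
unless it consists of this triangle, the leaf, and one further triangle with an `η`-fixed vertex. -/
theorem exists_cost_or_seven [Fintype T] (hv : C.ζ v = v) (hd : C.ζ (C.η v) ≠ C.η v)
    (hfour : ¬ (C.η (C.ζ (C.η v)) = C.ζ (C.η v) ∧
      C.η (C.ζ (C.ζ (C.η v))) = C.ζ (C.ζ (C.η v))))
    (hN : 2 ≤ C.fiberSize) (hN3 : ¬ 3 ∣ C.fiberSize)
    (hw : ∀ t, (C.fiberSize : ℚ) ≤ w t)
    (hw2 : ∀ t, (∀ q, C.proj q = t → C.σ₁ (C.σ₁ q) = q) →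
      4 / 3 * (C.fiberSize : ℚ) ≤ w t ∧ 4 / 3 * (C.fiberSize : ℚ) ≤ w (C.η t))
    (hw3 : ∀ t, (∀ q, C.proj q = t → (C.σ₁ ^ 3) q = q) →
      7 / 6 * (C.fiberSize : ℚ) ≤ w t ∧ 7 / 6 * (C.fiberSize : ℚ) ≤ w (C.η t)) :
    (∃ c : ℕ, C.Cost Finset.univ c ∧ 4 * (c : ℚ) ≤ ∑ t, w t) ∨
    ∃ p, p ∉ C.orb v ∪ C.orb (C.η v) ∧ C.ζ p ≠ p ∧ C.η p ∈ C.orb v ∪ C.orb (C.η v) ∧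
      C.η (C.ζ p) ∈ C.orb v ∪ C.orb (C.η v) ∧ C.η (C.ζ (C.ζ p)) = C.ζ (C.ζ p) := by
  have hv0 : C.η v ∉ C.orb v := η_leaf_notMem hv
  have hvK : C.η (C.η v) ∈ C.orb v := by rw [C.η_sq]; simp [mem_orb]
  have hfin : ∀ {d : ℚ}, d ≤ 2 * C.fiberSize → C.BigGain w d →
      ∃ c : ℕ, C.Cost Finset.univ c ∧ 4 * (c : ℚ) ≤ ∑ t, w t := by
    rintro d hd' ⟨K, h1, h2, h3⟩
    exact (h3.mono (by linarith)).cost_univ hw hN h1 h2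
  have hr : C.Reach w (C.orb v) (2 * C.fiberSize) := by
    refine ⟨C.fiberSize, ⟨C.fiber v, (C.card_fiber v).le, fun Q _ hsub t ht s hs => ?_⟩, ?_⟩
    · rw [orb_leaf hv, Finset.mem_singleton] at ht
      exact hsub (Finset.mem_coe.2 (C.mem_fiber.2 (hs.trans ht)))
    · rw [val, bd_leaf hv, orb_leaf hv, Finset.sum_singleton]
      push_cast
      linarith [hw v]
  have hs : C.Sparse (C.orb v) := by
    intro t ht hηt
    rw [orb_leaf hv, Finset.mem_singleton, C.η_eq_iff] at hηt
    subst hηt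
    refine ⟨hd, ?_, ?_⟩ <;>
      rw [orb_leaf hv, Finset.mem_singleton, C.η_eq_iff]
    · exact hd
    · exact ζ_ζ_ne hd
  rcases hs.gain_triangle hw hN hN3 inv_orb hv0 hvK hr with
    hc | ⟨h1, h2, -⟩ | ⟨hl1, hl2, hbd1, hra⟩
  · exact Or.inl (hfin le_rfl hc)
  · exact absurd ⟨h1, h2⟩ hfour
  have hinv : C.Inv (C.orb v ∪ C.orb (C.η v)) := inv_orb.union inv_orb
  rw [bd_leaf hv] at hbd1
  by_cases hsa : C.Sparse (C.orb v ∪ C.orb (C.η v))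
  · left
    rcases hsa.exists_gain hw hw2 hN hN3 hinv (by omega) hra with hc | ⟨K, e1, e2, e3, e4, e5⟩ |
      ⟨a, b, hg⟩
    · exact hfin le_rfl hc
    · rcases e2.exists_gain hw hw2 hN hN3 e1 (by omega) e5 with hc | ⟨K', f1, -, -, f4, f5⟩ |
        ⟨a, b, hg⟩
      · refine hfin ?_ hc
        have : (0 : ℚ) ≤ C.fiberSize := by positivity
        linarith
      · exact (f5.mono (by linarith)).cost_univ hw hN f1 f4
      · obtain ⟨K', f1, -, -, f4, f5⟩ := hg.gain hw hw2 e1 e2 e5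
        exact (f5.mono (by linarith)).cost_univ hw hN f1 f4
    · have hmem : ∀ t, t ∉ C.orb v ∪ C.orb (C.η v) → C.η t ∈ C.orb v ∪ C.orb (C.η v) →
          t = C.η (C.ζ (C.η v)) ∨ t = C.η (C.ζ (C.ζ (C.η v))) := by
        intro t ht hη
        simp only [Finset.mem_union, orb_leaf hv, Finset.mem_singleton, mem_orb, C.η_eq_iff,
          C.η_sq, not_or] at ht hη
        tauto
      have hne : a ≠ b := fun he => hg.b_notMem_orb (by rw [← he]; simp [mem_orb])
      rcases hmem a hg.a_notMem hg.ηa_mem with ha | ha <;>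
        rcases hmem b hg.b_notMem hg.ηb_mem with hb | hb
      · exact absurd (ha.trans hb.symm) hne
      · exact hg.exists_cost hv hd ha.symm hb.symm hw hw2 hw3
      · exact hg.symm.exists_cost hv hd hb.symm ha.symm hw hw2 hw3
      · exact absurd (ha.trans hb.symm) hne
  · rcases hs.gain_second hw hN inv_orb hv0 hvK hl1 hl2 hr hra hsa with
      hc | ⟨b, hg⟩ | ⟨p, hp, htp, hηp, hηp1, he, -⟩
    · exact Or.inl (hfin le_rfl hc)
    · exfalso
      have := hg.ηb_mem
      rw [orb_leaf hv, Finset.mem_singleton, C.η_eq_iff] at this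
      exact hg.b_notMem_orb (by rw [this]; simp [mem_orb])
    · exact Or.inr ⟨p, hp, htp, hηp, hηp1, he⟩

end Ten

end ModularCover

/-! ### Simply intersecting cycles and coordinates near a leaf -/

namespace ModularCover

section Shift

variable {S T : Type*} {C : ModularCover S T} {v t : T} {j : ℤ}

/-- Simply intersecting cycles: a common point of the `σ₁`-cycle and the `σ₂`-cycle of `p` is
`p`. -/
def SimplyIntersecting (C : ModularCover S T) : Prop :=
  ∀ (p : S) (m n : ℤ), (C.σ₁ ^ m) p = (C.σ₂ ^ n) p → (C.σ₁ ^ m) p = p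

theorem SimplyIntersecting.pow (hSI : C.SimplyIntersecting) (p : S) (m n : ℕ)
    (h : (C.σ₁ ^ m) p = (C.σ₂ ^ n) p) : (C.σ₁ ^ m) p = p := by
  have := hSI p m n
  rw [zpow_natCast, zpow_natCast] at this
  exact this h

theorem σ₁_eq {p q : S} (h : C.y p = C.z q) : C.σ₁ p = q := by
  change C.z.symm (C.y p) = q
  rw [h, C.z.symm_apply_apply]

theorem σ₂_eq {p q : S} (h : p = C.z q) : C.σ₂ p = C.y q := by
  change C.y (C.z.symm p) = _
  rw [h, C.z.symm_apply_apply]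

/-- Over a leaf, `z` is the power of `Δ` inverse to three. -/
theorem exists_leaf_power (C : ModularCover S T) : (∃ v, C.ζ v = v) → ∃ r : ℤ,
    (C.fiberSize : ℤ) ∣ 3 * r - 1 ∧ ∀ v, C.ζ v = v → ∀ p, C.proj p = v → C.z p = (C.Δ ^ r) p := by
  have key : ∀ v, C.ζ v = v → ∀ p, C.proj p = v → ∃ r : ℤ, C.z p = (C.Δ ^ r) p ∧
      (C.fiberSize : ℤ) ∣ 3 * r - 1 := by
    intro v hv p hp
    obtain ⟨r, hr⟩ := C.exists_zpow' (s := C.z p) (s' := p) (by rw [C.proj_z, hp, hv])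
    refine ⟨r, hr, ?_⟩
    rw [← C.zpow_eq_zpow_iff (3 * r) 1 p, zpow_one, ← C.z_z_z, hr, ← C.zpow_z, hr, ← C.zpow_z,
      ← C.zpow_z, hr, C.zpow_zpow, C.zpow_zpow]
    ring_nf
  rintro ⟨v, hv⟩
  obtain ⟨p, hp⟩ := C.proj_surj v
  obtain ⟨r, -, hrN⟩ := key v hv p hp
  refine ⟨r, hrN, fun v' hv' p' hp' => ?_⟩
  obtain ⟨r', hr', hrN'⟩ := key v' hv' p' hp'
  rw [hr', C.zpow_eq_zpow_iff]
  have h3 : (C.fiberSize : ℤ) ∣ 3 * (r' - r) := by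
    have := dvd_sub hrN' hrN
    ring_nf at this ⊢
    exact this
  -- Multiply by the inverse `r` of three.
  have h4 := dvd_sub (h3.mul_left r) (hrN.mul_right (r' - r))
  ring_nf at h4 ⊢
  exact h4

theorem fiberSize_ne_zero (hv : C.ζ v = v) : C.fiberSize ≠ 0 ∧ ¬ 3 ∣ C.fiberSize := by
  obtain ⟨r, hr, -⟩ := C.exists_leaf_power ⟨v, hv⟩
  constructor
  · intro h0
    rw [h0] at hr
    have := zero_dvd_iff.1 hr
    omega
  · rintro ⟨k, hk⟩
    obtain ⟨l, hl⟩ := hr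
    rw [hk] at hl
    push_cast at hl
    have : 3 * (r - k * l) = 1 := by linarith
    omega

theorem finite_of_leaf [Finite T] (hv : C.ζ v = v) : Finite S := by
  have hN : 0 < C.fiberSize := Nat.pos_of_ne_zero (fiberSize_ne_zero hv).1
  choose f hf using C.proj_surj
  refine Finite.of_surjective
    (fun q : T × Fin C.fiberSize => (C.Δ ^ ((q.2 : ℕ) : ℤ)) (f q.1)) fun s => ?_
  obtain ⟨m, hm⟩ := C.exists_zpow' (s := s) (s' := f (C.proj s)) (hf _).symm
  have h1 := Int.emod_nonneg m (show (C.fiberSize : ℤ) ≠ 0 by omega)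
  have h2 := Int.emod_lt_of_pos m (show (0 : ℤ) < C.fiberSize by omega)
  refine ⟨(C.proj s, ⟨(m % C.fiberSize).toNat, by omega⟩), ?_⟩
  conv_rhs => rw [hm]
  rw [C.zpow_eq_zpow_iff]
  simp only [Int.toNat_of_nonneg h1]
  exact ⟨-(m / C.fiberSize), by have := Int.mul_ediv_add_emod m C.fiberSize; linarith⟩

theorem η_ne_leaf (hv : C.ζ v = v) : C.η v ≠ v := by
  have := C.ne_rotate v
  rwa [hv] at this

theorem SimplyIntersecting.two_le (hSI : C.SimplyIntersecting) (hv : C.ζ v = v) :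
    2 ≤ C.fiberSize := by
  obtain ⟨h0, -⟩ := fiberSize_ne_zero hv
  by_contra hlt
  have h1 : C.fiberSize = 1 := by omega
  have hfix : ∀ (m : ℤ) s, (C.Δ ^ m) s = s := fun m s => by
    rw [C.zpow_apply_eq_self_iff, h1]; exact ⟨m, by simp⟩
  obtain ⟨r, -, hr⟩ := C.exists_leaf_power ⟨v, hv⟩
  obtain ⟨p, hp⟩ := C.proj_surj v
  have hz : C.z p = p := by rw [hr v hv p hp, hfix]
  have hyy : C.y (C.y p) = p := by rw [C.y_y]; simpa using hfix 1 p
  have e1 : (C.σ₁ ^ (-1 : ℤ)) p = C.y p := by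
    rw [zpow_neg_one, Equiv.Perm.inv_eq_iff_eq, eq_comm]
    exact σ₁_eq (by rw [hyy, hz])
  have e2 : (C.σ₂ ^ (1 : ℤ)) p = C.y p := by
    rw [zpow_one]
    exact σ₂_eq hz.symm
  have h := hSI p (-1) 1 (e1.trans e2.symm)
  rw [e1] at h
  apply η_ne_leaf hv
  rw [← hp, ← C.proj_y, h]

/-- Two leaves are not joined: `σ₁` and `σ₂` would agree on the space made of them. -/
theorem SimplyIntersecting.ζ_η_ne (hSI : C.SimplyIntersecting) (hv : C.ζ v = v) :
    C.ζ (C.η v) ≠ C.η v := by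
  intro hl
  obtain ⟨r, -, hr⟩ := C.exists_leaf_power ⟨v, hv⟩
  obtain ⟨p, hp⟩ := C.proj_surj v
  have hz : ∀ p, (C.proj p = v ∨ C.proj p = C.η v) → p = C.z ((C.Δ ^ (-r)) p) := by
    intro p hp
    rw [← C.zpow_z]
    rcases hp with hp | hp
    · rw [hr v hv p hp, C.zpow_zpow, neg_add_cancel, zpow_zero]; rfl
    · rw [hr _ hl p hp, C.zpow_zpow, neg_add_cancel, zpow_zero]; rfl
  have e1 : C.σ₁ p = (C.Δ ^ (-r)) (C.y p) := σ₁_eq (hz _ (Or.inr (by rw [C.proj_y, hp])))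
  have e2 : C.σ₂ p = C.y ((C.Δ ^ (-r)) p) := σ₂_eq (hz _ (Or.inl hp))
  have h := hSI.pow p 1 1 (by rw [pow_one, pow_one, e1, e2, C.zpow_y])
  rw [pow_one, e1] at h
  apply η_ne_leaf hv
  rw [← hp, ← C.proj_y, ← C.proj_zpow (-r), h]

/-- The powers of the sixth root `Δ ^ j` of `Δ`, where `6 j = 1` modulo the fibre size. -/
def shift (C : ModularCover S T) (j k : ℤ) : Equiv.Perm S := C.Δ ^ (j * k)

theorem shift_shift (k l : ℤ) (s : S) : C.shift j k (C.shift j l s) = C.shift j (k + l) s := by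
  rw [shift, shift, C.zpow_zpow, shift, mul_add]

theorem z_shift (k : ℤ) (s : S) : C.z (C.shift j k s) = C.shift j k (C.z s) := (C.zpow_z _ _).symm

theorem y_shift (k : ℤ) (s : S) : C.y (C.shift j k s) = C.shift j k (C.y s) := (C.zpow_y _ _).symm

theorem proj_shift (k : ℤ) (s : S) : C.proj (C.shift j k s) = C.proj s := C.proj_zpow _ _

theorem shift_eq_iff (hj : (C.fiberSize : ℤ) ∣ 6 * j - 1) {k l : ℤ} {s : S} :
    C.shift j k s = C.shift j l s ↔ (C.fiberSize : ℤ) ∣ k - l := by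
  rw [shift, shift, C.zpow_eq_zpow_iff, ← mul_sub]
  constructor
  · intro h
    have := dvd_sub (h.mul_left 6) (hj.mul_right (k - l))
    ring_nf at this ⊢
    exact this
  · exact fun h => h.mul_left j

theorem Δ_eq_shift (hj : (C.fiberSize : ℤ) ∣ 6 * j - 1) (s : S) : C.Δ s = C.shift j 6 s := by
  rw [← zpow_one C.Δ, shift, C.zpow_eq_zpow_iff, ← dvd_neg]
  ring_nf at hj ⊢
  exact hj

theorem exists_shift (hj : (C.fiberSize : ℤ) ∣ 6 * j - 1) {s s' : S} (h : C.proj s = C.proj s') :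
    ∃ k, s = C.shift j k s' := by
  obtain ⟨m, rfl⟩ := C.exists_zpow' h
  refine ⟨6 * m, ?_⟩
  rw [shift, C.zpow_eq_zpow_iff, ← dvd_neg]
  have := hj.mul_right m
  ring_nf at this ⊢
  exact this

theorem z_leaf (hj : (C.fiberSize : ℤ) ∣ 6 * j - 1) (hv : C.ζ v = v) {p : S} (hp : C.proj p = v) :
    C.z p = C.shift j 2 p := by
  obtain ⟨k, hk⟩ := exists_shift hj (s := C.z p) (s' := p) (by rw [C.proj_z, hp, hv])
  have h := C.z_z_z p
  rw [Δ_eq_shift hj, hk, z_shift, hk, shift_shift, z_shift, hk, shift_shift, shift_eq_iff hj] at h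
  rw [hk, shift_eq_iff hj]
  have := dvd_sub (h.mul_left (2 * j)) (hj.mul_right (k - 2))
  ring_nf at this ⊢
  exact this

theorem y_semi (hj : (C.fiberSize : ℤ) ∣ 6 * j - 1) (ht : C.η t = t) {p : S} (hp : C.proj p = t) :
    C.y p = C.shift j 3 p := by
  obtain ⟨k, hk⟩ := exists_shift hj (s := C.y p) (s' := p) (by rw [C.proj_y, hp, ht])
  have h := C.y_y p
  rw [Δ_eq_shift hj, hk, y_shift, hk, shift_shift, shift_eq_iff hj] at h
  rw [hk, shift_eq_iff hj]
  have := dvd_sub (h.mul_left (3 * j)) (hj.mul_right (k - 3))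
  ring_nf at this ⊢
  exact this

theorem exists_sixth (h2 : Odd C.fiberSize) (h3 : ¬ 3 ∣ C.fiberSize) :
    ∃ j : ℤ, (C.fiberSize : ℤ) ∣ 6 * j - 1 := by
  have hcop : IsCoprime (6 : ℤ) (C.fiberSize : ℤ) := by
    have : Nat.Coprime 6 C.fiberSize := by
      rw [show 6 = 2 * 3 by norm_num]
      exact Nat.Coprime.mul_left (Nat.coprime_two_left.2 h2)
        ((Nat.Prime.coprime_iff_not_dvd Nat.prime_three).2 h3)
    exact_mod_cast Nat.isCoprime_iff_coprime.2 this
  obtain ⟨a, b, hab⟩ := hcop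
  exact ⟨a, -b, by linarith⟩

/-- Coordinates on the points over a triangle, in which `z` shifts by two. -/
theorem exists_coords (hj : (C.fiberSize : ℤ) ∣ 6 * j - 1) (s : S) (c : ℤ) :
    ∃ F₀ F₁ F₂ : ℤ → S, (∀ k, F₀ k = C.shift j (k - c) s) ∧
      (∀ k, C.z (F₀ k) = F₁ (k + 2)) ∧ (∀ k, C.z (F₁ k) = F₂ (k + 2)) ∧
      (∀ k, C.z (F₂ k) = F₀ (k + 2)) ∧ (∀ k, C.proj (F₀ k) = C.proj s) ∧
      (∀ k, C.proj (F₁ k) = C.ζ (C.proj s)) ∧ (∀ k, C.proj (F₂ k) = C.ζ (C.ζ (C.proj s))) ∧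
      (∀ k l, F₁ k = C.shift j (k - l) (F₁ l)) ∧ (∀ k l, F₂ k = C.shift j (k - l) (F₂ l)) := by
  refine ⟨fun k => C.shift j (k - c) s, fun k => C.shift j (k - c - 2) (C.z s),
    fun k => C.shift j (k - c - 4) (C.z (C.z s)), fun k => rfl, ?_, ?_, ?_, ?_, ?_, ?_, ?_, ?_⟩
  · intro k; rw [z_shift]; ring_nf
  · intro k; rw [z_shift]; ring_nf
  · intro k; rw [z_shift, C.z_z_z, Δ_eq_shift hj, shift_shift]; ring_nf
  · intro k; exact proj_shift _ _
  · intro k; rw [proj_shift, C.proj_z]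
  · intro k; rw [proj_shift, C.proj_z, C.proj_z]
  · intro k l; rw [shift_shift]; ring_nf
  · intro k l; rw [shift_shift]; ring_nf

/-- Coordinates on the points over a leaf and its triangle, in which moreover `y` shifts by
three along the edge between them. -/
theorem exists_leaf_coords (hj : (C.fiberSize : ℤ) ∣ 6 * j - 1) (hv : C.ζ v = v) :
    ∃ V D₀ D₁ D₂ : ℤ → S, (∀ k, C.proj (V k) = v) ∧ (∀ k l, V k = V l ↔ (C.fiberSize : ℤ) ∣ k - l) ∧
      (∀ s, C.proj s = v → ∃ k, s = V k) ∧
      (∀ k, C.z (V k) = V (k + 2)) ∧ (∀ k, C.y (V k) = D₀ (k + 3)) ∧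
      (∀ k, C.y (D₀ k) = V (k + 3)) ∧ (∀ k, C.z (D₀ k) = D₁ (k + 2)) ∧
      (∀ k, C.z (D₁ k) = D₂ (k + 2)) ∧ (∀ k, C.z (D₂ k) = D₀ (k + 2)) ∧
      (∀ k, C.proj (D₀ k) = C.η v) ∧ (∀ k, C.proj (D₁ k) = C.ζ (C.η v)) ∧
      (∀ k, C.proj (D₂ k) = C.ζ (C.ζ (C.η v))) ∧
      (∀ k l, D₁ k = C.shift j (k - l) (D₁ l)) ∧ (∀ k l, D₂ k = C.shift j (k - l) (D₂ l)) ∧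
      (∀ k l, (C.fiberSize : ℤ) ∣ k - l → D₀ k = D₀ l) := by
  obtain ⟨p, hp⟩ := C.proj_surj v
  obtain ⟨D₀, D₁, D₂, h0, h1, h2, h3, h4, h5, h6, h7, h8⟩ := exists_coords hj (C.y p) 3
  have hyp : C.proj (C.y p) = C.η v := by rw [C.proj_y, hp]
  rw [hyp] at h4 h5 h6
  refine ⟨fun k => C.shift j k p, D₀, D₁, D₂, fun k => by rw [proj_shift, hp],
    fun k l => shift_eq_iff hj, fun s hs => exists_shift hj (hs.trans hp.symm), ?_, ?_, ?_, h1, h2,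
    h3, h4, h5, h6, h7, h8, ?_⟩
  · intro k; rw [z_shift, z_leaf hj hv hp, shift_shift]
  · intro k; rw [y_shift, h0]; ring_nf
  · intro k; rw [h0, y_shift, C.y_y, Δ_eq_shift hj, shift_shift]; ring_nf
  · intro k l hkl
    rw [h0, h0, shift_eq_iff hj]
    ring_nf at hkl ⊢
    exact hkl

/-- The triangle of a leaf has no two `η`-fixed vertices: otherwise `σ₁⁴` and `σ₂⁴` agree over the
leaf, and are not the identity. -/
theorem SimplyIntersecting.not_two_semi [Fintype S] (hSI : C.SimplyIntersecting) (hv : C.ζ v = v) :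
    ¬ (C.η (C.ζ (C.η v)) = C.ζ (C.η v) ∧ C.η (C.ζ (C.ζ (C.η v))) = C.ζ (C.ζ (C.η v))) := by
  rintro ⟨e1, e2⟩
  have hN3 := (fiberSize_ne_zero hv).2
  have h5 := five_le_of_semi (hSI.two_le hv) hN3 e1
  obtain ⟨j, hj⟩ := exists_sixth (odd_of_semi e1) hN3
  obtain ⟨V, D₀, D₁, D₂, -, hV, -, zV, yV, yD₀, zD₀, zD₁, zD₂, -, pD₁, pD₂, sD₁, sD₂, -⟩ :=
    exists_leaf_coords hj hv
  have yD₁ : ∀ k, C.y (D₁ k) = D₁ (k + 3) := fun k => by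
    rw [y_semi hj e1 (pD₁ k), sD₁ (k + 3) k]; ring_nf
  have yD₂ : ∀ k, C.y (D₂ k) = D₂ (k + 3) := fun k => by
    rw [y_semi hj e2 (pD₂ k), sD₂ (k + 3) k]; ring_nf
  have a1 : C.σ₁ (V 0) = D₂ 1 := σ₁_eq (by rw [yV, zD₂]; rfl)
  have a2 : C.σ₁ (D₂ 1) = D₁ 2 := σ₁_eq (by rw [yD₂, zD₁]; rfl)
  have a3 : C.σ₁ (D₁ 2) = D₀ 3 := σ₁_eq (by rw [yD₁, zD₀]; rfl)
  have a4 : C.σ₁ (D₀ 3) = V 4 := σ₁_eq (by rw [yD₀, zV]; rfl)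
  have b1 : C.σ₂ (V 0) = D₀ 1 := (σ₂_eq (q := V (-2)) (by rw [zV]; rfl)).trans (by rw [yV]; rfl)
  have b2 : C.σ₂ (D₀ 1) = D₂ 2 := (σ₂_eq (q := D₂ (-1)) (by rw [zD₂]; rfl)).trans (by rw [yD₂]; rfl)
  have b3 : C.σ₂ (D₂ 2) = D₁ 3 := (σ₂_eq (q := D₁ 0) (by rw [zD₁]; rfl)).trans (by rw [yD₁]; rfl)
  have b4 : C.σ₂ (D₁ 3) = V 4 := (σ₂_eq (q := D₀ 1) (by rw [zD₀]; rfl)).trans (by rw [yD₀]; rfl)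
  have s1 : (C.σ₁ ^ 4) (V 0) = V 4 := by
    change C.σ₁ (C.σ₁ (C.σ₁ (C.σ₁ (V 0)))) = _
    rw [a1, a2, a3, a4]
  have s2 : (C.σ₂ ^ 4) (V 0) = V 4 := by
    change C.σ₂ (C.σ₂ (C.σ₂ (C.σ₂ (V 0)))) = _
    rw [b1, b2, b3, b4]
  have h := hSI.pow (V 0) 4 4 (s1.trans s2.symm)
  rw [s1, hV] at h
  have := Int.le_of_dvd (by norm_num) h
  omega

end Shift

end ModularCover

/-! ### Spaces of seven vertices with a bigon -/

namespace ModularCover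

section Seven

variable {S T : Type*} {C : ModularCover S T} [DecidableEq T] {v b : T} {w : T → ℚ}

/-- Two triangles joined by a double edge, the first one next to the leaf `v` and the second one
with an `η`-fixed vertex `b`. -/
structure Seven (C : ModularCover S T) (v b : T) : Prop where
  leaf : C.ζ v = v
  ζ_ne : C.ζ (C.η v) ≠ C.η v
  ζb_ne : C.ζ b ≠ b
  semi : C.η b = b
  notMem : b ∉ C.orb v ∪ C.orb (C.η v)
  univ : ∀ t, t ∈ C.orb v ∪ C.orb (C.η v) ∪ C.orb b

theorem exists_seven [Fintype T] {p : T} (hv : C.ζ v = v) (hd : C.ζ (C.η v) ≠ C.η v)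
    (hp : p ∉ C.orb v ∪ C.orb (C.η v)) (htp : C.ζ p ≠ p) (hηp : C.η p ∈ C.orb v ∪ C.orb (C.η v))
    (hηp1 : C.η (C.ζ p) ∈ C.orb v ∪ C.orb (C.η v)) (he : C.η (C.ζ (C.ζ p)) = C.ζ (C.ζ p)) :
    ∃ b, C.Seven v b ∧
      (C.η (C.ζ b) = C.ζ (C.η v) ∧ C.η (C.ζ (C.ζ b)) = C.ζ (C.ζ (C.η v)) ∨
      C.η (C.ζ b) = C.ζ (C.ζ (C.η v)) ∧ C.η (C.ζ (C.ζ b)) = C.ζ (C.η v)) := by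
  have hinv : C.Inv (C.orb v ∪ C.orb (C.η v)) := inv_orb.union inv_orb
  have hfoot : ∀ t, t ∉ C.orb v ∪ C.orb (C.η v) → C.η t ∈ C.orb v ∪ C.orb (C.η v) →
      C.η t = C.ζ (C.η v) ∨ C.η t = C.ζ (C.ζ (C.η v)) := by
    intro t ht hη
    simp only [Finset.mem_union, orb_leaf hv, Finset.mem_singleton, mem_orb, not_or] at ht hη
    rcases hη with hη | hη | hη | hη
    · rw [C.η_eq_iff] at hη; tauto
    · exact absurd (C.η_inj.1 hη) ht.1
    · exact Or.inl hη
    · exact Or.inr hη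
  have c1 := hfoot p hp hηp
  have c2 := hfoot _ (hinv.ζ_notMem hp) hηp1
  have hcases : C.η p = C.ζ (C.η v) ∧ C.η (C.ζ p) = C.ζ (C.ζ (C.η v)) ∨
      C.η p = C.ζ (C.ζ (C.η v)) ∧ C.η (C.ζ p) = C.ζ (C.η v) := by
    have hne : C.η p ≠ C.η (C.ζ p) := fun h => htp (C.η_inj.1 h).symm
    rcases c1 with c1 | c1 <;> rcases c2 with c2 | c2
    · exact absurd (c1.trans c2.symm) hne
    · exact Or.inl ⟨c1, c2⟩
    · exact Or.inr ⟨c1, c2⟩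
    · exact absurd (c1.trans c2.symm) hne
  refine ⟨C.ζ (C.ζ p), ⟨hv, hd, ?_, he, hinv.ζ_notMem (hinv.ζ_notMem hp), ?_⟩, ?_⟩
  · rw [C.ζ_cube]; exact (ζ_ζ_ne htp).symm
  · have hK : C.Inv (C.orb v ∪ C.orb (C.η v) ∪ C.orb (C.ζ (C.ζ p))) := hinv.union inv_orb
    have huniv := C.eq_univ (C.orb v ∪ C.orb (C.η v) ∪ C.orb (C.ζ (C.ζ p)) : Finset T)
      ⟨v, by simp [mem_orb]⟩ (fun t ht => by exact_mod_cast hK t (by exact_mod_cast ht)) ?_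
    · intro t
      have : t ∈ ((C.orb v ∪ C.orb (C.η v) ∪ C.orb (C.ζ (C.ζ p)) : Finset T) : Set T) := by
        rw [huniv]; trivial
      exact_mod_cast this
    · intro t ht
      have d1 : C.η (C.ζ (C.η v)) = p ∨ C.η (C.ζ (C.η v)) = C.ζ p := by
        rcases hcases with ⟨c1, c2⟩ | ⟨c1, c2⟩
        · left; rw [← c1, C.η_sq]
        · right; rw [← c2, C.η_sq]
      have d2 : C.η (C.ζ (C.ζ (C.η v))) = p ∨ C.η (C.ζ (C.ζ (C.η v))) = C.ζ p := by
        rcases hcases with ⟨c1, c2⟩ | ⟨c1, c2⟩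
        · right; rw [← c2, C.η_sq]
        · left; rw [← c1, C.η_sq]
      simp only [Finset.coe_union, Set.mem_union, Finset.mem_coe, orb_leaf hv,
        Finset.mem_singleton, mem_orb, C.ζ_cube] at ht ⊢
      rcases ht with (rfl | rfl | rfl | rfl) | rfl | rfl | rfl
      · exact Or.inl (Or.inr (Or.inl rfl))
      · exact Or.inl (Or.inl (C.η_sq _))
      · exact Or.inr (Or.inr d1)
      · exact Or.inr (Or.inr d2)
      · exact Or.inr (Or.inl he)
      · exact Or.inl (Or.inr (Or.inr c1))
      · exact Or.inl (Or.inr (Or.inr c2))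
  · rw [C.ζ_cube]; exact hcases

/-- The two full vertices `v` and `ζ η v` suffice. -/
theorem Seven.full (h : C.Seven v b) (hb : C.η (C.ζ b) ∈ C.orb (C.η v))
    (hb' : C.η (C.ζ (C.ζ b)) ∈ C.orb (C.η v)) {Q : Set S} (hQ : C.Closed Q)
    (h0 : C.Full Q v) (h1 : C.Full Q (C.ζ (C.η v))) (t : T) : C.Full Q t := by
  have f0 : C.Full Q (C.η v) := hQ.full_η (by rwa [h.leaf]) (by rwa [h.leaf, h.leaf])
  have fd := hQ.full_orb f0 (by rwa [C.η_sq]) h1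
  have g1 : C.Full Q (C.ζ b) := by
    -- The vertices `ζ b` and `ζ² b` are full by their neighbours.
    have hdinv : C.Inv (C.orb (C.η v)) := inv_orb
    exact hdinv.full_base hQ fd hb
  have g2 : C.Full Q (C.ζ (C.ζ b)) := (inv_orb (C := C) (a := C.η v)).full_base hQ fd hb'
  have g0 := hQ.full_η g1 g2
  rw [h.semi] at g0
  have ht := h.univ t
  simp only [Finset.mem_union, orb_leaf h.leaf, Finset.mem_singleton] at ht
  rcases ht with (rfl | ht) | ht
  · exact h0
  · exact fd t ht
  · rw [mem_orb] at ht
    rcases ht with rfl | rfl | rfl <;> assumption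

theorem Seven.sum (h : C.Seven v b) [Fintype T] :
    ∑ t, w t = w v + (w (C.η v) + w (C.ζ (C.η v)) + w (C.ζ (C.ζ (C.η v)))) +
      (w b + w (C.ζ b) + w (C.ζ (C.ζ b))) := by
  have hinv : C.Inv (C.orb v ∪ C.orb (C.η v)) := inv_orb.union inv_orb
  have huniv : C.orb v ∪ C.orb (C.η v) ∪ C.orb b = Finset.univ := by
    ext t; simpa using h.univ t
  rw [← huniv, Finset.sum_union (hinv.disjoint_orb h.notMem),
    Finset.sum_union (inv_orb.disjoint_orb (η_leaf_notMem h.leaf)), sum_orb h.ζb_ne,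
    sum_orb h.ζ_ne, orb_leaf h.leaf, Finset.sum_singleton]

theorem cost_of_full [Fintype S] [Fintype T] {n : ℕ} {t : T}
    (P : Finset S) (hP : P.card ≤ n) (h : ∀ Q, C.Closed Q → (P : Set S) ⊆ Q → C.Full Q t →
      ∀ u, C.Full Q u) : C.Cost Finset.univ (C.fiberSize + n) := by
  classical
  refine ⟨C.fiber t ∪ P, (Finset.card_union_le _ _).trans ?_, fun Q hQ hsub u _ => ?_⟩
  · rw [C.card_fiber]; omega
  · rw [Finset.coe_union, Set.union_subset_iff] at hsub
    exact h Q hQ hsub.2 (fun s hs => hsub.1 (Finset.mem_coe.2 (C.mem_fiber.2 hs))) u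

/-- The untwisted double edge: it bounds a bigon. By simply intersecting cycles the holonomy around
the face of the leaf is trivial, which leaves `Δ ^ (7 / 6)` as holonomy of the bigon. If this is
trivial the bigon raises the weight. Otherwise the fibre size is at least `14`, and with the leaf
full ten consecutive points over `ζ η v` determine the other ones by recursion. -/
theorem Seven.exists_cost_bigon [Fintype S] [Fintype T] (h : C.Seven v b)
    (hSI : C.SimplyIntersecting)
    (hb1 : C.η (C.ζ b) = C.ζ (C.ζ (C.η v))) (hb2 : C.η (C.ζ (C.ζ b)) = C.ζ (C.η v))
    (hw : ∀ t, (C.fiberSize : ℚ) ≤ w t)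
    (hw2 : ∀ t, (∀ q, C.proj q = t → C.σ₁ (C.σ₁ q) = q) →
      4 / 3 * (C.fiberSize : ℚ) ≤ w t ∧ 4 / 3 * (C.fiberSize : ℚ) ≤ w (C.η t)) :
    ∃ c : ℕ, C.Cost Finset.univ c ∧ 4 * (c : ℚ) ≤ ∑ t, w t := by
  classical
  have hN3 := (fiberSize_ne_zero h.leaf).2
  have h5 := five_le_of_semi (hSI.two_le h.leaf) hN3 h.semi
  obtain ⟨j, hj⟩ := exists_sixth (odd_of_semi h.semi) hN3
  obtain ⟨V, D₀, D₁, D₂, pV, hV, -, zV, yV, yD₀, zD₀, zD₁, zD₂, -, pD₁, pD₂, sD₁, sD₂, -⟩ :=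
    exists_leaf_coords hj h.leaf
  have hηd1 : C.η (C.ζ (C.η v)) = C.ζ (C.ζ b) := by rw [← hb2, C.η_sq]
  have hηd2 : C.η (C.ζ (C.ζ (C.η v))) = C.ζ b := by rw [← hb1, C.η_sq]
  have hfull : ∀ {Q : Set S}, C.Closed Q → C.Full Q v → C.Full Q (C.ζ (C.η v)) →
      ∀ t, C.Full Q t := fun hQ h0 h1 t =>
    h.full (by rw [hb1]; simp [mem_orb]) (by rw [hb2]; simp [mem_orb]) hQ h0 h1 t
  have hsum := h.sum (w := w)
  by_cases hhol : ∀ q, C.proj q = C.ζ (C.η v) → C.σ₁ (C.σ₁ q) = q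
  · obtain ⟨w1, w2, w3, w4⟩ := bigon_weights hw2 hηd1 hηd2 hhol
    refine ⟨_, cost_of_full (t := v) (C.fiber (C.ζ (C.η v))) (C.card_fiber _).le
      fun Q hQ hsub h0 => hfull hQ h0 fun s hs => hsub (Finset.mem_coe.2 (C.mem_fiber.2 hs)), ?_⟩
    rw [hsum]
    push_cast
    linarith [hw v, hw (C.η v), hw b]
  obtain ⟨B₂, B₀, B₁, hB₂, zB₂, zB₀, zB₁, pB₂, pB₀, pB₁, sB₀, sB₁⟩ :=
    exists_coords hj (C.y (D₁ 0)) 3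
  have hp : C.proj (C.y (D₁ 0)) = C.ζ (C.ζ b) := by rw [C.proj_y, pD₁, hηd1]
  rw [hp, C.ζ_cube] at pB₀ pB₁
  rw [hp] at pB₂
  have yD₁ : ∀ k, C.y (D₁ k) = B₂ (k + 3) := fun k => by
    rw [hB₂, sD₁ k 0, y_shift]; ring_nf
  have yB₂ : ∀ k, C.y (B₂ k) = D₁ (k + 3) := fun k => by
    rw [hB₂, y_shift, C.y_y, Δ_eq_shift hj, shift_shift, sD₁ (k + 3) 0]; ring_nf
  have yB₀ : ∀ k, C.y (B₀ k) = B₀ (k + 3) := fun k => by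
    rw [y_semi hj h.semi (pB₀ k), sB₀ (k + 3) k]; ring_nf
  obtain ⟨m, hm⟩ : ∃ m, C.y (D₂ 0) = B₁ m := by
    obtain ⟨m, hm⟩ := exists_shift hj (s := C.y (D₂ 0)) (s' := B₁ 0)
      (by rw [C.proj_y, pD₂, pB₁, hηd2])
    exact ⟨m, by rw [hm, sB₁ m 0, sub_zero]⟩
  have yD₂' : ∀ k, C.y (D₂ k) = B₁ (k + m) := fun k => by
    rw [sD₂ k 0, y_shift, hm, sB₁ (k + m) m]; ring_nf
  -- The holonomy around the face of the leaf.
  have hm2 : (C.fiberSize : ℤ) ∣ m + 2 := by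
    have a1 : C.σ₁ (V 0) = D₂ 1 := σ₁_eq (by rw [yV, zD₂]; rfl)
    have a2 : C.σ₁ (D₂ 1) = B₀ (m - 1) := σ₁_eq (by rw [yD₂', zB₀]; ring_nf)
    have a3 : C.σ₁ (B₀ (m - 1)) = B₂ m := σ₁_eq (by rw [yB₀, zB₂]; ring_nf)
    have a4 : C.σ₁ (B₂ m) = D₀ (m + 1) := σ₁_eq (by rw [yB₂, zD₀]; ring_nf)
    have a5 : C.σ₁ (D₀ (m + 1)) = V (m + 2) := σ₁_eq (by rw [yD₀, zV]; ring_nf)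
    have b1 : C.σ₂ (V 0) = D₀ 1 := (σ₂_eq (q := V (-2)) (by rw [zV]; rfl)).trans (by rw [yV]; rfl)
    have b2 : C.σ₂ (D₀ 1) = B₁ (m - 1) :=
      (σ₂_eq (q := D₂ (-1)) (by rw [zD₂]; rfl)).trans (by rw [yD₂']; ring_nf)
    have b3 : C.σ₂ (B₁ (m - 1)) = B₀ m :=
      (σ₂_eq (q := B₀ (m - 3)) (by rw [zB₀]; ring_nf)).trans (by rw [yB₀]; ring_nf)
    have b4 : C.σ₂ (B₀ m) = D₁ (m + 1) :=
      (σ₂_eq (q := B₂ (m - 2)) (by rw [zB₂]; ring_nf)).trans (by rw [yB₂]; ring_nf)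
    have b5 : C.σ₂ (D₁ (m + 1)) = V (m + 2) :=
      (σ₂_eq (q := D₀ (m - 1)) (by rw [zD₀]; ring_nf)).trans (by rw [yD₀]; ring_nf)
    have s1 : (C.σ₁ ^ 5) (V 0) = V (m + 2) := by
      change C.σ₁ (C.σ₁ (C.σ₁ (C.σ₁ (C.σ₁ (V 0))))) = _
      rw [a1, a2, a3, a4, a5]
    have s2 : (C.σ₂ ^ 5) (V 0) = V (m + 2) := by
      change C.σ₂ (C.σ₂ (C.σ₂ (C.σ₂ (C.σ₂ (V 0))))) = _
      rw [b1, b2, b3, b4, b5]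
    have h := hSI.pow (V 0) 5 5 (s1.trans s2.symm)
    rw [s1, hV] at h
    simpa using h
  have yD₂ : ∀ k, C.y (D₂ k) = B₁ (k - 2) := fun k => by
    rw [yD₂', sB₁ (k + m) 0, sB₁ (k - 2) 0, shift_eq_iff hj]
    ring_nf at hm2 ⊢
    exact hm2
  have yB₁ : ∀ k, C.y (B₁ k) = D₂ (k + 8) := fun k => by
    have := C.y_y (D₂ (k + 2))
    rw [yD₂, Δ_eq_shift hj] at this
    rw [sD₂ (k + 8) (k + 2), ← show B₁ (k + 2 - 2) = B₁ k by ring_nf, this]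
    ring_nf
  -- The holonomy around the bigon.
  have hD₁ : ∀ k, C.σ₁ (C.σ₁ (D₁ k)) = D₁ (k + 7) := fun k => by
    have a1 : C.σ₁ (D₁ k) = B₁ (k + 1) := σ₁_eq (by rw [yD₁, zB₁]; ring_nf)
    have a2 : C.σ₁ (B₁ (k + 1)) = D₁ (k + 7) := σ₁_eq (by rw [yB₁, zD₁]; ring_nf)
    rw [a1, a2]
  have hcoord : ∀ q, C.proj q = C.ζ (C.η v) → ∃ k, q = D₁ k := by
    intro q hq
    obtain ⟨k, hk⟩ := exists_shift hj (s := q) (s' := D₁ 0) (by rw [hq, pD₁])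
    exact ⟨k, by rw [hk, sD₁ k 0, sub_zero]⟩
  have hN7 : ¬ (C.fiberSize : ℤ) ∣ 7 := by
    intro hd
    apply hhol
    intro q hq
    obtain ⟨k, rfl⟩ := hcoord q hq
    rw [hD₁, sD₁ (k + 7) 0, sD₁ k 0, shift_eq_iff hj]
    ring_nf
    exact hd
  have h14 : 14 ≤ C.fiberSize := by
    have h7 : 7 ∣ C.fiberSize := by
      by_contra h7
      have hcop : IsCoprime (7 : ℤ) (C.fiberSize : ℤ) := by
        exact_mod_cast Nat.isCoprime_iff_coprime.2
          ((Nat.Prime.coprime_iff_not_dvd (by norm_num : Nat.Prime 7)).2 h7)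
      obtain ⟨x, y, hxy⟩ := hcop
      -- If `Δ ^ (7 / 6)` generates the fibres, two cycles intersect over `ζ² η v` and `ζ² b`.
      have r1 : (C.σ₁ ^ 2) (D₂ 0) = B₂ (-3) := by
        have a1 : C.σ₁ (D₂ 0) = B₀ (-4) := σ₁_eq (by rw [yD₂, zB₀]; rfl)
        have a2 : C.σ₁ (B₀ (-4)) = B₂ (-3) := σ₁_eq (by rw [yB₀, zB₂]; rfl)
        change C.σ₁ (C.σ₁ (D₂ 0)) = _
        rw [a1, a2]
      have b1 : ∀ k, C.σ₂ (D₂ k) = B₂ (k + 1) := fun k =>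
        (σ₂_eq (q := D₁ (k - 2)) (by rw [zD₁]; ring_nf)).trans (by rw [yD₁]; ring_nf)
      have b2 : ∀ k, C.σ₂ (B₂ k) = D₂ (k + 6) := fun k =>
        (σ₂_eq (q := B₁ (k - 2)) (by rw [zB₁]; ring_nf)).trans (by rw [yB₁]; ring_nf)
      have r2 : ∀ i : ℕ, (C.σ₂ ^ (2 * i)) (D₂ 0) = D₂ (7 * i) := by
        intro i
        induction i with
        | zero => simp
        | succ i ih =>
          rw [show 2 * (i + 1) = 2 + 2 * i by ring, pow_add, Equiv.Perm.mul_apply, ih]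
          change C.σ₂ (C.σ₂ _) = _
          rw [b1, b2]
          push_cast
          ring_nf
      set i := ((-4 * x) % C.fiberSize).toNat with hi
      have hi' : (i : ℤ) = (-4 * x) % C.fiberSize :=
        Int.toNat_of_nonneg (Int.emod_nonneg _ (by omega))
      have hdvd : (C.fiberSize : ℤ) ∣ 7 * i + 4 := by
        have := Int.mul_ediv_add_emod (-4 * x) C.fiberSize
        refine ⟨4 * y - 7 * ((-4 * x) / C.fiberSize), ?_⟩
        rw [hi']
        linear_combination 7 * this - 4 * hxy
      have hEq : (C.σ₁ ^ 2) (D₂ 0) = (C.σ₂ ^ (2 * i + 1)) (D₂ 0) := by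
        rw [r1, pow_succ', Equiv.Perm.mul_apply, r2, b1, hB₂, hB₂, shift_eq_iff hj, ← dvd_neg]
        ring_nf at hdvd ⊢
        exact hdvd
      have hfix := hSI.pow _ _ _ hEq
      rw [r1] at hfix
      have hproj := congrArg C.proj hfix
      rw [pB₂, pD₂] at hproj
      have hb := ζ_ζ_ne h.ζb_ne
      apply h.notMem
      have : b = C.η v := C.ζ.injective (C.ζ.injective hproj)
      rw [this]
      simp [mem_orb]
    obtain ⟨k, hk⟩ := h7
    have : k ≠ 1 := by
      rintro rfl
      exact hN7 (by rw [hk]; norm_num)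
    omega
  refine ⟨C.fiberSize + 10, cost_of_full (t := v) ((Finset.range 10).image fun i : ℕ => D₁ i)
    (by simpa using Finset.card_image_le (s := Finset.range 10) (f := fun i : ℕ => D₁ i))
    fun Q hQ hsub h0 => hfull hQ h0 ?_, ?_⟩
  · have f0 : C.Full Q (C.η v) := hQ.full_η (by rwa [h.leaf]) (by rwa [h.leaf, h.leaf])
    have f0' : C.Full Q (C.η (C.η v)) := by rwa [C.η_sq]
    have l1 : ∀ k, D₁ k ∈ Q ↔ B₂ (k + 3) ∈ Q := fun k => by
      rw [← yD₁]; exact hQ.link_y f0 f0' (pD₁ k)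
    have l2 : ∀ k, D₁ k ∈ Q ↔ D₂ (k + 2) ∈ Q := fun k => by
      rw [← zD₁]; exact hQ.link_z f0' (pD₁ k)
    have l3 : ∀ k, B₁ k ∈ Q ↔ D₁ (k + 6) ∈ Q := fun k => by
      have := hQ.link_Δ f0 f0' (pD₂ (k + 2))
      rw [yD₂, Δ_eq_shift hj] at this
      rw [l2, show k + 6 + 2 = (k + 2) + 6 by ring, sD₂ (k + 2 + 6) (k + 2), add_sub_cancel_left,
        ← this, add_sub_cancel_right]
    -- Two points at distance seven determine a point over `b`, which links another such pair.
    have hrec : ∀ k, D₁ k ∈ Q → D₁ (k + 7) ∈ Q → D₁ (k + 3) ∈ Q → D₁ (k + 10) ∈ Q := by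
      intro k h1 h2 h3
      have t1 := (hQ (B₁ (k + 1))).1
      rw [yB₁, zB₁, zB₂] at t1
      have t2 := t1 (by have := (l2 (k + 7)).1 h2; ring_nf at this ⊢; exact this)
        (by have := (l1 k).1 h1; ring_nf at this ⊢; exact this)
      have t3 := (hQ (B₀ (k + 2))).2.1
      rw [yB₀, zB₀, zB₁] at t3
      have t4 := t3 (by ring_nf at t2 ⊢; exact t2)
        (by have := (l1 (k + 3)).1 h3; ring_nf at this ⊢; exact this)
      have := (l3 (k + 4)).1 (by ring_nf at t4 ⊢; exact t4)
      ring_nf at this ⊢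
      exact this
    have hall : ∀ n : ℕ, D₁ n ∈ Q := by
      intro n
      induction n using Nat.strong_induction_on with
      | _ n ih =>
        rcases Nat.lt_or_ge n 10 with hn | hn
        · exact hsub (by simpa using ⟨n, hn, rfl⟩)
        · obtain ⟨k, rfl⟩ := Nat.exists_eq_add_of_le' hn
          have := hrec k (ih k (by omega)) (by exact_mod_cast ih (k + 7) (by omega))
            (by exact_mod_cast ih (k + 3) (by omega))
          exact_mod_cast this
    intro q hq
    obtain ⟨k, rfl⟩ := hcoord q hq
    have hk : D₁ k = D₁ ((k % C.fiberSize).toNat : ℤ) := by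
      rw [Int.toNat_of_nonneg (Int.emod_nonneg _ (by omega)), sD₁ k 0,
        sD₁ (k % C.fiberSize) 0, shift_eq_iff hj]
      exact ⟨k / C.fiberSize, by have := Int.mul_ediv_add_emod k C.fiberSize; linarith⟩
    rw [hk]
    exact hall _
  · rw [hsum]
    have h14' : (14 : ℚ) ≤ C.fiberSize := by exact_mod_cast h14
    push_cast
    linarith [hw v, hw (C.η v), hw (C.ζ (C.η v)), hw (C.ζ (C.ζ (C.η v))), hw b, hw (C.ζ b),
      hw (C.ζ (C.ζ b))]

end Seven

end ModularCover

/-! ### Spaces of seven vertices without a bigon, and the bound for permutations -/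

namespace ModularCover

section Seven

variable {S T : Type*} {C : ModularCover S T} [DecidableEq T] {v b : T} {w : T → ℚ}

/-- The twisted double edge: the triangles bound a common triangular face. Simply intersecting
cycles, applied to the face of the leaf and then to the face of `b`, leave only one space, of fibre
size seven. It has a plague of `13` points, and the triangular face raises the weight. -/
theorem Seven.exists_cost_twisted [Fintype S] [Fintype T] (h : C.Seven v b)
    (hSI : C.SimplyIntersecting)
    (hb1 : C.η (C.ζ b) = C.ζ (C.η v)) (hb2 : C.η (C.ζ (C.ζ b)) = C.ζ (C.ζ (C.η v)))
    (hw : ∀ t, (C.fiberSize : ℚ) ≤ w t)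
    (hw3 : ∀ t, (∀ q, C.proj q = t → (C.σ₁ ^ 3) q = q) →
      7 / 6 * (C.fiberSize : ℚ) ≤ w t ∧ 7 / 6 * (C.fiberSize : ℚ) ≤ w (C.η t)) :
    ∃ c : ℕ, C.Cost Finset.univ c ∧ 4 * (c : ℚ) ≤ ∑ t, w t := by
  classical
  have hN3 := (fiberSize_ne_zero h.leaf).2
  have h5 := five_le_of_semi (hSI.two_le h.leaf) hN3 h.semi
  obtain ⟨j, hj⟩ := exists_sixth (odd_of_semi h.semi) hN3
  obtain ⟨V, D₀, D₁, D₂, pV, hV, cV, zV, yV, yD₀, zD₀, zD₁, zD₂, -, pD₁, pD₂, sD₁, sD₂, perD₀⟩ :=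
    exists_leaf_coords hj h.leaf
  have hηd1 : C.η (C.ζ (C.η v)) = C.ζ b := by rw [← hb1, C.η_sq]
  have hηd2 : C.η (C.ζ (C.ζ (C.η v))) = C.ζ (C.ζ b) := by rw [← hb2, C.η_sq]
  obtain ⟨B₁, B₂, B₀, hB₁, zB₁, zB₂, zB₀, pB₁, pB₂, pB₀, sB₂, sB₀⟩ :=
    exists_coords hj (C.y (D₁ 0)) 3
  have hp : C.proj (C.y (D₁ 0)) = C.ζ b := by rw [C.proj_y, pD₁, hηd1]
  rw [hp] at pB₁ pB₂ pB₀
  rw [C.ζ_cube] at pB₀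
  have yD₁ : ∀ k, C.y (D₁ k) = B₁ (k + 3) := fun k => by
    rw [hB₁, sD₁ k 0, y_shift]; ring_nf
  have yB₁ : ∀ k, C.y (B₁ k) = D₁ (k + 3) := fun k => by
    rw [hB₁, y_shift, C.y_y, Δ_eq_shift hj, shift_shift, sD₁ (k + 3) 0]; ring_nf
  have yB₀ : ∀ k, C.y (B₀ k) = B₀ (k + 3) := fun k => by
    rw [y_semi hj h.semi (pB₀ k), sB₀ (k + 3) k]; ring_nf
  obtain ⟨m, hm⟩ : ∃ m, C.y (D₂ 0) = B₂ m := by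
    obtain ⟨m, hm⟩ := exists_shift hj (s := C.y (D₂ 0)) (s' := B₂ 0)
      (by rw [C.proj_y, pD₂, pB₂, hηd2])
    exact ⟨m, by rw [hm, sB₂ m 0, sub_zero]⟩
  have yD₂' : ∀ k, C.y (D₂ k) = B₂ (k + m) := fun k => by
    rw [sD₂ k 0, y_shift, hm, sB₂ (k + m) m]; ring_nf
  -- The holonomy around the face of the leaf.
  have hm1 : (C.fiberSize : ℤ) ∣ m + 1 := by
    have a1 : C.σ₁ (V 0) = D₂ 1 := σ₁_eq (by rw [yV, zD₂]; rfl)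
    have a2 : C.σ₁ (D₂ 1) = B₁ (m - 1) := σ₁_eq (by rw [yD₂', zB₁]; ring_nf)
    have a3 : C.σ₁ (B₁ (m - 1)) = D₀ m := σ₁_eq (by rw [yB₁, zD₀]; ring_nf)
    have a4 : C.σ₁ (D₀ m) = V (m + 1) := σ₁_eq (by rw [yD₀, zV]; ring_nf)
    have yB₂' : ∀ k, C.y (B₂ k) = D₂ (k - m + 6) := fun k => by
      have := C.y_y (D₂ (k - m))
      rw [yD₂', Δ_eq_shift hj, sub_add_cancel] at this
      rw [this, sD₂ (k - m + 6) (k - m)]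
      ring_nf
    have b1 : C.σ₂ (V 0) = D₀ 1 := (σ₂_eq (q := V (-2)) (by rw [zV]; rfl)).trans (by rw [yV]; rfl)
    have b2 : C.σ₂ (D₀ 1) = B₂ (m - 1) :=
      (σ₂_eq (q := D₂ (-1)) (by rw [zD₂]; rfl)).trans (by rw [yD₂']; ring_nf)
    have b3 : C.σ₂ (B₂ (m - 1)) = D₁ m :=
      (σ₂_eq (q := B₁ (m - 3)) (by rw [zB₁]; ring_nf)).trans (by rw [yB₁]; ring_nf)
    have b4 : C.σ₂ (D₁ m) = V (m + 1) :=
      (σ₂_eq (q := D₀ (m - 2)) (by rw [zD₀]; ring_nf)).trans (by rw [yD₀]; ring_nf)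
    have s1 : (C.σ₁ ^ 4) (V 0) = V (m + 1) := by
      change C.σ₁ (C.σ₁ (C.σ₁ (C.σ₁ (V 0)))) = _
      rw [a1, a2, a3, a4]
    have s2 : (C.σ₂ ^ 4) (V 0) = V (m + 1) := by
      change C.σ₂ (C.σ₂ (C.σ₂ (C.σ₂ (V 0)))) = _
      rw [b1, b2, b3, b4]
    have h := hSI.pow (V 0) 4 4 (s1.trans s2.symm)
    rw [s1, hV] at h
    simpa using h
  have yD₂ : ∀ k, C.y (D₂ k) = B₂ (k - 1) := fun k => by
    rw [yD₂', sB₂ (k + m) 0, sB₂ (k - 1) 0, shift_eq_iff hj]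
    ring_nf at hm1 ⊢
    exact hm1
  have yB₂ : ∀ k, C.y (B₂ k) = D₂ (k + 7) := fun k => by
    have := C.y_y (D₂ (k + 1))
    rw [yD₂, Δ_eq_shift hj] at this
    rw [sD₂ (k + 7) (k + 1), ← show B₂ (k + 1 - 1) = B₂ k by ring_nf, this]
    ring_nf
  have a1 : ∀ k, C.σ₁ (B₀ k) = B₂ (k + 1) := fun k => σ₁_eq (by rw [yB₀, zB₂]; ring_nf)
  have a2 : ∀ k, C.σ₁ (B₂ k) = D₁ (k + 5) := fun k => σ₁_eq (by rw [yB₂, zD₁]; ring_nf)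
  have a3 : ∀ k, C.σ₁ (D₁ k) = B₀ (k + 1) := fun k => σ₁_eq (by rw [yD₁, zB₀]; ring_nf)
  have sh₀ : ∀ {k l}, B₀ k = B₀ l ↔ (C.fiberSize : ℤ) ∣ k - l := fun {k l} => by
    rw [sB₀ k 0, sB₀ l 0, shift_eq_iff hj, sub_zero, sub_zero]
  -- The holonomy around the face of `b`.
  have h7 : C.fiberSize = 7 := by
    have b1 : ∀ k, C.σ₂ (B₀ k) = D₂ (k + 5) := fun k =>
      (σ₂_eq (q := B₂ (k - 2)) (by rw [zB₂]; ring_nf)).trans (by rw [yB₂]; ring_nf)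
    have b2 : ∀ k, C.σ₂ (D₂ k) = B₁ (k + 1) := fun k =>
      (σ₂_eq (q := D₁ (k - 2)) (by rw [zD₁]; ring_nf)).trans (by rw [yD₁]; ring_nf)
    have b3 : ∀ k, C.σ₂ (B₁ k) = B₀ (k + 1) := fun k =>
      (σ₂_eq (q := B₀ (k - 2)) (by rw [zB₀]; ring_nf)).trans (by rw [yB₀]; ring_nf)
    have s1 : (C.σ₁ ^ 3) (B₀ 0) = B₀ 7 := by
      change C.σ₁ (C.σ₁ (C.σ₁ (B₀ 0))) = _
      rw [a1, a2, a3]; rfl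
    have s2 : (C.σ₂ ^ 3) (B₀ 0) = B₀ 7 := by
      change C.σ₂ (C.σ₂ (C.σ₂ (B₀ 0))) = _
      rw [b1, b2, b3]; rfl
    have h := hSI.pow (B₀ 0) 3 3 (s1.trans s2.symm)
    rw [s1, sh₀, sub_zero] at h
    have h' : C.fiberSize ∣ 7 := by exact_mod_cast h
    rcases (Nat.dvd_prime (by norm_num : Nat.Prime 7)).1 h' with h | h <;> omega
  refine ⟨C.fiberSize + 6, cost_of_full (t := C.ζ (C.η v))
    (((Finset.range 6).image fun i : ℕ => V (i + 1)))
    (by simpa using Finset.card_image_le (s := Finset.range 6) (f := fun i : ℕ => V (i + 1)))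
    fun Q hQ hsub h1 => ?_, ?_⟩
  · have mV : ∀ i : ℕ, i < 6 → V (i + 1) ∈ Q := fun i hi =>
      hsub (Finset.mem_coe.2 (Finset.mem_image_of_mem _ (Finset.mem_range.2 hi)))
    have v1 : V 1 ∈ Q := by simpa using mV 0 (by norm_num)
    have v2 : V 2 ∈ Q := by simpa using mV 1 (by norm_num)
    have v3 : V 3 ∈ Q := by simpa using mV 2 (by norm_num)
    have v4 : V 4 ∈ Q := by simpa using mV 3 (by norm_num)
    have v5 : V 5 ∈ Q := by simpa using mV 4 (by norm_num)
    have v6 : V 6 ∈ Q := by simpa using mV 5 (by norm_num)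
    have mD₁ : ∀ k, D₁ k ∈ Q := fun k => h1 _ (pD₁ k)
    -- The rule at each of the points used below.
    have rV : ∀ k, V (k + 2) ∈ Q → V (k + 4) ∈ Q → D₀ (k + 3) ∈ Q := fun k => by
      have := (hQ (V k)).2.2
      rw [yV, zV, zV] at this
      ring_nf at this ⊢
      exact this
    have rV' : ∀ k, D₀ (k + 3) ∈ Q → V (k + 2) ∈ Q → V (k + 4) ∈ Q := fun k => by
      have := (hQ (V k)).1
      rw [yV, zV, zV] at this
      ring_nf at this ⊢
      exact this
    have d23 : D₂ 3 ∈ Q := by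
      have := (hQ (D₀ (-1))).1
      rw [yD₀, zD₀, zD₁] at this
      exact this v2 (mD₁ _)
    have d05 : D₀ 5 ∈ Q := rV 2 v4 v6
    have d02 : D₀ 2 ∈ Q := by
      have := rV (-1)
      norm_num at this
      exact this v1 v3
    have b14 : B₁ 4 ∈ Q := by
      have := (hQ (D₁ 1)).2.2
      rw [yD₁, zD₁, zD₂] at this
      exact this d23 d05
    have d09 : D₀ 9 ∈ Q := by rwa [perD₀ 9 2 (by rw [h7]; norm_num)]
    have b26 : B₂ 6 ∈ Q := by
      have := (hQ (D₂ 7)).2.2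
      rw [yD₂, zD₂, zD₀] at this
      exact this d09 (mD₁ _)
    have b05 : B₀ 5 ∈ Q := by
      have := (hQ (B₀ 2)).2.2
      rw [yB₀, zB₀, zB₁] at this
      exact this b14 b26
    have b23 : B₂ 3 ∈ Q := by
      have := (hQ (B₁ 1)).2.1
      rw [yB₁, zB₁, zB₂] at this
      exact this (mD₁ _) b05
    have d06 : D₀ 6 ∈ Q := by
      have := (hQ (D₂ 4)).2.1
      rw [yD₂, zD₂, zD₀] at this
      exact this b23 (mD₁ _)
    have v7 : V 7 ∈ Q := rV' 3 d06 v5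
    have h0 : C.Full Q v := by
      intro q hq
      obtain ⟨k, rfl⟩ := cV q hq
      have hred : ∀ l, (C.fiberSize : ℤ) ∣ k - l → V l ∈ Q → V k ∈ Q := fun l hl hQl => by
        rwa [(hV k l).2 hl]
      rw [h7] at hred
      have : k % 7 = 0 ∨ k % 7 = 1 ∨ k % 7 = 2 ∨ k % 7 = 3 ∨ k % 7 = 4 ∨ k % 7 = 5 ∨ k % 7 = 6 := by
        omega
      push_cast at hred
      rcases this with h | h | h | h | h | h | h
      · exact hred 7 (by omega) v7
      · exact hred 1 (by omega) v1
      · exact hred 2 (by omega) v2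
      · exact hred 3 (by omega) v3
      · exact hred 4 (by omega) v4
      · exact hred 5 (by omega) v5
      · exact hred 6 (by omega) v6
    exact h.full (by rw [hb1]; simp [mem_orb]) (by rw [hb2]; simp [mem_orb]) hQ h0 h1
  · have hcoord : ∀ {F : ℤ → S} {t : T}, (∀ k, C.proj (F k) = t) →
        (∀ k l, F k = C.shift j (k - l) (F l)) → ∀ q, C.proj q = t → ∃ k, q = F k := by
      intro F t pF sF q hq
      obtain ⟨k, hk⟩ := exists_shift hj (s := q) (s' := F 0) (by rw [hq, pF])
      exact ⟨k, by rw [hk, sF k 0, sub_zero]⟩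
    have w1 := hw3 b fun q hq => by
      obtain ⟨k, rfl⟩ := hcoord pB₀ sB₀ q hq
      change C.σ₁ (C.σ₁ (C.σ₁ _)) = _
      rw [a1, a2, a3, sh₀, h7]
      ring_nf
      norm_num
    have w2 := hw3 (C.ζ (C.ζ b)) fun q hq => by
      obtain ⟨k, rfl⟩ := hcoord pB₂ sB₂ q hq
      change C.σ₁ (C.σ₁ (C.σ₁ _)) = _
      rw [a2, a3, a1, sB₂ _ 0, sB₂ k 0, shift_eq_iff hj, h7]
      ring_nf
      norm_num
    have w3 := hw3 (C.ζ (C.η v)) fun q hq => by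
      obtain ⟨k, rfl⟩ := hcoord pD₁ sD₁ q hq
      change C.σ₁ (C.σ₁ (C.σ₁ _)) = _
      rw [a3, a1, a2, sD₁ _ 0, sD₁ k 0, shift_eq_iff hj, h7]
      ring_nf
      norm_num
    rw [hb2] at w2
    rw [hηd1] at w3
    rw [h.sum]
    have hwv := hw v
    have hwd := hw (C.η v)
    rw [h7] at w1 w2 w3 hwv hwd ⊢
    norm_num at w1 w2 w3 hwv hwd ⊢
    linarith [w1.1, w2.1, w2.2, w3.1, w3.2]

end Seven

/-- A covering with simply intersecting cycles of a space with a leaf has a plague whose size is at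
most its weight, provided that the weights are large enough. Here `w t` is four times the sum of the
weights over `t`. On average these have to be at least `1 / 4`, and, over `t` and `η t`, at least
`1 / 3` if `σ₁²` is trivial over `t`, and at least `7 / 24` if `σ₁³` is. -/
theorem exists_cost {S T : Type*} {C : ModularCover S T} [Fintype S] [Fintype T] [DecidableEq T]
    {v : T} {w : T → ℚ} (hSI : C.SimplyIntersecting) (hv : C.ζ v = v)
    (hw : ∀ t, (C.fiberSize : ℚ) ≤ w t)
    (hw2 : ∀ t, (∀ q, C.proj q = t → C.σ₁ (C.σ₁ q) = q) →
      4 / 3 * (C.fiberSize : ℚ) ≤ w t ∧ 4 / 3 * (C.fiberSize : ℚ) ≤ w (C.η t))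
    (hw3 : ∀ t, (∀ q, C.proj q = t → (C.σ₁ ^ 3) q = q) →
      7 / 6 * (C.fiberSize : ℚ) ≤ w t ∧ 7 / 6 * (C.fiberSize : ℚ) ≤ w (C.η t)) :
    ∃ c : ℕ, C.Cost Finset.univ c ∧ 4 * (c : ℚ) ≤ ∑ t, w t := by
  have hd := hSI.ζ_η_ne hv
  rcases exists_cost_or_seven hv hd (hSI.not_two_semi hv) (hSI.two_le hv) (fiberSize_ne_zero hv).2
    hw hw2 hw3 with h | ⟨p, hp, htp, hηp, hηp1, he⟩
  · exact h
  · obtain ⟨b, hb, ⟨h1, h2⟩ | ⟨h1, h2⟩⟩ := exists_seven hv hd hp htp hηp hηp1 he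
    · exact hb.exists_cost_twisted hSI h1 h2 hw hw3
    · exact hb.exists_cost_bigon hSI h1 h2 hw hw2

end ModularCover

/-! ### The braid group and the modular group -/

section BraidGroup

namespace BraidThree

theorem s1_s2_s1 : s1 * s2 * s1 = s2 * s1 * s2 := by
  have h : (PresentedGroup.mk _ (FreeGroup.of 0 * FreeGroup.of 1 * FreeGroup.of 0 *
      (FreeGroup.of 1 * FreeGroup.of 0 * FreeGroup.of 1)⁻¹) : BraidThree) = 1 :=
    PresentedGroup.one_of_mem rfl
  rw [map_mul, map_inv, mul_inv_eq_one] at h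
  exact h

theorem delta_eq : delta = (s1 * s2 * s1) ^ 2 := by
  rw [delta, pow_succ, pow_two, pow_two]
  calc s1 * s2 * (s1 * s2) * (s1 * s2) = s1 * s2 * s1 * (s2 * s1 * s2) := by group
    _ = _ := by rw [← s1_s2_s1]

theorem s1_eq : s1 = (s1 * s2)⁻¹ * (s1 * s2 * s1) := by group

theorem s2_eq : s2 = s1 * s2 * s1 * (s1 * s2)⁻¹ := by
  rw [s1_s2_s1]; group

theorem liftX_inv : liftX⁻¹ = s1 * s2 := by rw [liftX]; group

/-- Invariance under the generators `σ₁` and `σ₂` suffices for invariance under `𝔹₃`. -/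
theorem smul_mem {S : Type*} [MulAction BraidThree S] {K : Set S}
    (h1 : ∀ s, s1 • s ∈ K ↔ s ∈ K) (h2 : ∀ s, s2 • s ∈ K ↔ s ∈ K) (g : BraidThree) (s : S) :
    g • s ∈ K ↔ s ∈ K := by
  induction g using PresentedGroup.induction_on with
  | _ w =>
    induction w using FreeGroup.induction_on generalizing s with
    | C1 => simp
    | of i =>
      fin_cases i
      · exact h1 s
      · exact h2 s
    | inv_of i ih =>
      rw [map_inv, ← ih, smul_inv_smul]
    | mul a b iha ihb => rw [map_mul, mul_smul, iha, ihb]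

end BraidThree

namespace Modular

theorem ofBraid_s1 : ofBraid BraidThree.s1 = u := PresentedGroup.toGroup.of _

theorem ofBraid_s2 : ofBraid BraidThree.s2 = l := PresentedGroup.toGroup.of _

theorem ofBraid_delta : ofBraid BraidThree.delta = 1 := by
  rw [BraidThree.delta, map_pow, map_mul, ofBraid_s1, ofBraid_s2]
  have : (u * l) ^ 3 = (QuotientGroup.mk ((matU * matL) ^ 3) : Modular) := rfl
  rw [this, QuotientGroup.eq_one_iff, show (matU * matL) ^ 3 = -1 by decide]
  rw [Subgroup.mem_center_iff]
  intro g
  rw [mul_neg, neg_mul, mul_one, one_mul]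

theorem x_inv : x⁻¹ = ofBraid (BraidThree.s1 * BraidThree.s2) := by
  rw [x, ← map_inv, BraidThree.liftX_inv]

theorem x_inv_cube : x⁻¹ * x⁻¹ * x⁻¹ = 1 := by
  rw [x_inv, ← map_mul, ← map_mul, ← ofBraid_delta, BraidThree.delta]
  congr 1

theorem y_mul_y : y * y = 1 := by
  rw [y, ← map_mul, ← ofBraid_delta, BraidThree.delta_eq, BraidThree.liftY, pow_two]

end Modular

end BraidGroup

section Covering

variable {S T : Type*} [MulAction BraidThree S] [MulAction Modular T] {π : S → T}

/-- The permutations underlying a covering. -/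
def IsCovering.toModularCover [MulAction.IsPretransitive BraidThree S] (hπ : IsCovering π)
    (hxy : verticesXY T = ∅) : ModularCover S T where
  z := MulAction.toPerm (BraidThree.s1 * BraidThree.s2)
  y := MulAction.toPerm BraidThree.liftY
  ζ := MulAction.toPerm Modular.x⁻¹
  η := MulAction.toPerm Modular.y
  proj := π
  proj_surj := hπ.surjective
  proj_z s := by
    simp only [MulAction.toPerm_apply]
    rw [hπ.equivariant, Modular.x_inv]
  proj_y s := hπ.equivariant _ s
  z_cube := by
    ext s
    have h := congrArg (· • s) BraidThree.delta_eq
    simpa only [BraidThree.delta, pow_succ, pow_zero, one_mul, mul_smul, Equiv.Perm.mul_apply,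
      MulAction.toPerm_apply, BraidThree.liftY] using h
  exists_zpow s s' h := by
    obtain ⟨m, hm⟩ := hπ.fiber s s' h
    refine ⟨m, ?_⟩
    rw [BraidThree.delta_eq] at hm
    have h2 : (MulAction.toPerm BraidThree.liftY : Equiv.Perm S) =
      MulAction.toPermHom BraidThree S BraidThree.liftY := rfl
    rw [h2, ← map_pow, ← map_zpow]
    exact hm
  ζ_cube t := by
    simp only [MulAction.toPerm_apply]
    rw [smul_smul, smul_smul, Modular.x_inv_cube, one_smul]
  η_sq t := by
    simp only [MulAction.toPerm_apply]
    rw [smul_smul, Modular.y_mul_y, one_smul]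
  ne_rotate t h := by
    have : t ∈ verticesXY T := by
      simp only [MulAction.toPerm_apply] at h
      change (Modular.x * Modular.y) • t = t
      rw [mul_smul, h, smul_inv_smul]
    rw [hxy] at this
    exact this
  eq_univ K hK hz hy := by
    simp only [MulAction.toPerm_apply] at hz hy
    have hz' : ∀ t, Modular.x⁻¹ • t ∈ K ↔ t ∈ K := fun t => by
      refine ⟨fun h => ?_, hz t⟩
      have := hz _ (hz _ h)
      rwa [smul_smul, smul_smul, Modular.x_inv_cube, one_smul] at this
    have hy' : ∀ t, Modular.y • t ∈ K ↔ t ∈ K := fun t => by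
      refine ⟨fun h => ?_, hy t⟩
      have := hy _ h
      rwa [smul_smul, Modular.y_mul_y, one_smul] at this
    have kz : ∀ s, (BraidThree.s1 * BraidThree.s2) • s ∈ π ⁻¹' K ↔ s ∈ π ⁻¹' K := fun s => by
      rw [Set.mem_preimage, hπ.equivariant, ← Modular.x_inv, hz', Set.mem_preimage]
    have kz' : ∀ s, (BraidThree.s1 * BraidThree.s2)⁻¹ • s ∈ π ⁻¹' K ↔ s ∈ π ⁻¹' K := fun s => by
      rw [← kz, smul_inv_smul]
    have ky : ∀ s, (BraidThree.s1 * BraidThree.s2 * BraidThree.s1) • s ∈ π ⁻¹' K ↔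
        s ∈ π ⁻¹' K := fun s => by
      rw [Set.mem_preimage, hπ.equivariant]
      exact hy' _
    have k1 : ∀ s, BraidThree.s1 • s ∈ π ⁻¹' K ↔ s ∈ π ⁻¹' K := fun s => by
      rw [BraidThree.s1_eq, mul_smul, kz', ky]
    have k2 : ∀ s, BraidThree.s2 • s ∈ π ⁻¹' K ↔ s ∈ π ⁻¹' K := fun s => by
      rw [BraidThree.s2_eq, mul_smul, ky, kz']
    rw [Set.eq_univ_iff_forall]
    intro t
    obtain ⟨t₀, ht₀⟩ := hK
    obtain ⟨s, rfl⟩ := hπ.surjective t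
    obtain ⟨s₀, rfl⟩ := hπ.surjective t₀
    obtain ⟨g, rfl⟩ := MulAction.exists_smul_eq BraidThree s₀ s
    exact (BraidThree.smul_mem k1 k2 g s₀).2 ht₀

variable [MulAction.IsPretransitive BraidThree S] {hπ : IsCovering π} {hxy : verticesXY T = ∅}

theorem IsCovering.σ₁_eq : (hπ.toModularCover hxy).σ₁ = MulAction.toPermHom _ S BraidThree.s1 := by
  rw [BraidThree.s1_eq, map_mul, map_inv]; rfl

theorem IsCovering.σ₂_eq : (hπ.toModularCover hxy).σ₂ = MulAction.toPermHom _ S BraidThree.s2 := by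
  rw [BraidThree.s2_eq, map_mul, map_inv]; rfl

theorem mem_cycleOf {G S : Type*} [Group G] [MulAction G S] {g : G} {v w : S} :
    w ∈ cycleOf g v ↔ ∃ n : ℤ, g ^ n • v = w := by
  constructor
  · rintro ⟨⟨h, n, rfl⟩, rfl⟩
    exact ⟨n, rfl⟩
  · rintro ⟨n, rfl⟩
    exact ⟨⟨g ^ n, n, rfl⟩, rfl⟩

theorem IsCovering.simplyIntersecting (hS : SimplyIntersectingCycles S) :
    (hπ.toModularCover hxy).SimplyIntersecting := by
  intro p m n h
  rw [σ₁_eq, σ₂_eq, ← map_zpow, ← map_zpow] at h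
  rw [σ₁_eq, ← map_zpow]
  have h1 := hS _ _ ((isCycle_iff BraidThree.s1 _).2 ⟨p, rfl⟩)
    ((isCycle_iff BraidThree.s2 _).2 ⟨p, rfl⟩)
  rw [Set.encard_le_one_iff] at h1
  exact h1 _ _ ⟨mem_cycleOf.2 ⟨m, rfl⟩, mem_cycleOf.2 ⟨n, h.symm⟩⟩
    ⟨mem_cycleOf.2 ⟨0, by simp⟩, mem_cycleOf.2 ⟨0, by simp⟩⟩

theorem IsCovering.closed_of_isQuarantine {Q : Set S} (hQ : IsQuarantine Q) :
    (hπ.toModularCover hxy).Closed Q := by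
  intro q
  have h := hQ.2 ((BraidThree.s1 * BraidThree.s2) • q)
  have e : BraidThree.s2 • (BraidThree.s1 * BraidThree.s2) • q = BraidThree.liftY • q := by
    rw [BraidThree.liftY, BraidThree.s1_s2_s1, mul_smul, mul_smul, mul_smul]
  rw [e] at h
  exact ⟨fun a b => h.1 b a, fun a b => h.2.2 a b, fun a b => h.2.1 a b⟩

theorem IsCovering.immunity_le [Fintype S] [Fintype T] [DecidableEq T] {c : ℕ}
    (hc : (hπ.toModularCover hxy).Cost Finset.univ c) :
    immunity S ≤ c / (Nat.card S : ℚ) := by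
  obtain ⟨P, hP, hcl⟩ := hc
  have huniv : ∀ Q : Set S, (hπ.toModularCover hxy).Closed Q → (P : Set S) ⊆ Q → Q = Set.univ := by
    intro Q hQ hsub
    rw [Set.eq_univ_iff_forall]
    exact fun s => hcl Q hQ hsub (π s) (Finset.mem_univ _) s rfl
  rw [immunity]
  rcases isEmpty_or_nonempty S with hS | ⟨⟨s₀⟩⟩
  · simp
  have hplague : IsPlague (P : Set S) := by
    refine ⟨?_, fun Q hQ => huniv Q (closed_of_isQuarantine hQ)⟩
    rw [Finset.coe_nonempty, Finset.nonempty_iff_ne_empty]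
    rintro rfl
    -- The empty set satisfies the closure rules.
    have := huniv ∅ (fun q => ⟨fun h => h.elim, fun h => h.elim, fun h => h.elim⟩) (by simp)
    exact Set.notMem_empty s₀ (this ▸ Set.mem_univ s₀)
  gcongr
  exact (Nat.sInf_le (s := {n | ∃ P : Set S, IsPlague P ∧ P.ncard = n})
    ⟨P, hplague, Set.ncard_coe_finset P⟩).trans hP

end Covering

section Weight

theorem quarter_le_weightMatrix (i j : ℕ) : 1 / 4 ≤ weightMatrix i j := by
  unfold weightMatrix
  split <;> norm_num

theorem weightMatrix_two_left (j : ℕ) : weightMatrix 2 j = 1 / 3 := by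
  unfold weightMatrix
  split <;> simp_all

theorem weightMatrix_two_right (i : ℕ) : weightMatrix i 2 = 1 / 3 := by
  unfold weightMatrix
  split <;> simp_all

theorem seven_le_weightMatrix_left (j : ℕ) : 7 / 24 ≤ weightMatrix 3 j := by
  unfold weightMatrix
  split <;> norm_num at *

theorem seven_le_weightMatrix_right (i : ℕ) : 7 / 24 ≤ weightMatrix i 3 := by
  unfold weightMatrix
  split <;> norm_num at *

theorem weightMatrix_le_pointWeight {S : Type*} [MulAction BraidThree S] (v : S) :
    weightMatrix (cycleOf BraidThree.s1 v).ncard (cycleOf BraidThree.s2 v).ncard ≤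
      pointWeight v := by
  unfold pointWeight
  split_ifs <;> norm_num

theorem ncard_cycleOf {G S : Type*} [Group G] [MulAction G S] [Finite S] (g : G) (v : S) :
    (cycleOf g v).ncard = Function.minimalPeriod (g • ·) v := by
  have : Fintype (MulAction.orbit (Subgroup.zpowers g) v) := Fintype.ofFinite _
  rw [cycleOf, ← Nat.card_coe_set_eq, Nat.card_eq_fintype_card, MulAction.minimalPeriod_eq_card]

theorem ncard_cycleOf_of_prime {G S : Type*} [Group G] [MulAction G S] [Finite S] {g : G}
    {v : S} {n : ℕ} (hn : n.Prime) (h : g ^ n • v = v) (hne : g • v ≠ v) :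
    (cycleOf g v).ncard = n := by
  rw [ncard_cycleOf]
  have h1 : Function.minimalPeriod (g • ·) v ∣ n := by
    apply Function.IsPeriodicPt.minimalPeriod_dvd
    rw [Function.IsPeriodicPt, smul_iterate]
    exact h
  rcases (Nat.dvd_prime hn).1 h1 with h2 | h2
  · rw [Function.minimalPeriod_eq_one_iff_isFixedPt] at h2
    exact absurd h2 hne
  · exact h2

end Weight

/-! ### The bound for coverings -/

namespace ModularCover

variable {S T : Type*} {C : ModularCover S T}

theorem σ₂_pow_y (n : ℕ) (q : S) : (C.σ₂ ^ n) (C.y q) = C.y ((C.σ₁ ^ n) q) := by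
  have h : SemiconjBy C.y C.σ₁ C.σ₂ := by
    rw [SemiconjBy, σ₁, σ₂, mul_assoc]
  exact (congrArg (fun g : Equiv.Perm S => g q) (h.pow_right n).eq).symm

theorem σ₁_ne (q : S) : C.σ₁ q ≠ q := by
  intro h
  have := C.proj_σ₁ q
  rw [h] at this
  apply C.ne_rotate (C.proj q)
  rw [← C.ζ_cube (C.η (C.proj q)), ← this]

theorem σ₂_ne (q : S) : C.σ₂ q ≠ q := by
  obtain ⟨q, rfl⟩ := C.y.surjective q
  have := C.σ₂_pow_y 1 q
  rw [pow_one, pow_one] at this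
  rw [this]
  exact fun h => σ₁_ne q (C.y.injective h)

theorem le_fiber_sum [Fintype S] [DecidableEq T] {t : T}
    {f : S → ℚ} {a : ℚ} (h : ∀ s, C.proj s = t → a ≤ f s) :
    4 * a * C.fiberSize ≤ 4 * ∑ s ∈ C.fiber t, f s := by
  have := Finset.card_nsmul_le_sum (C.fiber t) f a fun s hs => h s (C.mem_fiber.1 hs)
  rw [C.card_fiber, nsmul_eq_mul] at this
  linarith

end ModularCover

section Weight

variable {S T : Type*} [MulAction BraidThree S] [MulAction Modular T] {π : S → T}
  [MulAction.IsPretransitive BraidThree S] {hπ : IsCovering π} {hxy : verticesXY T = ∅}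

/-- If `σ₁ⁿ` is trivial over `t`, the points over `t` lie on `σ₁`-cycles of length `n`, and those
over `η t` on `σ₂`-cycles of length `n`. -/
theorem IsCovering.ncard_cycleOf [Finite S] {n : ℕ} (hn : n.Prime) {t : T}
    (h : ∀ q, (hπ.toModularCover hxy).proj q = t → ((hπ.toModularCover hxy).σ₁ ^ n) q = q) :
    (∀ s, (hπ.toModularCover hxy).proj s = t → (cycleOf BraidThree.s1 s).ncard = n) ∧
      ∀ s, (hπ.toModularCover hxy).proj s = (hπ.toModularCover hxy).η t →
        (cycleOf BraidThree.s2 s).ncard = n := by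
  set C := hπ.toModularCover hxy
  constructor
  · intro s hs
    refine ncard_cycleOf_of_prime hn ?_ ?_
    · have := h s hs
      rwa [σ₁_eq, ← map_pow] at this
    · have := C.σ₁_ne s
      rwa [σ₁_eq] at this
  · intro s hs
    refine ncard_cycleOf_of_prime hn ?_ ?_
    · obtain ⟨q, rfl⟩ := C.y.surjective s
      have := C.σ₂_pow_y n q
      rw [C.proj_y, C.η_inj] at hs
      rwa [h q hs, σ₂_eq, ← map_pow] at this
    · have := C.σ₂_ne s
      rwa [σ₂_eq] at this

end Weight

theorem theorem3p13 {S T : Type*} [MulAction BraidThree S] [MulAction.IsPretransitive BraidThree S]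
    [MulAction Modular T] [MulAction.IsPretransitive Modular T] [Finite T]
    (π : S → T) (hπ : IsCovering π) (hS : SimplyIntersectingCycles S)
    (hx : (verticesX T).Nonempty) (hxy : verticesXY T = ∅) :
    Finite S ∧ immunity S ≤ weight S := by
  classical
  set C := hπ.toModularCover hxy with hC
  obtain ⟨v, hv⟩ := hx
  have hleaf : C.ζ v = v := by
    change Modular.x⁻¹ • v = v
    rw [inv_smul_eq_iff]
    exact hv.symm
  have hfin : Finite S := C.finite_of_leaf hleaf
  have := Fintype.ofFinite S
  have := Fintype.ofFinite T
  refine ⟨hfin, ?_⟩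
  obtain ⟨c, hc, hle⟩ := ModularCover.exists_cost (C := C)
    (w := fun t => 4 * ∑ s ∈ C.fiber t, pointWeight s)
    (IsCovering.simplyIntersecting hS) hleaf
    (fun t => by
      have := C.le_fiber_sum (t := t) (a := 1 / 4) fun s _ =>
        (quarter_le_weightMatrix _ _).trans (weightMatrix_le_pointWeight s)
      linarith)
    (fun t ht => by
      obtain ⟨h1, h2⟩ := IsCovering.ncard_cycleOf Nat.prime_two ht
      have w1 := C.le_fiber_sum (t := t) (a := 1 / 3) fun s hs => by
        refine le_trans ?_ (weightMatrix_le_pointWeight s)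
        rw [h1 s hs, weightMatrix_two_left]
      have w2 := C.le_fiber_sum (t := C.η t) (a := 1 / 3) fun s hs => by
        refine le_trans ?_ (weightMatrix_le_pointWeight s)
        rw [h2 s hs, weightMatrix_two_right]
      constructor <;> linarith)
    (fun t ht => by
      obtain ⟨h1, h2⟩ := IsCovering.ncard_cycleOf Nat.prime_three ht
      have w1 := C.le_fiber_sum (t := t) (a := 7 / 24) fun s hs => by
        refine le_trans ?_ (weightMatrix_le_pointWeight s)
        rw [h1 s hs]
        exact seven_le_weightMatrix_left _
      have w2 := C.le_fiber_sum (t := C.η t) (a := 7 / 24) fun s hs => by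
        refine le_trans ?_ (weightMatrix_le_pointWeight s)
        rw [h2 s hs]
        exact seven_le_weightMatrix_right _
      constructor <;> linarith)
  refine (IsCovering.immunity_le hc).trans ?_
  rw [weight, finsum_eq_sum_of_fintype]
  gcongr
  rw [← Finset.mul_sum] at hle
  have hsum : ∑ t, ∑ s ∈ C.fiber t, pointWeight s = ∑ s : S, pointWeight s :=
    Finset.sum_fiberwise _ _ _
  rw [hsum] at hle
  linarith
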